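/- Let $n,m,M,N\ge 0$ and $r\ge 2$ be integers, and let $c_{-M}<\dots<c_0<\dots<c_N$ be real numbers; put $c_{-M-1}=-\infty$. Let $h:\mathbb R^n\times\mathbb R^m\to\mathbb R$ be of class $C^r$ with bounded derivatives of orders $1,\dots,r$, and for $-M\le\ell\le N$ let $f_\ell:\mathbb R^n\times\mathbb R^m\to\mathbb R^n$ be of class $C^r$, bounded together with its derivatives up to order $r$. Put $\Omega_0=\{(x,y): c_{-1}\le h(x,y)<c_0\}$. *Solutions.* Let $u_+(t,y)$ ($t\ge 0$, $y\in\mathbb R^m$) be continuous in $t$, and suppose there are $\eta>0$ (independent of $y$) and times $0=t_0(y)<t_1(y)<\dots<t_N(y)$ such that for every $y$: - $\dot u_+=f_{i-1}(u_+,y)$ for $t_{i-1}(y)<t<t_i(y)$ ($1\le i\le N$), and $\dot u_+=f_N(u_+,y)$ for $t>t_N(y)$; - $h(u_+(t_i(y),y),y)=c_{i-1}$ and $h_x(u_+(t_i(y),y),y)\,\dot u_+(t_i(y)^\pm,y)>2\eta$ ($1\le i\le N$); - $c_{i-1}<h(u_+(t,y),y)<c_i$ for $t_i(y)<t<t_{i+1}(y)$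 ($0\le i\le N-1$), and $h(u_+(t,y),y)>c_{N-1}$ for $t>t_N(y)$. Symmetrically, let $u_-(t,y)$ ($t\le 0$) be continuous in $t$, and suppose there are $\eta>0$ (independent of $y$) and times $t_{-M}(y)<\dots<t_{-1}(y)<t_0(y)=0$ such that for every $y$ and every $-M\le j\le -1$: - $\dot u_-=f_{j+1}(u_-,y)$ for $t_j(y)<t<t_{j+1}(y)$; - $h(u_-(t_j(y),y),y)=c_j$ and $h_x(u_-(t_j(y),y),y)\,\dot u_-(t_j(y)^\pm,y)>2\eta$; - $c_j<h(u_-(t,y),y)<c_{j+1}$ for $t_j(y)<t<t_{j+1}(y)$; and, moreover, $\dot u_-=f_{-M}(u_-,y)$ and $h(u_-(t,y),y)<c_{-M}$ for $t<t_{-M}(y)$. *Assumptions.* - A1) The functions $y\mapsto u_\pm(0,y)$ are of class $C^r$, bounded together with their derivatives up to order $r$, and take values in a bounded open set $B\subset\mathbb R^n$ with $\overline B\times\mathbb R^m\subset\Omega_0$. - A2) There are bounded $C^r$ functions $w_\pm:\mathbb R^m\to\mathbb R^n$ and $\mu_0>0$ such that, for all $y$, $f_N(w_+(y),y)=0=f_{-M}(w_-(y),y)$,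 $h(w_+(y),y)-c_{N-1}>\mu_0$ and $h(w_-(y),y)-c_{-M}<-\mu_0$; and $u_\pm(t,y)-w_\pm(y)\to0$ as $t\to\pm\infty$, uniformly in $y\in\mathbb R^m$. - A3) There are an integer $k$ and $\delta_0>0$ such that, for every $y$, each of the matrices $f_{N,x}(w_+(y),y)$ and $f_{-M,x}(w_-(y),y)$ has $k$ eigenvalues with negative real part and $n-k$ eigenvalues with positive real part, counted with multiplicities, and all these eigenvalues $\lambda$ satisfy $|\mathrm{Re}\,\lambda|>\delta_0$. Let $u^+_N(\cdot,y)$ be the solution on $t\ge0$ of $\dot x=f_N(x,y)$ with $u^+_N(t_N(y),y)=u_+(t_N(y),y)$, and let $u^-_{-M}(\cdot,y)$ be the solution on $t\le 0$ of $\dot x=f_{-M}(x,y)$ with $u^-_{-M}(t_{-M}(y),y)=u_-(t_{-M}(y),y)$. **Claim.** Assume A1)–A3). Then $u^+_N(t,\cdot)$ is of class $C^r$ near $y$ whenever $t\ge t_N(y)$, and for each $p=0,1,\dots,r$ $$\sup_{y\in\mathbb R^m}\ \sup_{t\ge t_N(y)}\left|\frac{\partial^p u^+_N}{\partial y^p}(t,y)\right|<\infty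 .$$ Similarly, $u^-_{-M}(t,\cdot)$ is of class $C^r$ near $y$ whenever $t\le t_{-M}(y)$, and for each $p=0,1,\dots,r$ $$\sup_{y\in\mathbb R^m}\ \sup_{t\le t_{-M}(y)}\left|\frac{\partial^p u^-_{-M}}{\partial y^p}(t,y)\right|<\infty .$$ -/

import Mathlib

open Set Filter Topology

noncomputable section

/-- `g` is of class `C^r`, and `g` and all its derivatives up to order `r` are bounded. -/
def BddWithDerivs {E F : Type*} [NormedAddCommGroup E] [NormedSpace ℝ E]
    [NormedAddCommGroup F] [NormedSpace ℝ F] (r : ℕ) (g : E → F) : Prop :=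
  ContDiff ℝ r g ∧ ∀ k : ℕ, k ≤ r → ∃ C : ℝ, ∀ z, ‖iteratedFDeriv ℝ k g z‖ ≤ C

/-- The complex eigenvalues of a real linear map, with their algebraic multiplicities. -/
def complexEigenvalues {n : ℕ}
    (A : EuclideanSpace ℝ (Fin n) →L[ℝ] EuclideanSpace ℝ (Fin n)) : Multiset ℂ :=
  ((A : EuclideanSpace ℝ (Fin n) →ₗ[ℝ] EuclideanSpace ℝ (Fin n)).charpoly.map
    (algebraMap ℝ ℂ)).roots

/-- `A` has `k` eigenvalues with negative real part and `n - k` with positive real part, counted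
with multiplicities, and `|Re lambda| > delta` for each of them. -/
def HyperbolicSpectrum {n : ℕ} (k : ℕ) (δ : ℝ)
    (A : EuclideanSpace ℝ (Fin n) →L[ℝ] EuclideanSpace ℝ (Fin n)) : Prop :=
  (complexEigenvalues A).countP (fun z => z.re < 0) = k ∧
  (complexEigenvalues A).countP (fun z => 0 < z.re) = n - k ∧
  ∀ z ∈ complexEigenvalues A, δ < |z.re|

/-- The data of the discontinuous equation `x' = f_ℓ(x,y)` for `(x,y) ∈ Ω_ℓ`, `-M ≤ ℓ ≤ N`.
Only the values `c ℓ` and `f ℓ` with `-M ≤ ℓ ≤ N` matter. -/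
structure DiscSystem (n m : ℕ) where
  /-- order of smoothness -/
  r : ℕ
  two_le_r : 2 ≤ r
  M : ℕ
  N : ℕ
  /-- the levels `c_{-M} < ... < c_0 < ... < c_N` -/
  c : ℤ → ℝ
  c_lt : ∀ ℓ : ℤ, -(M : ℤ) ≤ ℓ → ℓ < N → c ℓ < c (ℓ + 1)
  h : EuclideanSpace ℝ (Fin n) × EuclideanSpace ℝ (Fin m) → ℝ
  h_contDiff : ContDiff ℝ r h
  /-- the derivatives of `h` are bounded; `h` itself need not be -/
  h_bdd : ∀ k : ℕ, 1 ≤ k → k ≤ r → ∃ C : ℝ, ∀ z, ‖iteratedFDeriv ℝ k h z‖ ≤ C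
  f : ℤ → EuclideanSpace ℝ (Fin n) × EuclideanSpace ℝ (Fin m) → EuclideanSpace ℝ (Fin n)
  f_bdd : ∀ ℓ : ℤ, -(M : ℤ) ≤ ℓ → ℓ ≤ N → BddWithDerivs r (f ℓ)

namespace DiscSystem

variable {n m : ℕ} (S : DiscSystem n m)

/-- The levels with the convention `c_{-M-1} = -∞`. -/
def level (ℓ : ℤ) : EReal := if ℓ < -(S.M : ℤ) then ⊥ else (S.c ℓ : EReal)

/-- `Ω_ℓ = {(x,y) | c_{ℓ-1} ≤ h(x,y) < c_ℓ}`. -/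
def region (ℓ : ℤ) : Set (EuclideanSpace ℝ (Fin n) × EuclideanSpace ℝ (Fin m)) :=
  {p | S.level (ℓ - 1) ≤ (S.h p : EReal) ∧ (S.h p : EReal) < S.level ℓ}

/-- `h_x(x,y) v` -/
def hx (x : EuclideanSpace ℝ (Fin n)) (y : EuclideanSpace ℝ (Fin m))
    (v : EuclideanSpace ℝ (Fin n)) : ℝ :=
  fderiv ℝ (fun x' => S.h (x', y)) x v

/-- `f_{ℓ,x}(x,y)` -/
def fx (ℓ : ℤ) (x : EuclideanSpace ℝ (Fin n)) (y : EuclideanSpace ℝ (Fin m)) :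
    EuclideanSpace ℝ (Fin n) →L[ℝ] EuclideanSpace ℝ (Fin n) :=
  fderiv ℝ (fun x' => S.f ℓ (x', y)) x

/-- `u(t,y)`, `t ≥ 0`, is for each `y` a continuous, piecewise smooth solution which crosses
transversally the sets `h = c_{i-1}` at the times `t_i(y)`, `0 = t_0(y) < t_1(y) < ... < t_N(y)`.
By the differential equation, the one-sided derivatives of `u` at `t_i(y)` are
`f_{i-1}(u(t_i(y),y),y)` from the left and `f_i(u(t_i(y),y),y)` from the right. -/
structure IsForwardSolution
    (u : ℝ → EuclideanSpace ℝ (Fin m) → EuclideanSpace ℝ (Fin n))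
    (t : ℤ → EuclideanSpace ℝ (Fin m) → ℝ) : Prop where
  cont : ∀ y, ContinuousOn (fun s => u s y) (Ici 0)
  t_zero : ∀ y, t 0 y = 0
  t_lt : ∀ i : ℤ, 0 ≤ i → i < S.N → ∀ y, t i y < t (i + 1) y
  deriv : ∀ i : ℤ, 1 ≤ i → i ≤ S.N → ∀ y s, t (i - 1) y < s → s < t i y →
    HasDerivAt (fun τ => u τ y) (S.f (i - 1) (u s y, y)) s
  deriv_last : ∀ y s, t S.N y < s → HasDerivAt (fun τ => u τ y) (S.f S.N (u s y, y)) s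
  crossing : ∀ i : ℤ, 1 ≤ i → i ≤ S.N → ∀ y, S.h (u (t i y) y, y) = S.c (i - 1)
  transversal : ∃ η : ℝ, 0 < η ∧ ∀ i : ℤ, 1 ≤ i → i ≤ S.N → ∀ y,
    2 * η < S.hx (u (t i y) y) y (S.f (i - 1) (u (t i y) y, y)) ∧
    2 * η < S.hx (u (t i y) y) y (S.f i (u (t i y) y, y))
  between : ∀ i : ℤ, 0 ≤ i → i < S.N → ∀ y s, t i y < s → s < t (i + 1) y →
    S.level (i - 1) < (S.h (u s y, y) : EReal) ∧ (S.h (u s y, y) : EReal) < S.level i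
  above_last : ∀ y s, t S.N y < s → S.level (S.N - 1) < (S.h (u s y, y) : EReal)

/-- `u(t,y)`, `t ≤ 0`, is for each `y` a continuous, piecewise smooth solution which crosses
transversally the sets `h = c_j` at the times `t_j(y)`, `t_{-M}(y) < ... < t_{-1}(y) < t_0(y) = 0`.
By the differential equation, the one-sided derivatives of `u` at `t_j(y)` are
`f_j(u(t_j(y),y),y)` from the left and `f_{j+1}(u(t_j(y),y),y)` from the right. -/
structure IsBackwardSolution
    (u : ℝ → EuclideanSpace ℝ (Fin m) → EuclideanSpace ℝ (Fin n))
    (t : ℤ → EuclideanSpace ℝ (Fin m) → ℝ) : Prop where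
  cont : ∀ y, ContinuousOn (fun s => u s y) (Iic 0)
  t_zero : ∀ y, t 0 y = 0
  t_lt : ∀ j : ℤ, -(S.M : ℤ) ≤ j → j ≤ -1 → ∀ y, t j y < t (j + 1) y
  deriv : ∀ j : ℤ, -(S.M : ℤ) ≤ j → j ≤ -1 → ∀ y s, t j y < s → s < t (j + 1) y →
    HasDerivAt (fun τ => u τ y) (S.f (j + 1) (u s y, y)) s
  deriv_last : ∀ y s, s < t (-(S.M : ℤ)) y →
    HasDerivAt (fun τ => u τ y) (S.f (-(S.M : ℤ)) (u s y, y)) s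
  crossing : ∀ j : ℤ, -(S.M : ℤ) ≤ j → j ≤ -1 → ∀ y, S.h (u (t j y) y, y) = S.c j
  transversal : ∃ η : ℝ, 0 < η ∧ ∀ j : ℤ, -(S.M : ℤ) ≤ j → j ≤ -1 → ∀ y,
    2 * η < S.hx (u (t j y) y) y (S.f j (u (t j y) y, y)) ∧
    2 * η < S.hx (u (t j y) y) y (S.f (j + 1) (u (t j y) y, y))
  between : ∀ j : ℤ, -(S.M : ℤ) ≤ j → j ≤ -1 → ∀ y s, t j y < s → s < t (j + 1) y →
    S.c j < S.h (u s y, y) ∧ S.h (u s y, y) < S.c (j + 1)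
  below_last : ∀ y s, s < t (-(S.M : ℤ)) y → S.h (u s y, y) < S.c (-(S.M : ℤ))

/-- Assumption A1: `u_±(0,·)` are bounded together with their derivatives and take values in a
bounded open set `B` with `closure B × ℝ^m ⊆ Ω_0`. -/
def A1 (up um : ℝ → EuclideanSpace ℝ (Fin m) → EuclideanSpace ℝ (Fin n)) : Prop :=
  BddWithDerivs S.r (up 0) ∧ BddWithDerivs S.r (um 0) ∧
  ∃ B : Set (EuclideanSpace ℝ (Fin n)), IsOpen B ∧ Bornology.IsBounded B ∧
    (∀ y, up 0 y ∈ B ∧ um 0 y ∈ B) ∧ closure B ×ˢ univ ⊆ S.region 0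

/-- Assumption A2: `w_±` are smooth and bounded families of equilibria of `f_N`, resp. `f_{-M}`,
uniformly inside `h > c_{N-1}`, resp. `h < c_{-M}`, and `u_±(t,y) → w_±(y)` as `t → ±∞`
uniformly in `y`. -/
def A2 (up um : ℝ → EuclideanSpace ℝ (Fin m) → EuclideanSpace ℝ (Fin n))
    (wp wm : EuclideanSpace ℝ (Fin m) → EuclideanSpace ℝ (Fin n)) : Prop :=
  ContDiff ℝ S.r wp ∧ ContDiff ℝ S.r wm ∧
  (∃ C : ℝ, ∀ y, ‖wp y‖ ≤ C ∧ ‖wm y‖ ≤ C) ∧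
  (∀ y, S.f S.N (wp y, y) = 0 ∧ S.f (-(S.M : ℤ)) (wm y, y) = 0) ∧
  (∃ μ₀ : ℝ, 0 < μ₀ ∧ ∀ y, S.level (S.N - 1) + (μ₀ : EReal) < (S.h (wp y, y) : EReal) ∧
    S.h (wm y, y) - S.c (-(S.M : ℤ)) < -μ₀) ∧
  TendstoUniformly up wp atTop ∧ TendstoUniformly um wm atBot

/-- Assumption A3: uniform hyperbolicity of the equilibria, with the same number `k` of
eigenvalues in the left half-plane at `w_+(y)` and at `w_-(y)`, for all `y`. -/
def A3 (wp wm : EuclideanSpace ℝ (Fin m) → EuclideanSpace ℝ (Fin n)) : Prop :=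
  ∃ k : ℕ, ∃ δ₀ : ℝ, 0 < δ₀ ∧ ∀ y,
    HyperbolicSpectrum k δ₀ (S.fx S.N (wp y) y) ∧
    HyperbolicSpectrum k δ₀ (S.fx (-(S.M : ℤ)) (wm y) y)

/-- `v(·,y)` is the solution on `t ≥ 0` of `x' = f_N(x,y)` with `v(t_N(y),y) = u(t_N(y),y)`. -/
def IsForwardTail (u : ℝ → EuclideanSpace ℝ (Fin m) → EuclideanSpace ℝ (Fin n))
    (t : ℤ → EuclideanSpace ℝ (Fin m) → ℝ)
    (v : ℝ → EuclideanSpace ℝ (Fin m) → EuclideanSpace ℝ (Fin n)) : Prop :=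
  ∀ y, v (t S.N y) y = u (t S.N y) y ∧
    ∀ s, 0 ≤ s → HasDerivWithinAt (fun τ => v τ y) (S.f S.N (v s y, y)) (Ici 0) s

/-- `v(·,y)` is the solution on `t ≤ 0` of `x' = f_{-M}(x,y)` with
`v(t_{-M}(y),y) = u(t_{-M}(y),y)`. -/
def IsBackwardTail (u : ℝ → EuclideanSpace ℝ (Fin m) → EuclideanSpace ℝ (Fin n))
    (t : ℤ → EuclideanSpace ℝ (Fin m) → ℝ)
    (v : ℝ → EuclideanSpace ℝ (Fin m) → EuclideanSpace ℝ (Fin n)) : Prop :=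
  ∀ y, v (t (-(S.M : ℤ)) y) y = u (t (-(S.M : ℤ)) y) y ∧
    ∀ s, s ≤ 0 → HasDerivWithinAt (fun τ => v τ y) (S.f (-(S.M : ℤ)) (v s y, y)) (Iic 0) s

end DiscSystem

end

/-! Time is cut at some `T₀` independent of `y`. Before `T₀` everything happens on bounded time
intervals, where Grönwall's inequality is harmless. The gap in A2 forces the last crossing to occur
before a uniform time, and transversality with a uniform constant makes each crossing time an
implicit function with bounded derivatives. Induction over the crossings (`bddWithDerivs_crossing`)
then gives smooth, bounded data for the tail. Regularity of the crossing times is not assumed: their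
continuity comes from their being first zeros (`continuousAt_firstZero`).

After `T₀` Grönwall's constants blow up, and hyperbolicity takes over. No stable manifold is
constructed. The point is that the solutions are already known to be bounded, and a bounded solution
of `e' = A e + g` with `A` hyperbolic is controlled by `e(a)` and `sup ‖g‖`: stable modes are
governed by the past, unstable ones by the future. This is `exists_norm_le_of_bounded_solution`,
proved by peeling off one linear factor of the characteristic polynomial at a time. Hence its
constant depends only on the dimension, the norm bound and the spectral gap, never on a choice of
eigenvectors. Near the equilibria the linearization along the solution is a small perturbation of
such an `A`, which is absorbed (`exists_bddSolutionEstimate_Ici`).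

Applied to the difference of two nearby solutions, the estimate gives a Lipschitz constant in `y`
uniform in time and in `y`, that is, a bound on the first derivative. Differentiating the equation
again changes only the forcing, which involves lower order derivatives, so all further orders follow
by induction (`derivBdd_of_linear`, `derivBdd_of_solution`). Differentiability itself is the
classical theorem on compact intervals. The backward statement is the forward one after time
reversal. -/

/-! ### Families of maps with uniformly bounded derivatives. -/

/-- A family `v s`, `s ∈ J`, of maps is jointly continuous together with its derivatives up to
order `k`, and its derivatives of orders `1, ..., k` are bounded uniformly in `s ∈ J`. -/
def DerivBdd {W : Type} [NormedAddCommGroup W] [NormedSpace ℝ W] (J : Set ℝ) :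
    ℕ → ∀ {V : Type} [NormedAddCommGroup V] [NormedSpace ℝ V], (ℝ → W → V) → Prop
  | 0, _, _, _, v => ContinuousOn (fun p : ℝ × W => v p.1 p.2) (J ×ˢ univ)
  | k + 1, _, _, _, v => ContinuousOn (fun p : ℝ × W => v p.1 p.2) (J ×ˢ univ) ∧
      (∀ s ∈ J, ∀ w, DifferentiableAt ℝ (v s) w) ∧
      (∃ C, ∀ s ∈ J, ∀ w, ‖fderiv ℝ (v s) w‖ ≤ C) ∧
      DerivBdd J k (fun s w => fderiv ℝ (v s) w)

/-- A family of maps is bounded uniformly in `s ∈ J`. -/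
def UnifBdd {W V : Type} [NormedAddCommGroup V] (J : Set ℝ) (v : ℝ → W → V) : Prop :=
  ∃ C, ∀ s ∈ J, ∀ w, ‖v s w‖ ≤ C

section UniformlyBounded

variable {W V V₁ V₂ V₃ : Type}
  [NormedAddCommGroup V] [NormedSpace ℝ V] [NormedAddCommGroup V₁] [NormedSpace ℝ V₁]
  [NormedAddCommGroup V₂] [NormedSpace ℝ V₂] [NormedAddCommGroup V₃] [NormedSpace ℝ V₃]
  {J : Set ℝ}

theorem UnifBdd.bilin (B : V₁ →L[ℝ] V₂ →L[ℝ] V₃) {a : ℝ → W → V₁} {b : ℝ → W → V₂}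
    (ha : UnifBdd J a) (hb : UnifBdd J b) : UnifBdd J (fun s w => B (a s w) (b s w)) := by
  obtain ⟨C, hC⟩ := ha
  obtain ⟨D, hD⟩ := hb
  refine ⟨‖B‖ * C * D, fun s hs w => (B.le_opNorm₂ _ _).trans ?_⟩
  have := hC s hs w
  have := hD s hs w
  have := (norm_nonneg (a s w)).trans (hC s hs w)
  gcongr

theorem UnifBdd.add {W V : Type} [NormedAddCommGroup V] {J : Set ℝ} {a b : ℝ → W → V}
    (ha : UnifBdd J a) (hb : UnifBdd J b) :
    UnifBdd J (fun s w => a s w + b s w) := by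
  obtain ⟨C, hC⟩ := ha
  obtain ⟨D, hD⟩ := hb
  exact ⟨C + D, fun s hs w => norm_add_le_of_le (hC s hs w) (hD s hs w)⟩

theorem UnifBdd.clm_comp (L : V →L[ℝ] V₁) {a : ℝ → W → V} (ha : UnifBdd J a) :
    UnifBdd J (fun s w => L (a s w)) := by
  obtain ⟨C, hC⟩ := ha
  exact ⟨‖L‖ * C, fun s hs w => L.le_opNorm_of_le (hC s hs w)⟩

end UniformlyBounded

/-! ### Sums, products and compositions in the uniform smoothness class. -/

section Calculus

variable {W V V₁ V₂ V₃ Z : Type} [NormedAddCommGroup W] [NormedSpace ℝ W]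
  [NormedAddCommGroup V] [NormedSpace ℝ V] [NormedAddCommGroup V₁] [NormedSpace ℝ V₁]
  [NormedAddCommGroup V₂] [NormedSpace ℝ V₂] [NormedAddCommGroup V₃] [NormedSpace ℝ V₃]
  [NormedAddCommGroup Z] [NormedSpace ℝ Z] {J : Set ℝ} {k : ℕ}

namespace DerivBdd

theorem continuousOn {v : ℝ → W → V} (h : DerivBdd J k v) :
    ContinuousOn (fun p : ℝ × W => v p.1 p.2) (J ×ˢ univ) := by
  cases k with
  | zero => exact h
  | succ k => exact h.1

theorem congr : ∀ {k : ℕ} {V : Type} [NormedAddCommGroup V] [NormedSpace ℝ V]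
    {v v' : ℝ → W → V}, DerivBdd J k v → (∀ s ∈ J, v' s = v s) → DerivBdd J k v'
  | 0, _, _, _, _, _, h, e => ContinuousOn.congr h fun p hp => congrFun (e p.1 hp.1) p.2
  | k + 1, _, _, _, _, _, ⟨h1, h2, ⟨C, hC⟩, h4⟩, e =>
    ⟨ContinuousOn.congr h1 fun p hp => congrFun (e p.1 hp.1) p.2,
      fun s hs w => (e s hs).symm ▸ h2 s hs w, ⟨C, fun s hs w => (e s hs).symm ▸ hC s hs w⟩,
      congr h4 fun s hs => by simp only [e s hs]⟩

theorem mono : ∀ {k : ℕ} {J' : Set ℝ} {V : Type} [NormedAddCommGroup V] [NormedSpace ℝ V]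
    {v : ℝ → W → V}, DerivBdd J k v → J' ⊆ J → DerivBdd J' k v
  | 0, _, _, _, _, _, h, e => ContinuousOn.mono h (prod_mono e le_rfl)
  | k + 1, _, _, _, _, _, ⟨h1, h2, ⟨C, hC⟩, h4⟩, e =>
    ⟨h1.mono (prod_mono e le_rfl), fun s hs w => h2 s (e hs) w, ⟨C, fun s hs w => hC s (e hs) w⟩,
      mono h4 e⟩

theorem of_succ : ∀ {k : ℕ} {V : Type} [NormedAddCommGroup V] [NormedSpace ℝ V]
    {v : ℝ → W → V}, DerivBdd J (k + 1) v → DerivBdd J k v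
  | 0, _, _, _, _, h => h.1
  | k + 1, _, _, _, _, ⟨h1, h2, h3, h4⟩ => ⟨h1, h2, h3, of_succ h4⟩

theorem of_le {v : ℝ → W → V} {k' : ℕ} (h : DerivBdd J k v) (hk : k' ≤ k) : DerivBdd J k' v := by
  induction k, hk using Nat.le_induction with
  | base => exact h
  | succ k _ ih => exact ih h.of_succ

/-- Lets a derivative be supplied as an explicit formula; the closure properties and the bootstraps
below enter the class through it. -/
theorem succ_intro {v : ℝ → W → V} {v' : ℝ → W → W →L[ℝ] V}
    (hc : ContinuousOn (fun p : ℝ × W => v p.1 p.2) (J ×ˢ univ))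
    (hd : ∀ s ∈ J, ∀ w, HasFDerivAt (v s) (v' s w) w) (hb : UnifBdd J v')
    (h : DerivBdd J k v') : DerivBdd J (k + 1) v := by
  obtain ⟨C, hC⟩ := hb
  have e : ∀ s ∈ J, (fun w => fderiv ℝ (v s) w) = v' s := fun s hs =>
    funext fun w => (hd s hs w).fderiv
  exact ⟨hc, fun s hs w => (hd s hs w).differentiableAt,
    ⟨C, fun s hs w => by rw [(hd s hs w).fderiv]; exact hC s hs w⟩, h.congr e⟩

theorem hasFDerivAt {v : ℝ → W → V} (h : DerivBdd J (k + 1) v) {s : ℝ} (hs : s ∈ J) (w : W) :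
    HasFDerivAt (v s) (fderiv ℝ (v s) w) w := (h.2.1 s hs w).hasFDerivAt

theorem unifBdd_fderiv {v : ℝ → W → V} (h : DerivBdd J (k + 1) v) :
    UnifBdd J (fun s w => fderiv ℝ (v s) w) := h.2.2.1

theorem fderiv {v : ℝ → W → V} (h : DerivBdd J (k + 1) v) :
    DerivBdd J k (fun s w => fderiv ℝ (v s) w) := h.2.2.2

theorem const (c : V) : ∀ {k : ℕ}, DerivBdd J k (fun _ (_ : W) => c) := by
  intro k
  induction k generalizing V with
  | zero => exact continuousOn_const
  | succ k ih =>
    exact succ_intro continuousOn_const (v' := fun _ _ => 0) (fun s _ w => hasFDerivAt_const c w)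
      ⟨0, by simp⟩ (ih 0)

theorem clm (L : W →L[ℝ] V) : DerivBdd J k (fun _ w => L w) := by
  have hc : ContinuousOn (fun p : ℝ × W => L p.2) (J ×ˢ univ) :=
    (L.continuous.comp continuous_snd).continuousOn
  cases k with
  | zero => exact hc
  | succ k =>
    exact succ_intro hc (v' := fun _ _ => L) (fun s _ w => L.hasFDerivAt) ⟨‖L‖, by simp⟩ (const L)

theorem clm_comp (L : V →L[ℝ] V₁) {v : ℝ → W → V} (h : DerivBdd J k v) :
    DerivBdd J k (fun s w => L (v s w)) := by
  induction k generalizing V V₁ with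
  | zero => exact L.continuous.comp_continuousOn h
  | succ k ih =>
    obtain ⟨C, hC⟩ := h.unifBdd_fderiv
    exact succ_intro (v' := fun s w => L.comp (_root_.fderiv ℝ (v s) w))
      (L.continuous.comp_continuousOn h.continuousOn)
      (fun s hs w => L.hasFDerivAt.comp w (h.hasFDerivAt hs w))
      ⟨‖L‖ * C, fun s hs w => (L.opNorm_comp_le _).trans
        (mul_le_mul_of_nonneg_left (hC s hs w) (norm_nonneg _))⟩
      (ih (ContinuousLinearMap.compL ℝ W V V₁ L) h.fderiv)

theorem prodMk {v : ℝ → W → V} {v₁ : ℝ → W → V₁} (h : DerivBdd J k v) (h₁ : DerivBdd J k v₁) :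
    DerivBdd J k (fun s w => (v s w, v₁ s w)) := by
  induction k generalizing V V₁ with
  | zero => exact ContinuousOn.prodMk h h₁
  | succ k ih =>
    obtain ⟨C, hC⟩ := h.unifBdd_fderiv
    obtain ⟨C₁, hC₁⟩ := h₁.unifBdd_fderiv
    refine succ_intro (v' := fun s w => (_root_.fderiv ℝ (v s) w).prod (_root_.fderiv ℝ (v₁ s) w))
      (h.continuousOn.prodMk h₁.continuousOn)
      (fun s hs w => (h.hasFDerivAt hs w).prodMk (h₁.hasFDerivAt hs w))
      ⟨max C C₁, fun s hs w => ?_⟩ ?_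
    · rw [ContinuousLinearMap.opNorm_prod]
      exact max_le_max (hC s hs w) (hC₁ s hs w)
    · let e : ((W →L[ℝ] V) × (W →L[ℝ] V₁)) ≃ₗᵢ[ℝ] (W →L[ℝ] V × V₁) :=
        ContinuousLinearMap.prodₗᵢ ℝ
      exact clm_comp e.toContinuousLinearEquiv.toContinuousLinearMap (ih h.fderiv h₁.fderiv)

theorem add {v v₁ : ℝ → W → V} (h : DerivBdd J k v) (h₁ : DerivBdd J k v₁) :
    DerivBdd J k (fun s w => v s w + v₁ s w) :=
  clm_comp (ContinuousLinearMap.fst ℝ V V + ContinuousLinearMap.snd ℝ V V) (h.prodMk h₁)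

theorem neg {v : ℝ → W → V} (h : DerivBdd J k v) : DerivBdd J k (fun s w => -v s w) :=
  clm_comp (-ContinuousLinearMap.id ℝ V) h

theorem sub {v v₁ : ℝ → W → V} (h : DerivBdd J k v) (h₁ : DerivBdd J k v₁) :
    DerivBdd J k (fun s w => v s w - v₁ s w) :=
  clm_comp (ContinuousLinearMap.fst ℝ V V - ContinuousLinearMap.snd ℝ V V) (h.prodMk h₁)

end DerivBdd

namespace DerivBdd

theorem bilin (B : V₁ →L[ℝ] V₂ →L[ℝ] V₃) {a : ℝ → W → V₁} {b : ℝ → W → V₂}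
    (ha : DerivBdd J k a) (ha' : UnifBdd J a) (hb : DerivBdd J k b) (hb' : UnifBdd J b) :
    DerivBdd J k (fun s w => B (a s w) (b s w)) := by
  have hc : ContinuousOn (fun p : ℝ × W => B (a p.1 p.2) (b p.1 p.2)) (J ×ˢ univ) :=
    (B.continuous.comp_continuousOn ha.continuousOn).clm_apply hb.continuousOn
  induction k generalizing V₁ V₂ V₃ with
  | zero => exact hc
  | succ k ih =>
    have hC := ha.unifBdd_fderiv
    have hD := hb.unifBdd_fderiv
    refine succ_intro (v' := fun s w => B.precompR W (a s w) (_root_.fderiv ℝ (b s) w) +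
        B.precompL W (_root_.fderiv ℝ (a s) w) (b s w)) hc
      (fun s hs w => B.hasFDerivAt_of_bilinear (ha.hasFDerivAt hs w) (hb.hasFDerivAt hs w))
      ((ha'.bilin (B.precompR W) hD).add (hC.bilin (B.precompL W) hb')) (add ?_ ?_)
    · exact ih (B.precompR W) ha.of_succ ha' hb.fderiv hD
        (((B.precompR W).continuous.comp_continuousOn ha.continuousOn).clm_apply
          hb.fderiv.continuousOn)
    · exact ih (B.precompL W) ha.fderiv hC hb.of_succ hb'
        (((B.precompL W).continuous.comp_continuousOn ha.fderiv.continuousOn).clm_apply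
          hb.continuousOn)

/-- The chain rule writes the derivative as a bilinear expression in `DG ∘ v` and `Dv`; both are
bounded, so `bilin` applies although `v` itself may be unbounded. -/
theorem comp {G : Z → V} {v : ℝ → W → Z} (hG : DerivBdd univ k (fun _ => G))
    (hv : DerivBdd J k v) : DerivBdd J k (fun s w => G (v s w)) := by
  have hc : ContinuousOn (fun p : ℝ × W => G (v p.1 p.2)) (J ×ˢ univ) :=
    hG.continuousOn.comp (f := fun p : ℝ × W => ((0 : ℝ), v p.1 p.2))
      (continuousOn_const.prodMk hv.continuousOn) (fun _ _ => ⟨trivial, trivial⟩)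
  induction k generalizing V with
  | zero => exact hc
  | succ k ih =>
    obtain ⟨C, hC⟩ := hG.unifBdd_fderiv
    have hD := hv.unifBdd_fderiv
    have h1 : UnifBdd J (fun s w => _root_.fderiv ℝ G (v s w)) :=
      ⟨C, fun s hs w => hC s trivial _⟩
    have hc' : ContinuousOn (fun p : ℝ × W => _root_.fderiv ℝ G (v p.1 p.2)) (J ×ˢ univ) :=
      hG.fderiv.continuousOn.comp (f := fun p : ℝ × W => ((0 : ℝ), v p.1 p.2))
        (continuousOn_const.prodMk hv.continuousOn) (fun _ _ => ⟨trivial, trivial⟩)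
    exact succ_intro (v' := fun s w => ContinuousLinearMap.compL ℝ W Z V
        (_root_.fderiv ℝ G (v s w)) (_root_.fderiv ℝ (v s) w)) hc
      (fun s hs w => (hG.hasFDerivAt (s := 0) trivial _).comp w (hv.hasFDerivAt hs w))
      (h1.bilin _ hD) (bilin _ (ih hG.fderiv hv.of_succ hc') h1 hv.fderiv hD)

theorem contDiff : ∀ {k : ℕ} {V : Type} [NormedAddCommGroup V] [NormedSpace ℝ V]
    {v : ℝ → W → V}, DerivBdd J k v → ∀ s ∈ J, ContDiff ℝ k (v s)
  | 0, _, _, _, v, h, s, hs => by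
    have : Continuous (v s) := by
      rw [← continuousOn_univ]
      exact ContinuousOn.comp (g := fun p : ℝ × W => v p.1 p.2) (f := fun w => (s, w)) h
        (by fun_prop) (fun w _ => ⟨hs, trivial⟩)
    exact_mod_cast contDiff_zero.2 this
  | k + 1, _, _, _, v, h, s, hs => by
    push_cast
    rw [contDiff_succ_iff_fderiv]
    exact ⟨fun w => h.2.1 s hs w, by simp, contDiff h.fderiv s hs⟩

theorem exists_bound {k : ℕ} {v : ℝ → W → V} (h : DerivBdd J k v) {j : ℕ} (hj : 1 ≤ j)
    (hjk : j ≤ k) : ∃ C, ∀ s ∈ J, ∀ w, ‖iteratedFDeriv ℝ j (v s) w‖ ≤ C := by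
  induction j, hj using Nat.le_induction generalizing V k with
  | base =>
    obtain ⟨k, rfl⟩ : ∃ k', k = k' + 1 := ⟨k - 1, by omega⟩
    obtain ⟨C, hC⟩ := h.unifBdd_fderiv
    refine ⟨C, fun s hs w => ?_⟩
    rw [norm_iteratedFDeriv_one]
    exact hC s hs w
  | succ j hj ih =>
    obtain ⟨k, rfl⟩ : ∃ k', k = k' + 1 := ⟨k - 1, by omega⟩
    obtain ⟨C, hC⟩ := ih h.fderiv (by omega)
    refine ⟨C, fun s hs w => ?_⟩
    rw [← norm_iteratedFDeriv_fderiv]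
    exact hC s hs w

theorem of_contDiff {k : ℕ} {G : W → V} (h : ContDiff ℝ k G)
    (hb : ∀ j, 1 ≤ j → j ≤ k → ∃ C, ∀ w, ‖iteratedFDeriv ℝ j G w‖ ≤ C) :
    DerivBdd J k (fun _ => G) := by
  have hc : ContinuousOn (fun p : ℝ × W => G p.2) (J ×ˢ univ) :=
    (h.continuous.comp continuous_snd).continuousOn
  induction k generalizing V with
  | zero => exact hc
  | succ k ih =>
    push_cast at h
    obtain ⟨C, hC⟩ := hb 1 le_rfl (by omega)
    rw [contDiff_succ_iff_fderiv] at h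
    refine succ_intro (v' := fun _ => _root_.fderiv ℝ G) hc (fun s _ w => (h.1 w).hasFDerivAt)
      ⟨C, fun s _ w => ?_⟩ (ih h.2.2 (fun j h1 hj => ?_)
        (h.2.2.continuous.comp continuous_snd).continuousOn)
    · simpa using hC w
    · obtain ⟨C, hC⟩ := hb (j + 1) (by omega) (by omega)
      exact ⟨C, fun w => by rw [norm_iteratedFDeriv_fderiv]; exact hC w⟩

end DerivBdd

theorem BddWithDerivs.derivBdd {G : W → V} (h : BddWithDerivs k G) :
    DerivBdd J k (fun _ => G) :=
  .of_contDiff h.1 fun j _ hj => h.2 j hj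

theorem BddWithDerivs.unifBdd {G : W → V} (h : BddWithDerivs k G) : UnifBdd J (fun _ => G) := by
  obtain ⟨C, hC⟩ := h.2 0 (Nat.zero_le _)
  exact ⟨C, fun s _ w => by simpa using hC w⟩

theorem DerivBdd.exists_bound_of_unifBdd {v : ℝ → W → V} (h : DerivBdd J k v)
    (hb : UnifBdd J v) {j : ℕ} (hj : j ≤ k) :
    ∃ C, ∀ s ∈ J, ∀ w, ‖iteratedFDeriv ℝ j (v s) w‖ ≤ C := by
  rcases Nat.eq_zero_or_pos j with rfl | h1
  · obtain ⟨C, hC⟩ := hb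
    exact ⟨C, fun s hs w => by simpa using hC s hs w⟩
  · exact h.exists_bound h1 hj

theorem DerivBdd.bddWithDerivs {G : W → V} (h : DerivBdd univ k (fun _ => G))
    (hb : UnifBdd univ (fun _ => G)) : BddWithDerivs k G := by
  refine ⟨h.contDiff 0 trivial, fun j hj => ?_⟩
  obtain ⟨C, hC⟩ := h.exists_bound_of_unifBdd hb hj
  exact ⟨C, fun w => hC 0 trivial w⟩

end Calculus

/-! ### Grönwall's inequality and global existence. -/

section LinearODE

variable {V : Type} [NormedAddCommGroup V] [NormedSpace ℝ V]

/-- Grönwall with rate `K + 1` in place of `K`: the quotient `ε / (K + 1)` is then at most `ε`, and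
`K = 0` needs no separate treatment. -/
theorem norm_le_mul_exp_of_norm_deriv_le {x x' : ℝ → V} {a b K ε δ : ℝ} (hK : 0 ≤ K) (hε : 0 ≤ ε)
    (hx : ∀ t ∈ Icc a b, HasDerivWithinAt x (x' t) (Icc a b) t) (hδ : ‖x a‖ ≤ δ)
    (hb : ∀ t ∈ Icc a b, ‖x' t‖ ≤ K * ‖x t‖ + ε) :
    ∀ t ∈ Icc a b, ‖x t‖ ≤ (δ + ε) * Real.exp ((K + 1) * (b - a)) := by
  intro t ht
  have hδ0 : 0 ≤ δ := (norm_nonneg _).trans hδ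
  have h := norm_le_gronwallBound_of_norm_deriv_right_le (K := K + 1) (ε := ε) (δ := δ)
    (fun s hs => (hx s hs).continuousWithinAt)
    (fun s hs => (hx s ⟨hs.1, hs.2.le⟩).mono_of_mem_nhdsWithin
      (mem_of_superset (Icc_mem_nhdsGE hs.2) (Icc_subset_Icc_left hs.1))) hδ
    (fun s hs => (hb s ⟨hs.1, hs.2.le⟩).trans (by nlinarith [norm_nonneg (x s)])) t ht
  refine h.trans ?_
  rw [gronwallBound_of_K_ne_0 (by positivity)]
  have h1 : Real.exp ((K + 1) * (t - a)) ≤ Real.exp ((K + 1) * (b - a)) := by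
    gcongr
    exact ht.2
  have h0 : 1 ≤ Real.exp ((K + 1) * (t - a)) :=
    Real.one_le_exp (mul_nonneg (by positivity) (sub_nonneg.2 ht.1))
  have h2 : ε / (K + 1) ≤ ε := div_le_self hε (by linarith)
  have h3 : ε / (K + 1) * (Real.exp ((K + 1) * (t - a)) - 1) ≤
      ε * Real.exp ((K + 1) * (b - a)) := by
    apply mul_le_mul h2 _ _ hε <;> linarith
  nlinarith

/-- The radial retraction onto the closed ball of radius `R`. -/
noncomputable def radialRetraction (R : ℝ) (x : V) : V := (R / max R ‖x‖) • x

theorem radialRetraction_of_norm_le {R : ℝ} (hR : 0 < R) {x : V} (hx : ‖x‖ ≤ R) :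
    radialRetraction R x = x := by
  rw [radialRetraction, max_eq_left hx, div_self hR.ne', one_smul]

theorem norm_radialRetraction_le {R : ℝ} (hR : 0 < R) (x : V) :
    ‖radialRetraction R x‖ ≤ R := by
  have hm : 0 < max R ‖x‖ := lt_max_of_lt_left hR
  rw [radialRetraction, norm_smul, Real.norm_of_nonneg (by positivity), div_mul_eq_mul_div,
    div_le_iff₀ hm]
  exact mul_le_mul_of_nonneg_left (le_max_right _ _) hR.le

theorem norm_radialRetraction_le_norm {R : ℝ} (hR : 0 < R) (x : V) :
    ‖radialRetraction R x‖ ≤ ‖x‖ := by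
  have hm : 0 < max R ‖x‖ := lt_max_of_lt_left hR
  rw [radialRetraction, norm_smul, Real.norm_of_nonneg (by positivity)]
  exact mul_le_of_le_one_left (norm_nonneg _) ((div_le_one hm).2 (le_max_left _ _))

/-- Moving the vector at a fixed scaling factor and moving the factor at a fixed vector each cost at
most `‖x - y‖`. The argument works in any normed space, in particular in the operator spaces where
the variational equation lives. -/
theorem norm_radialRetraction_sub_le {R : ℝ} (hR : 0 < R) (x y : V) :
    ‖radialRetraction R x - radialRetraction R y‖ ≤ 2 * ‖x - y‖ := by
  have hx : 0 < max R ‖x‖ := lt_max_of_lt_left hR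
  have hy : 0 < max R ‖y‖ := lt_max_of_lt_left hR
  have e : radialRetraction R x - radialRetraction R y =
      (R / max R ‖x‖) • (x - y) + (R / max R ‖x‖ - R / max R ‖y‖) • y := by
    rw [radialRetraction, radialRetraction, smul_sub, sub_smul]
    abel
  have h1 : ‖(R / max R ‖x‖) • (x - y)‖ ≤ ‖x - y‖ := by
    rw [norm_smul, Real.norm_of_nonneg (by positivity)]
    exact mul_le_of_le_one_left (norm_nonneg _) ((div_le_one hx).2 (le_max_left _ _))
  have h2 : ‖(R / max R ‖x‖ - R / max R ‖y‖) • y‖ ≤ ‖x - y‖ := by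
    have e2 : R / max R ‖x‖ - R / max R ‖y‖ =
        (R / max R ‖x‖) * ((max R ‖y‖ - max R ‖x‖) / max R ‖y‖) := by
      field_simp
    have h3 : |max R ‖y‖ - max R ‖x‖| ≤ ‖x - y‖ := by
      refine (abs_max_sub_max_le_max R ‖y‖ R ‖x‖).trans ?_
      rw [sub_self, abs_zero, max_eq_right (abs_nonneg _), norm_sub_rev]
      exact abs_norm_sub_norm_le y x
    rw [e2, norm_smul, Real.norm_eq_abs, abs_mul, abs_div _ (max R ‖y‖), abs_of_pos hy,
      abs_of_nonneg (by positivity : 0 ≤ R / max R ‖x‖)]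
    calc R / max R ‖x‖ * (|max R ‖y‖ - max R ‖x‖| / max R ‖y‖) * ‖y‖
        = R / max R ‖x‖ * (|max R ‖y‖ - max R ‖x‖| * (‖y‖ / max R ‖y‖)) := by ring
      _ ≤ 1 * (|max R ‖y‖ - max R ‖x‖| * 1) := by
          gcongr
          · exact (div_le_one hx).2 (le_max_left _ _)
          · exact (div_le_one hy).2 (le_max_right _ _)
      _ ≤ ‖x - y‖ := by simpa using h3
  rw [e]
  linarith [norm_add_le ((R / max R ‖x‖) • (x - y)) ((R / max R ‖x‖ - R / max R ‖y‖) • y)]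

/-- Global existence for a bounded, uniformly Lipschitz vector field. -/
theorem exists_solution_of_bounded_lipschitz [CompleteSpace V] {f : ℝ → V → V} {a b t₀ : ℝ}
    (ht : t₀ ∈ Icc a b) {K L : ℝ} (hK : ∀ t ∈ Icc a b, ∀ x y, ‖f t x - f t y‖ ≤ K * ‖x - y‖)
    (hc : ∀ x, ContinuousOn (fun t => f t x) (Icc a b)) (hL : ∀ t ∈ Icc a b, ∀ x, ‖f t x‖ ≤ L)
    (x₀ : V) : ∃ x : ℝ → V, x t₀ = x₀ ∧
      ∀ t ∈ Icc a b, HasDerivWithinAt x (f t (x t)) (Icc a b) t := by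
  have hL0 : 0 ≤ L := (norm_nonneg _).trans (hL t₀ ht 0)
  have hab : a ≤ b := ht.1.trans ht.2
  -- A solution with speed at most `L` cannot leave the ball of radius `L * (b - a)`, so the
  -- Picard–Lindelöf interval is all of `[a, b]`.
  have : IsPicardLindelof f (⟨t₀, ht⟩ : Icc a b) x₀ (⟨L * (b - a), mul_nonneg hL0
      (sub_nonneg.2 hab)⟩ : NNReal) 0 ⟨L, hL0⟩ K.toNNReal :=
    { lipschitzOnWith := fun t ht => by
        refine LipschitzOnWith.of_dist_le_mul fun x _ y _ => ?_
        rw [dist_eq_norm, dist_eq_norm]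
        refine (hK t ht x y).trans ?_
        gcongr
        exact Real.le_coe_toNNReal K
      continuousOn := fun x _ => hc x
      norm_le := fun t ht x _ => hL t ht x
      mul_max_le := by
        change L * max (b - t₀) (t₀ - a) ≤ L * (b - a) - 0
        rw [sub_zero]
        gcongr
        exact max_le (by linarith [ht.1]) (by linarith [ht.2]) }
  exact this.exists_eq_forall_mem_Icc_hasDerivWithinAt₀

/-- Existence for linear differential equations on a compact interval. -/
theorem exists_solution_linear [CompleteSpace V] {a b : ℝ} (hab : a ≤ b) {A : ℝ → V →L[ℝ] V}
    {g : ℝ → V} (hA : ContinuousOn A (Icc a b)) (hg : ContinuousOn g (Icc a b)) (x₀ : V) :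
    ∃ x : ℝ → V, x a = x₀ ∧
      ∀ t ∈ Icc a b, HasDerivWithinAt x (A t (x t) + g t) (Icc a b) t := by
  obtain ⟨K, hK⟩ := isCompact_Icc.exists_bound_of_continuousOn hA
  obtain ⟨L, hL⟩ := isCompact_Icc.exists_bound_of_continuousOn hg
  have ha : a ∈ Icc a b := ⟨le_rfl, hab⟩
  have hK0 : 0 ≤ K := (norm_nonneg _).trans (hK a ha)
  have hL0 : 0 ≤ L := (norm_nonneg _).trans (hL a ha)
  -- An a priori Grönwall bound. The retraction does not increase norms, so the truncated solution
  -- obeys the same bound, stays where the retraction is the identity, and solves the original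
  -- equation.
  set R := (‖x₀‖ + L) * Real.exp ((K + 1) * (b - a)) + 1 with hRdef
  have hR : 0 < R := by positivity
  have hbd : ∀ t ∈ Icc a b, ∀ x : V, ‖A t (radialRetraction R x) + g t‖ ≤ K * ‖x‖ + L := by
    intro t ht x
    refine norm_add_le_of_le ((A t).le_of_opNorm_le_of_le (hK t ht)
      (norm_radialRetraction_le_norm hR x)) (hL t ht)
  obtain ⟨x, hx0, hx⟩ := exists_solution_of_bounded_lipschitz (V := V)
    (f := fun t x => A t (radialRetraction R x) + g t) ha (K := K * 2) (L := K * R + L)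
    (fun t ht x y => by
      rw [add_sub_add_right_eq_sub, ← map_sub, mul_assoc]
      exact (A t).le_of_opNorm_le_of_le (hK t ht) (norm_radialRetraction_sub_le hR x y))
    (fun x => (hA.clm_apply continuousOn_const).add hg)
    (fun t ht x => norm_add_le_of_le ((A t).le_of_opNorm_le_of_le (hK t ht)
      (norm_radialRetraction_le hR x)) (hL t ht)) x₀
  have hle : ∀ t ∈ Icc a b, ‖x t‖ ≤ R := fun t ht =>
    (norm_le_mul_exp_of_norm_deriv_le hK0 hL0 hx (by rw [hx0])
      (fun t ht => hbd t ht (x t)) t ht).trans (by rw [hRdef]; linarith)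
  refine ⟨x, hx0, fun t ht => ?_⟩
  have := hx t ht
  rwa [radialRetraction_of_norm_le hR (hle t ht)] at this

end LinearODE

/-! ### Continuous and differentiable dependence on parameters over compact intervals. -/

/-- Tube lemma along the curve `z`: only the time interval has to be compact, so `Z` may be
infinite-dimensional. -/
theorem exists_delta_of_continuousOn_Icc {Z V : Type} [NormedAddCommGroup Z]
    [NormedAddCommGroup V] {a b : ℝ} {F : ℝ → Z → V}
    (hF : ContinuousOn (fun p : ℝ × Z => F p.1 p.2) (Icc a b ×ˢ univ)) {z : ℝ → Z}
    (hz : ContinuousOn z (Icc a b)) {ε : ℝ} (hε : 0 < ε) :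
    ∃ δ > 0, ∀ s ∈ Icc a b, ∀ x, ‖x - z s‖ < δ → ‖F s x - F s (z s)‖ < ε := by
  let Φ : Z × Icc a b → ℝ := fun p => ‖F p.2 (z p.2 + p.1) - F p.2 (z p.2)‖
  have hz' : Continuous fun s : Icc a b => z s := hz.domRestrict
  have hΦ : Continuous Φ := by
    have h1 : Continuous fun p : Z × Icc a b => F p.2 (z p.2 + p.1) :=
      hF.comp_continuous (f := fun p : Z × Icc a b => ((p.2 : ℝ), z p.2 + p.1))
        ((continuous_subtype_val.comp continuous_snd).prodMk
          ((hz'.comp continuous_snd).add continuous_fst)) (fun p => ⟨p.2.2, trivial⟩)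
    have h2 : Continuous fun p : Z × Icc a b => F p.2 (z p.2) :=
      hF.comp_continuous (f := fun p : Z × Icc a b => ((p.2 : ℝ), z p.2))
        ((continuous_subtype_val.comp continuous_snd).prodMk (hz'.comp continuous_snd))
        (fun p => ⟨p.2.2, trivial⟩)
    exact (h1.sub h2).norm
  have key : ∀ᶠ x in 𝓝 (0 : Z), ∀ s ∈ (univ : Set (Icc a b)), Φ (x, s) < ε := by
    refine isCompact_univ.eventually_forall_of_forall_eventually fun s _ => ?_
    have : Φ (0, s) < ε := by simpa [Φ] using hε
    exact hΦ.continuousAt.eventually_lt continuousAt_const this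
  obtain ⟨δ, hδ, h⟩ := Metric.eventually_nhds_iff.1 key
  refine ⟨δ, hδ, fun s hs x hx => ?_⟩
  have := h (y := x - z s) (by simpa using hx) ⟨s, hs⟩ trivial
  simpa [Φ] using this

section Dependence

variable {W V : Type} [NormedAddCommGroup W] [NormedAddCommGroup V] [NormedSpace ℝ V]

/-- Joint continuity of solutions with respect to time and parameters. -/
theorem continuousOn_solution_Icc {a b K : ℝ} (hK0 : 0 ≤ K) {G : ℝ → V × W → V}
    (hG : ContinuousOn (fun p : ℝ × (V × W) => G p.1 p.2) (Icc a b ×ˢ univ))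
    (hK : ∀ s ∈ Icc a b, ∀ x y w, ‖G s (x, w) - G s (y, w)‖ ≤ K * ‖x - y‖) {u : ℝ → W → V}
    (hu : ∀ w, ∀ s ∈ Icc a b, HasDerivWithinAt (fun τ => u τ w) (G s (u s w, w)) (Icc a b) s)
    (h0 : Continuous (u a)) :
    ContinuousOn (fun p : ℝ × W => u p.1 p.2) (Icc a b ×ˢ univ) := by
  rintro ⟨s₀, w₀⟩ ⟨hs₀, -⟩
  have hu0 : ContinuousOn (fun s => u s w₀) (Icc a b) := fun s hs => (hu w₀ s hs).continuousWithinAt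
  set E := Real.exp ((K + 1) * (b - a))
  have hE : 0 < E := Real.exp_pos _
  rw [ContinuousWithinAt, Metric.tendsto_nhds]
  intro ε hε
  set η := ε / (4 * E) with hη
  have hη0 : 0 < η := by positivity
  obtain ⟨δ, hδ, h1⟩ := exists_delta_of_continuousOn_Icc hG
    (z := fun s => (u s w₀, w₀)) (hu0.prodMk continuousOn_const) hη0
  have h2 : ∀ᶠ w in 𝓝 w₀, ‖u a w - u a w₀‖ < η ∧ ‖w - w₀‖ < δ := by
    refine Eventually.and ?_ ?_
    · have := Metric.tendsto_nhds.1 (h0.tendsto w₀) η hη0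
      simpa [dist_eq_norm] using this
    · have := Metric.ball_mem_nhds w₀ hδ
      filter_upwards [this] with w hw
      simpa [dist_eq_norm] using hw
  have h3 : ∀ᶠ s in 𝓝[Icc a b] s₀, ‖u s w₀ - u s₀ w₀‖ < ε / 2 ∧ s ∈ Icc a b := by
    refine Eventually.and ?_ self_mem_nhdsWithin
    have := Metric.tendsto_nhds.1 (hu0 s₀ hs₀) (ε / 2) (by positivity)
    simpa [dist_eq_norm] using this
  rw [nhdsWithin_prod_eq, nhdsWithin_univ]
  filter_upwards [h3.prod_mk h2] with ⟨s, w⟩ ⟨⟨h4, hs⟩, h5, h6⟩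
  have hd := norm_le_mul_exp_of_norm_deriv_le (x := fun τ => u τ w - u τ w₀) (δ := η) (ε := η) hK0
    hη0.le (fun τ hτ => (hu w τ hτ).sub (hu w₀ τ hτ)) h5.le (fun τ hτ => by
      have e : G τ (u τ w, w) - G τ (u τ w₀, w₀) = (G τ (u τ w, w) - G τ (u τ w₀, w)) +
        (G τ (u τ w₀, w) - G τ (u τ w₀, w₀)) := by abel
      rw [e]
      refine norm_add_le_of_le (hK τ hτ _ _ _) (h1 τ hτ _ ?_).le
      simpa [Prod.norm_def] using h6) s hs
  have e1 : (η + η) * E = ε / 2 := by rw [hη]; field_simp; ring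
  rw [e1] at hd
  calc dist (u s w) (u s₀ w₀) ≤ dist (u s w) (u s w₀) + dist (u s w₀) (u s₀ w₀) :=
        dist_triangle _ _ _
    _ < ε := by rw [dist_eq_norm, dist_eq_norm]; linarith

/-- A solution family of an equation with continuously differentiable right hand side depends
differentiably on the parameter, and the derivative solves the variational equation. -/
theorem exists_hasFDerivAt_solution_Icc [NormedSpace ℝ W] [CompleteSpace V] {a b K : ℝ}
    (hab : a ≤ b) (hK0 : 0 ≤ K) {G : ℝ → V × W → V}
    {G' : ℝ → V × W → V × W →L[ℝ] V} (hGd : ∀ s ∈ Icc a b, ∀ z, HasFDerivAt (G s) (G' s z) z)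
    (hG' : ContinuousOn (fun p : ℝ × (V × W) => G' p.1 p.2) (Icc a b ×ˢ univ))
    (hK : ∀ s ∈ Icc a b, ∀ x y w, ‖G s (x, w) - G s (y, w)‖ ≤ K * ‖x - y‖) {u : ℝ → W → V}
    (hu : ∀ w, ∀ s ∈ Icc a b, HasDerivWithinAt (fun τ => u τ w) (G s (u s w, w)) (Icc a b) s)
    (h0 : ∀ w, DifferentiableAt ℝ (u a) w) (w₀ : W) :
    ∃ v : ℝ → W →L[ℝ] V, ∀ s ∈ Icc a b, HasFDerivAt (u s) (v s) w₀ ∧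
      HasDerivWithinAt v (((G' s (u s w₀, w₀)).comp (.inl ℝ V W)).comp (v s) +
        (G' s (u s w₀, w₀)).comp (.inr ℝ V W)) (Icc a b) s := by
  have hu0 : ContinuousOn (fun s => u s w₀) (Icc a b) := fun s hs => (hu w₀ s hs).continuousWithinAt
  have hz : ContinuousOn (fun s => (u s w₀, w₀)) (Icc a b) := hu0.prodMk continuousOn_const
  set D : ℝ → V × W →L[ℝ] V := fun s => G' s (u s w₀, w₀) with hD
  have hDc : ContinuousOn D (Icc a b) :=
    hG'.comp (f := fun s => (s, (u s w₀, w₀))) (continuousOn_id.prodMk hz)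
      (fun s hs => ⟨hs, trivial⟩)
  have hAc : ContinuousOn (fun s => (D s).comp (.inl ℝ V W)) (Icc a b) :=
    hDc.clm_comp continuousOn_const
  have hRc : ContinuousOn (fun s => (D s).comp (.inr ℝ V W)) (Icc a b) :=
    hDc.clm_comp continuousOn_const
  obtain ⟨v, hv0, hv⟩ := exists_solution_linear hab
    (A := fun s => ContinuousLinearMap.compL ℝ W V V ((D s).comp (.inl ℝ V W)))
    ((ContinuousLinearMap.compL ℝ W V V).continuous.comp_continuousOn hAc) hRc (fderiv ℝ (u a) w₀)
  refine ⟨v, fun s₀ hs₀ => ⟨?_, hv s₀ hs₀⟩⟩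
  obtain ⟨M, hM⟩ := isCompact_Icc.exists_bound_of_continuousOn hDc
  have hM0 : 0 ≤ M := (norm_nonneg _).trans (hM s₀ hs₀)
  set E := Real.exp ((K + 1) * (b - a))
  have hE : 0 < E := Real.exp_pos _
  set N := ‖fderiv ℝ (u a) w₀‖ + 1
  have hN : 0 < N := by positivity
  -- Grönwall constant for initial slope at most `N` and forcing at most `(M + 1) * ‖w - w₀‖`; the
  -- `1` comes from the Taylor estimate taken with `ε = 1`.
  set C := (N + (M + 1)) * E
  have hC : 0 < C := by positivity
  -- first-order Taylor estimate, uniform along the solution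
  have taylor : ∀ ε > 0, ∃ δ > 0, ∀ s ∈ Icc a b, ∀ z, ‖z - (u s w₀, w₀)‖ < δ →
      ‖G s z - G s (u s w₀, w₀) - D s (z - (u s w₀, w₀))‖ ≤ ε * ‖z - (u s w₀, w₀)‖ := by
    intro ε hε
    obtain ⟨δ, hδ, h⟩ := exists_delta_of_continuousOn_Icc hG' hz hε
    refine ⟨δ, hδ, fun s hs z hzs => ?_⟩
    refine (convex_ball (u s w₀, w₀) δ).norm_image_sub_le_of_norm_hasFDerivWithin_le'
      (fun x _ => (hGd s hs x).hasFDerivWithinAt) (fun x hx => ?_)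
      (Metric.mem_ball_self hδ) (by simpa [dist_eq_norm] using hzs)
    exact (h s hs x (by simpa [dist_eq_norm] using hx)).le
  -- local Lipschitz estimate
  have lip : ∀ᶠ w in 𝓝 w₀, ∀ s ∈ Icc a b, ‖u s w - u s w₀‖ ≤ C * ‖w - w₀‖ := by
    obtain ⟨δ, hδ, h⟩ := taylor 1 one_pos
    have h1 : ∀ᶠ w in 𝓝 w₀, ‖u a w - u a w₀‖ ≤ N * ‖w - w₀‖ := by
      have := ((h0 w₀).hasFDerivAt.isLittleO.bound one_pos)
      filter_upwards [this] with w hw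
      have h2 := norm_add_le_of_le hw ((fderiv ℝ (u a) w₀).le_opNorm (w - w₀))
      rw [sub_add_cancel] at h2
      refine h2.trans (le_of_eq ?_)
      ring
    filter_upwards [h1, Metric.ball_mem_nhds w₀ hδ] with w hw hwδ s hs
    have := norm_le_mul_exp_of_norm_deriv_le (x := fun τ => u τ w - u τ w₀)
      (ε := (M + 1) * ‖w - w₀‖) hK0
      (by positivity) (fun τ hτ => (hu w τ hτ).sub (hu w₀ τ hτ)) hw (fun τ hτ => by
        have e : G τ (u τ w, w) - G τ (u τ w₀, w₀) = (G τ (u τ w, w) - G τ (u τ w₀, w)) +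
          (G τ (u τ w₀, w) - G τ (u τ w₀, w₀)) := by abel
        rw [e]
        refine norm_add_le_of_le (hK τ hτ _ _ _) ?_
        have e2 : ((u τ w₀, w) : V × W) - (u τ w₀, w₀) = (0, w - w₀) := by simp
        have hn : ‖((0, w - w₀) : V × W)‖ = ‖w - w₀‖ := by simp [Prod.norm_def]
        have h3 := h τ hτ (u τ w₀, w) (by rw [e2, hn]; simpa [dist_eq_norm] using hwδ)
        have h4 := norm_add_le_of_le h3
          ((D τ).le_of_opNorm_le (hM τ hτ) ((u τ w₀, w) - (u τ w₀, w₀)))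
        rw [sub_add_cancel, e2, hn] at h4
        linarith) s hs
    refine this.trans (le_of_eq ?_)
    ring
  rw [hasFDerivAt_iff_isLittleO, Asymptotics.isLittleO_iff]
  intro c hc
  -- The remainder starts below `ε * ‖w - w₀‖` and is forced by at most `ε * (C + 1) * ‖w - w₀‖`;
  -- Grönwall multiplies the sum by `E`, which yields exactly `c * ‖w - w₀‖`.
  set ε := c / ((C + 2) * E) with hε
  have hε0 : 0 < ε := by positivity
  obtain ⟨δ, hδ, htay⟩ := taylor ε hε0
  have hsmall : ∀ᶠ w in 𝓝 w₀, (C + 1) * ‖w - w₀‖ < δ := by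
    have : Tendsto (fun w => (C + 1) * ‖w - w₀‖) (𝓝 w₀) (𝓝 ((C + 1) * ‖w₀ - w₀‖)) :=
      Continuous.tendsto (by fun_prop) w₀
    exact this.eventually_lt_const (by simpa using hδ)
  filter_upwards [lip, hsmall, (h0 w₀).hasFDerivAt.isLittleO.bound hε0] with w hlip hw hini
  have hnorm : ∀ s ∈ Icc a b, ‖((u s w, w) : V × W) - (u s w₀, w₀)‖ ≤ (C + 1) * ‖w - w₀‖ := by
    intro s hs
    rw [Prod.mk_sub_mk, Prod.norm_def]
    refine max_le ((hlip s hs).trans ?_) ?_ <;> nlinarith [norm_nonneg (w - w₀)]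
  have hd := norm_le_mul_exp_of_norm_deriv_le
    (x := fun τ => u τ w - u τ w₀ - v τ (w - w₀)) (δ := ε * ‖w - w₀‖)
    (ε := ε * ((C + 1) * ‖w - w₀‖)) hK0 (by positivity)
    (fun τ hτ => ((hu w τ hτ).sub (hu w₀ τ hτ)).sub
      ((hv τ hτ).clm_apply (hasDerivWithinAt_const τ (Icc a b) (w - w₀))))
    (by rw [hv0]; exact hini) (fun τ hτ => ?_) s₀ hs₀
  · refine hd.trans (le_of_eq ?_)
    rw [hε]
    field_simp
    ring
  · have hA : ‖(D τ).comp (.inl ℝ V W)‖ ≤ K := by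
      have h1 : HasFDerivAt (fun x => G τ (x, w₀)) ((D τ).comp (.inl ℝ V W)) (u τ w₀) :=
        (hGd τ hτ _).comp (u τ w₀) (hasFDerivAt_prodMk_left _ _)
      rw [← h1.fderiv]
      refine norm_fderiv_le_of_lipschitz ℝ (C := ⟨K, hK0⟩) (LipschitzWith.of_dist_le_mul
        fun x y => ?_)
      rw [dist_eq_norm, dist_eq_norm]
      exact hK τ hτ x y w₀
    have e : G τ (u τ w, w) - G τ (u τ w₀, w₀) -
        ((ContinuousLinearMap.compL ℝ W V V ((D τ).comp (.inl ℝ V W)) (v τ) +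
          (D τ).comp (.inr ℝ V W)) (w - w₀) + v τ 0) =
        (D τ).comp (.inl ℝ V W) (u τ w - u τ w₀ - v τ (w - w₀)) +
        (G τ (u τ w, w) - G τ (u τ w₀, w₀) - D τ ((u τ w, w) - (u τ w₀, w₀))) := by
      have e3 : ((u τ w, w) : V × W) - (u τ w₀, w₀) =
        (u τ w - u τ w₀, 0) + (0, w - w₀) := by simp
      rw [e3, map_add]
      simp only [add_apply, ContinuousLinearMap.compL_apply,
        ContinuousLinearMap.comp_apply, ContinuousLinearMap.inl_apply,
        ContinuousLinearMap.inr_apply, map_zero, add_zero]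
      have e4 : ((u τ w - u τ w₀ - v τ (w - w₀), 0) : V × W) =
        (u τ w - u τ w₀, 0) - (v τ (w - w₀), 0) := by simp
      rw [e4, (D τ).map_sub]
      abel
    rw [e]
    refine norm_add_le_of_le (ContinuousLinearMap.le_of_opNorm_le _ hA _) ?_
    refine (htay τ hτ _ ((hnorm τ hτ).trans_lt hw)).trans ?_
    gcongr
    exact hnorm τ hτ

end Dependence

/-- `J` is an interval with left endpoint `a ∈ J`, exhausted by compact intervals `[a, b]`. -/
structure InitialInterval (a : ℝ) (J : Set ℝ) : Prop where
  left_mem : a ∈ J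
  exhaust : ∀ s ∈ J, ∃ b, a ≤ b ∧ Icc a b ⊆ J ∧ Icc a b ∈ 𝓝[J] s

theorem InitialInterval.Icc {a b : ℝ} (h : a ≤ b) : InitialInterval a (Icc a b) :=
  ⟨⟨le_rfl, h⟩, fun _ _ => ⟨b, h, le_rfl, self_mem_nhdsWithin⟩⟩

theorem InitialInterval.Ici (a : ℝ) : InitialInterval a (Ici a) := by
  refine ⟨self_mem_Ici, fun s hs => ⟨s + 1, ?_, Icc_subset_Ici_self, ?_⟩⟩
  · have : a ≤ s := hs
    linarith
  · rw [← Ici_inter_Iic]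
    exact inter_mem self_mem_nhdsWithin (mem_nhdsWithin_of_mem_nhds (Iic_mem_nhds (by linarith)))

/-! ### From compact intervals to half-lines, and the estimate for bounded solutions. -/

section Lift

variable {W V : Type} [NormedAddCommGroup W] [NormedAddCommGroup V] [NormedSpace ℝ V]
  {J : Set ℝ} {a K : ℝ}

theorem continuousOn_solution (hJ : InitialInterval a J) (hK0 : 0 ≤ K) {G : ℝ → V × W → V}
    (hG : ContinuousOn (fun p : ℝ × (V × W) => G p.1 p.2) (J ×ˢ univ))
    (hK : ∀ s ∈ J, ∀ x y w, ‖G s (x, w) - G s (y, w)‖ ≤ K * ‖x - y‖) {u : ℝ → W → V}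
    (hu : ∀ w, ∀ s ∈ J, HasDerivWithinAt (fun τ => u τ w) (G s (u s w, w)) J s)
    (h0 : Continuous (u a)) :
    ContinuousOn (fun p : ℝ × W => u p.1 p.2) (J ×ˢ univ) := by
  rintro ⟨s, w⟩ ⟨hs, -⟩
  obtain ⟨b, hab, hbJ, hb⟩ := hJ.exhaust s hs
  have h := continuousOn_solution_Icc hK0 (hG.mono (prod_mono hbJ le_rfl))
    (fun s hs => hK s (hbJ hs)) (fun w s hs => (hu w s (hbJ hs)).mono hbJ) h0 (s, w)
    ⟨mem_of_mem_nhdsWithin hs hb, trivial⟩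
  refine h.mono_of_mem_nhdsWithin ?_
  rw [nhdsWithin_prod_eq]
  exact prod_mem_prod hb self_mem_nhdsWithin

/-- The variational solutions found on different compact subintervals agree automatically, each
being the Fréchet derivative of `u τ`; they therefore glue over `J`. -/
theorem hasFDerivAt_solution [NormedSpace ℝ W] [CompleteSpace V] (hJ : InitialInterval a J)
    (hK0 : 0 ≤ K) {G : ℝ → V × W → V} {G' : ℝ → V × W → V × W →L[ℝ] V}
    (hGd : ∀ s ∈ J, ∀ z, HasFDerivAt (G s) (G' s z) z)
    (hG' : ContinuousOn (fun p : ℝ × (V × W) => G' p.1 p.2) (J ×ˢ univ))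
    (hK : ∀ s ∈ J, ∀ x y w, ‖G s (x, w) - G s (y, w)‖ ≤ K * ‖x - y‖) {u : ℝ → W → V}
    (hu : ∀ w, ∀ s ∈ J, HasDerivWithinAt (fun τ => u τ w) (G s (u s w, w)) J s)
    (h0 : ∀ w, DifferentiableAt ℝ (u a) w) (w : W) {s : ℝ} (hs : s ∈ J) :
    HasFDerivAt (u s) (fderiv ℝ (u s) w) w ∧
      HasDerivWithinAt (fun τ => fderiv ℝ (u τ) w)
        (((G' s (u s w, w)).comp (.inl ℝ V W)).comp (fderiv ℝ (u s) w) +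
        (G' s (u s w, w)).comp (.inr ℝ V W)) J s := by
  obtain ⟨b, hab, hbJ, hb⟩ := hJ.exhaust s hs
  have hsb : s ∈ Icc a b := mem_of_mem_nhdsWithin hs hb
  obtain ⟨v, hv⟩ := exists_hasFDerivAt_solution_Icc hab hK0 (fun s hs => hGd s (hbJ hs))
    (hG'.mono (prod_mono hbJ le_rfl)) (fun s hs => hK s (hbJ hs))
    (fun w s hs => (hu w s (hbJ hs)).mono hbJ) h0 w
  have e : ∀ τ ∈ Icc a b, fderiv ℝ (u τ) w = v τ := fun τ hτ => (hv τ hτ).1.fderiv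
  rw [e s hsb]
  exact ⟨(hv s hsb).1, ((hv s hsb).2.congr e (e s hsb)).mono_of_mem_nhdsWithin hb⟩

end Lift

/-- Bounded solutions on `J` of `e' = A(s, w) e + g` are controlled by `e(a)` and `sup ‖g‖`. -/
structure BddSolutionEstimate {W V : Type} [NormedAddCommGroup V] [NormedSpace ℝ V] (J : Set ℝ)
    (a K : ℝ) (A : ℝ → W → V →L[ℝ] V) : Prop where
  nonneg : 0 ≤ K
  est : ∀ w, ∀ e g : ℝ → V, ∀ γ : ℝ, (∃ C, ∀ s ∈ J, ‖e s‖ ≤ C) →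
    (∀ s ∈ J, HasDerivWithinAt e (A s w (e s) + g s) J s) → (∀ s ∈ J, ‖g s‖ ≤ γ) →
    ∀ s ∈ J, ‖e s‖ ≤ K * (‖e a‖ + γ)

/-- Test an operator-valued solution on a fixed vector `x`. The constant `K` is unchanged, so the
estimate survives any number of differentiations in the parameter. -/
theorem BddSolutionEstimate.compL {W V X : Type} [NormedAddCommGroup V] [NormedSpace ℝ V]
    [NormedAddCommGroup X] [NormedSpace ℝ X] {J : Set ℝ} {a K : ℝ} {A : ℝ → W → V →L[ℝ] V}
    (h : BddSolutionEstimate J a K A) :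
    BddSolutionEstimate J a K fun s w => ContinuousLinearMap.compL ℝ X V V (A s w) := by
  refine ⟨h.nonneg, fun w e g γ ⟨C, hC⟩ he hg s hs => ?_⟩
  have hγ : 0 ≤ γ := (norm_nonneg _).trans (hg s hs)
  refine ContinuousLinearMap.opNorm_le_bound _ (mul_nonneg h.nonneg (by positivity)) fun x => ?_
  have := h.est w (fun s => e s x) (fun s => g s x) (γ * ‖x‖)
    ⟨C * ‖x‖, fun s hs => (e s).le_of_opNorm_le (hC s hs) x⟩ (fun s hs => by
      simpa using (he s hs).clm_apply (hasDerivWithinAt_const s J x))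
    (fun s hs => (g s).le_of_opNorm_le (hg s hs) x) s hs
  refine this.trans ?_
  rw [mul_assoc, add_mul]
  have := h.nonneg
  gcongr
  exact (e a).le_opNorm x

theorem UnifBdd.postcomp {W V X : Type} [NormedAddCommGroup V] [NormedSpace ℝ V]
    [NormedAddCommGroup X] [NormedSpace ℝ X] {J : Set ℝ} {A : ℝ → W → V →L[ℝ] V}
    (h : UnifBdd J A) : UnifBdd J fun s w => ContinuousLinearMap.compL ℝ X V V (A s w) := by
  obtain ⟨C, hC⟩ := h
  refine ⟨C, fun s hs w => ?_⟩
  have hC0 : 0 ≤ C := (norm_nonneg _).trans (hC s hs w)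
  refine ContinuousLinearMap.opNorm_le_bound _ hC0 fun x => ?_
  exact (ContinuousLinearMap.opNorm_comp_le _ _).trans
    (mul_le_mul_of_nonneg_right (hC s hs w) (norm_nonneg _))

/-! ### Uniform bounds on parameter derivatives, order by order. -/

section Bootstrap

variable {W V : Type} [NormedAddCommGroup W] [NormedSpace ℝ W] [NormedAddCommGroup V]
  [NormedSpace ℝ V] {J : Set ℝ} {a K : ℝ}

theorem DerivBdd.exists_lipschitz {k : ℕ} {v : ℝ → W → V} (h : DerivBdd J (k + 1) v) :
    ∃ C, 0 ≤ C ∧ ∀ s ∈ J, ∀ w w', ‖v s w' - v s w‖ ≤ C * ‖w' - w‖ := by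
  obtain ⟨C, hC⟩ := h.unifBdd_fderiv
  refine ⟨max C 0, le_max_right _ _, fun s hs w w' => ?_⟩
  exact convex_univ.norm_image_sub_le_of_norm_fderiv_le (𝕜 := ℝ) (fun x _ => h.2.1 s hs x)
    (fun x _ => (hC s hs x).trans (le_max_left _ _)) trivial trivial

-- The parameter derivative of `v` solves an equation with the same homogeneous part, acting by
-- composition, and a forcing built from `v`, `DA` and `DR`. The induction hypothesis is used twice:
-- in `V` to control this forcing, and in `W →L[ℝ] V` for the derivative. The first bound on `Dv`
-- comes from difference quotients.
set_option maxHeartbeats 400000 in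
theorem derivBdd_of_linear (hJ : InitialInterval a J) {k : ℕ} [CompleteSpace V]
    {A : ℝ → W → V →L[ℝ] V} {R v : ℝ → W → V} (hA : DerivBdd J k A) (hAb : UnifBdd J A)
    (hR : DerivBdd J k R) (hRb : UnifBdd J R) (hE : BddSolutionEstimate J a K A)
    (hv : ∀ w, ∀ s ∈ J, HasDerivWithinAt (fun τ => v τ w) (A s w (v s w) + R s w) J s)
    (hvb : UnifBdd J v) (hvc : ContinuousOn (fun p : ℝ × W => v p.1 p.2) (J ×ˢ univ))
    (h0 : DerivBdd {a} k v) : DerivBdd J k v := by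
  induction k generalizing V with
  | zero => exact hvc
  | succ k ih =>
    have hvk : DerivBdd J k v := ih hA.of_succ hAb hR.of_succ hRb hE hv hvb hvc h0.of_succ
    have hAb' := hAb
    obtain ⟨M, hM⟩ := hAb
    have hM0 : 0 ≤ M := (norm_nonneg _).trans (hM a hJ.left_mem 0)
    have hcA : ContinuousOn (fun p : ℝ × (V × W) => A p.1 p.2.2) (J ×ˢ univ) :=
      hA.continuousOn.comp (f := fun p : ℝ × (V × W) => (p.1, p.2.2)) (by fun_prop)
        (fun p hp => ⟨hp.1, trivial⟩)
    have hcA' : ContinuousOn (fun p : ℝ × (V × W) => fderiv ℝ (A p.1) p.2.2) (J ×ˢ univ) :=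
      hA.fderiv.continuousOn.comp (f := fun p : ℝ × (V × W) => (p.1, p.2.2)) (by fun_prop)
        (fun p hp => ⟨hp.1, trivial⟩)
    have hcR' : ContinuousOn (fun p : ℝ × (V × W) => fderiv ℝ (R p.1) p.2.2) (J ×ˢ univ) :=
      hR.fderiv.continuousOn.comp (f := fun p : ℝ × (V × W) => (p.1, p.2.2)) (by fun_prop)
        (fun p hp => ⟨hp.1, trivial⟩)
    let flipC : (W →L[ℝ] V →L[ℝ] V) →L[ℝ] (V →L[ℝ] W →L[ℝ] V) :=
      (ContinuousLinearMap.flipₗᵢ ℝ W V V).toContinuousLinearEquiv.toContinuousLinearMap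
    have hlip : ∀ s ∈ J, ∀ (x y : V) (w : W),
        ‖(A s w x + R s w) - (A s w y + R s w)‖ ≤ M * ‖x - y‖ := fun s hs x y w => by
      rw [add_sub_add_right_eq_sub, ← map_sub]
      exact (A s w).le_of_opNorm_le (hM s hs w) _
    let R₁ : ℝ → W → W →L[ℝ] V := fun s w => flipC (fderiv ℝ (A s) w) (v s w) + fderiv ℝ (R s) w
    let G' : ℝ → V × W → V × W →L[ℝ] V := fun s p => (A s p.2).comp (.fst ℝ V W) +
        (flipC (fderiv ℝ (A s) p.2) p.1 + fderiv ℝ (R s) p.2).comp (.snd ℝ V W)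
    have hGd : ∀ s ∈ J, ∀ z : V × W,
        HasFDerivAt (fun p : V × W => A s p.2 p.1 + R s p.2) (G' s z) z := fun s hs z => by
      have h1 : HasFDerivAt (fun p : V × W => A s p.2)
          ((fderiv ℝ (A s) z.2).comp (.snd ℝ V W)) z :=
        (hA.hasFDerivAt hs z.2).comp z hasFDerivAt_snd
      have h2 : HasFDerivAt (fun p : V × W => R s p.2)
          ((fderiv ℝ (R s) z.2).comp (.snd ℝ V W)) z :=
        (hR.hasFDerivAt hs z.2).comp z hasFDerivAt_snd
      refine ((h1.clm_apply hasFDerivAt_fst).add h2).congr_fderiv ?_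
      apply ContinuousLinearMap.ext
      intro x
      simp [G', flipC, add_assoc]
    have hG'c : ContinuousOn (fun p : ℝ × (V × W) => G' p.1 p.2) (J ×ˢ univ) := by
      have h1 : ContinuousOn (fun p : ℝ × (V × W) => flipC (fderiv ℝ (A p.1) p.2.2) p.2.1)
          (J ×ˢ univ) :=
        (flipC.continuous.comp_continuousOn hcA').clm_apply (by fun_prop)
      exact (hcA.clm_comp continuousOn_const).add ((h1.add hcR').clm_comp continuousOn_const)
    have key := fun w {s} (hs : s ∈ J) => hasFDerivAt_solution hJ hM0
      (G := fun s p => A s p.2 p.1 + R s p.2) hGd hG'c hlip hv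
      (fun w => (h0.hasFDerivAt rfl w).differentiableAt) w hs
    have hR₁b : UnifBdd J R₁ := by
      have h1 := UnifBdd.bilin flipC hA.unifBdd_fderiv hvb
      have h2 := hR.unifBdd_fderiv
      exact UnifBdd.add h1 h2
    have hR₁ : DerivBdd J k R₁ := by
      have h1 := DerivBdd.bilin flipC hA.fderiv hA.unifBdd_fderiv hvk hvb
      have h2 := hR.fderiv
      exact DerivBdd.add h1 h2
    have hv₁ : ∀ w, ∀ s ∈ J, HasDerivWithinAt (fun τ => fderiv ℝ (v τ) w)
        (ContinuousLinearMap.compL ℝ W V V (A s w) (fderiv ℝ (v s) w) + R₁ s w) J s := by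
      intro w s hs
      convert (key w hs).2 using 1
      have e1 : (G' s (v s w, w)).comp (.inl ℝ V W) = A s w := by
        apply ContinuousLinearMap.ext
        intro x
        simp [G']
      have e2 : (G' s (v s w, w)).comp (.inr ℝ V W) = R₁ s w := by
        apply ContinuousLinearMap.ext
        intro x
        simp [G', R₁]
      rw [e1, e2]
      rfl
    have hA₁ : DerivBdd J k fun s w => ContinuousLinearMap.compL ℝ W V V (A s w) :=
      hA.of_succ.clm_comp _
    have hA₁b : UnifBdd J fun s w => ContinuousLinearMap.compL ℝ W V V (A s w) := by
      exact UnifBdd.postcomp hAb'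
    have hv₁c : ContinuousOn (fun p : ℝ × W => fderiv ℝ (v p.1) p.2) (J ×ˢ univ) := by
      refine continuousOn_solution hJ hM0
        (G := fun s p => ContinuousLinearMap.compL ℝ W V V (A s p.2) p.1 + R₁ s p.2)
        (u := fun s w => fderiv ℝ (v s) w) ?_ ?_ hv₁ ?_
      · have h1 : ContinuousOn (fun p : ℝ × ((W →L[ℝ] V) × W) => A p.1 p.2.2) (J ×ˢ univ) :=
          hA.continuousOn.comp (f := fun p : ℝ × ((W →L[ℝ] V) × W) => (p.1, p.2.2))
            (by fun_prop) (fun p hp => ⟨hp.1, trivial⟩)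
        refine ContinuousOn.add (h1.clm_comp (by fun_prop)) ?_
        exact hR₁.continuousOn.comp (f := fun p : ℝ × ((W →L[ℝ] V) × W) => (p.1, p.2.2))
          (by fun_prop) (fun p hp => ⟨hp.1, trivial⟩)
      · intro s hs x y w
        rw [add_sub_add_right_eq_sub, ← map_sub]
        exact (ContinuousLinearMap.opNorm_comp_le _ _).trans
          (mul_le_mul_of_nonneg_right (hM s hs w) (norm_nonneg _))
      · exact (h0.fderiv.contDiff a rfl).continuous
    -- The estimate cannot be applied to `Dv` directly, since its boundedness is not yet known. The
    -- difference of two values of `v` is bounded a priori and solves the equation with a forcing of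
    -- size `O(‖w' - w‖)`, so the estimate gives a Lipschitz constant.
    have hv₁b : UnifBdd J fun s w => fderiv ℝ (v s) w := by
      obtain ⟨C₀, hC₀, hl₀⟩ := h0.exists_lipschitz
      obtain ⟨CA, hCA, hlA⟩ := hA.exists_lipschitz
      obtain ⟨CR, hCR, hlR⟩ := hR.exists_lipschitz
      obtain ⟨D, hD⟩ := hvb
      have hD0 : 0 ≤ D := (norm_nonneg _).trans (hD a hJ.left_mem 0)
      have := hE.nonneg
      refine ⟨K * (C₀ + (CA * D + CR)), fun s hs w => ?_⟩
      refine (key w hs).1.le_of_lip' (by positivity) (Eventually.of_forall fun w' => ?_)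
      have h := hE.est w (fun s => v s w' - v s w)
        (fun s => (A s w' - A s w) (v s w') + (R s w' - R s w)) ((CA * D + CR) * ‖w' - w‖)
        ⟨D + D, fun s hs => norm_sub_le_of_le (hD s hs _) (hD s hs _)⟩ (fun s hs => by
          refine ((hv w' s hs).sub (hv w s hs)).congr_deriv ?_
          rw [sub_apply, map_sub]
          abel) (fun s hs => by
          have h1 := (A s w' - A s w).le_of_opNorm_le_of_le (hlA s hs w w') (hD s hs w')
          refine (norm_add_le_of_le h1 (hlR s hs w w')).trans (le_of_eq ?_)
          ring) s hs
      refine h.trans ?_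
      rw [mul_assoc]
      exact mul_le_mul_of_nonneg_left (by linarith [hl₀ a rfl w w']) hE.nonneg
    exact DerivBdd.succ_intro hvc (fun s hs w => (key w hs).1) hv₁b
      (ih hA₁ hA₁b hR₁ hR₁b (hE.compL) hv₁ hv₁b hv₁c h0.fderiv)

set_option maxHeartbeats 400000 in
/-- Solution families of `u' = G(u, w)` are as smooth, with uniform bounds, as `G` and the initial
values, provided bounded solutions of the linearized equation are controlled. -/
theorem derivBdd_of_solution (hJ : InitialInterval a J) {r : ℕ} [CompleteSpace V] {G : V × W → V}
    (hG : DerivBdd univ (r + 1) fun _ => G) {u : ℝ → W → V}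
    (hu : ∀ w, ∀ s ∈ J, HasDerivWithinAt (fun τ => u τ w) (G (u s w, w)) J s)
    (hlip : ∃ C, ∀ w, ∀ᶠ w' in 𝓝 w, ∀ s ∈ J, ‖u s w' - u s w‖ ≤ C * ‖w' - w‖)
    (hE : BddSolutionEstimate J a K fun s w => (fderiv ℝ G (u s w, w)).comp (.inl ℝ V W))
    (h0 : DerivBdd {a} (r + 1) u) : DerivBdd J (r + 1) u := by
  obtain ⟨M, hM0, hM⟩ := hG.exists_lipschitz
  obtain ⟨B, hB⟩ := hG.unifBdd_fderiv
  have hGlip : ∀ s ∈ J, ∀ x y w, ‖G (x, w) - G (y, w)‖ ≤ M * ‖x - y‖ := fun s _ x y w => by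
    have := hM 0 trivial (y, w) (x, w)
    simpa [Prod.norm_def] using this
  have huc : ContinuousOn (fun p : ℝ × W => u p.1 p.2) (J ×ˢ univ) :=
    continuousOn_solution hJ hM0 (G := fun _ => G)
      (((hG.contDiff 0 trivial).continuous.comp continuous_snd).continuousOn) hGlip hu
      (h0.contDiff a rfl).continuous
  have hG'c : Continuous (fderiv ℝ G) := (hG.fderiv.contDiff 0 trivial).continuous
  have key := fun w {s} (hs : s ∈ J) => hasFDerivAt_solution hJ hM0 (G := fun _ => G)
    (G' := fun _ => fderiv ℝ G) (fun s _ z => hG.hasFDerivAt (s := 0) trivial z)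
    ((hG'c.comp continuous_snd).continuousOn) hGlip hu
    (fun w => (h0.hasFDerivAt rfl w).differentiableAt) w hs
  let restr (Y : Type) [NormedAddCommGroup Y] [NormedSpace ℝ Y] (L : Y →L[ℝ] V × W) :
      (V × W →L[ℝ] V) →L[ℝ] (Y →L[ℝ] V) := (ContinuousLinearMap.compL ℝ Y (V × W) V).flip L
  have hDb : UnifBdd J fun s w => fderiv ℝ G (u s w, w) := ⟨B, fun s _ w => hB 0 trivial _⟩
  have hD : ∀ {j}, j ≤ r → DerivBdd J j u → DerivBdd J j fun s w => fderiv ℝ G (u s w, w) :=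
    fun hj h => (hG.fderiv.of_le hj).comp (h.prodMk (.clm (.id ℝ W)))
  have hub : UnifBdd J fun s w => fderiv ℝ (u s) w := by
    obtain ⟨C, hC⟩ := hlip
    refine ⟨max C 0, fun s hs w => (key w hs).1.le_of_lip' (le_max_right _ _) ?_⟩
    filter_upwards [hC w] with w' hw'
    exact (hw' s hs).trans (mul_le_mul_of_nonneg_right (le_max_left _ _) (norm_nonneg _))
  -- Continuity in `(s, w)` jointly: `Du` solves a linear equation whose coefficients are already
  -- known to be continuous along `u`.
  have hu'c : ContinuousOn (fun p : ℝ × W => fderiv ℝ (u p.1) p.2) (J ×ˢ univ) := by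
    have hB0 : 0 ≤ B := (norm_nonneg _).trans (hB 0 trivial 0)
    have hc : ContinuousOn (fun p : ℝ × ((W →L[ℝ] V) × W) => fderiv ℝ G (u p.1 p.2.2, p.2.2))
        (J ×ˢ univ) :=
      (hD (Nat.zero_le _) huc).continuousOn.comp
        (f := fun p : ℝ × ((W →L[ℝ] V) × W) => (p.1, p.2.2)) (by fun_prop)
        (fun p hp => ⟨hp.1, trivial⟩)
    refine continuousOn_solution hJ (mul_nonneg hB0 (norm_nonneg (.inl ℝ V W : V →L[ℝ] V × W)))
      (G := fun s p => ((fderiv ℝ G (u s p.2, p.2)).comp (.inl ℝ V W)).comp p.1 +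
        (fderiv ℝ G (u s p.2, p.2)).comp (.inr ℝ V W)) (u := fun s w => fderiv ℝ (u s) w)
      (((hc.clm_comp continuousOn_const).clm_comp (by fun_prop)).add
        (hc.clm_comp continuousOn_const)) ?_ (fun w s hs => (key w hs).2)
      (h0.fderiv.contDiff a rfl).continuous
    intro s hs x y w
    rw [add_sub_add_right_eq_sub, ← ContinuousLinearMap.comp_sub]
    refine (ContinuousLinearMap.opNorm_comp_le _ _).trans ?_
    gcongr
    refine (ContinuousLinearMap.opNorm_comp_le _ _).trans ?_
    gcongr
    exact hB 0 trivial _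
  -- If `u` has order `j + 1`, so do the coefficients `DG(u, w)` of the variational equation; the
  -- linear result gives `Du` order `j + 1`, hence `u` order `j + 2`.
  have main : ∀ j ≤ r, DerivBdd J (j + 1) u := by
    intro j
    induction j with
    | zero => exact fun _ => DerivBdd.succ_intro huc (fun s hs w => (key w hs).1) hub hu'c
    | succ j ih =>
      intro hj
      have hDj := hD hj (ih (by omega))
      refine DerivBdd.succ_intro huc (fun s hs w => (key w hs).1) hub ?_
      refine derivBdd_of_linear hJ
        (A := fun s w => ContinuousLinearMap.compL ℝ W V V
          ((fderiv ℝ G (u s w, w)).comp (.inl ℝ V W)))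
        (R := fun s w => (fderiv ℝ G (u s w, w)).comp (.inr ℝ V W))
        ((hDj.clm_comp (restr V (.inl ℝ V W))).clm_comp _)
        (UnifBdd.postcomp (hDb.clm_comp (restr V (.inl ℝ V W))))
        (hDj.clm_comp (restr W (.inr ℝ V W))) (hDb.clm_comp (restr W (.inr ℝ V W)))
        (hE.compL) (fun w s hs => (key w hs).2) hub hu'c (h0.fderiv.of_le hj)
  exact main r le_rfl

end Bootstrap

/-! ### Compact time intervals: smoothness, uniqueness, endpoints. -/

section FiniteInterval

variable {W V : Type} [NormedAddCommGroup V] [NormedSpace ℝ V] {a b : ℝ}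

/-- On a bounded interval Grönwall alone gives the estimate, without any spectral condition. -/
theorem bddSolutionEstimate_Icc {M : ℝ} (hM : 0 ≤ M) {A : ℝ → W → V →L[ℝ] V}
    (hA : ∀ s ∈ Icc a b, ∀ w, ‖A s w‖ ≤ M) :
    BddSolutionEstimate (Icc a b) a (Real.exp ((M + 1) * (b - a))) A := by
  refine ⟨(Real.exp_pos _).le, fun w e g γ _ he hg s hs => ?_⟩
  have hγ : 0 ≤ γ := (norm_nonneg _).trans (hg s hs)
  rw [mul_comm]
  exact norm_le_mul_exp_of_norm_deriv_le hM hγ he le_rfl (fun s hs =>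
    norm_add_le_of_le ((A s w).le_of_opNorm_le (hA s hs w) _) (hg s hs)) s hs

theorem derivBdd_of_solution_Icc [NormedAddCommGroup W] [NormedSpace ℝ W] [CompleteSpace V]
    (hab : a ≤ b) {r : ℕ} {G : V × W → V}
    (hG : DerivBdd univ (r + 1) fun _ => G) {u : ℝ → W → V}
    (hu : ∀ w, ∀ s ∈ Icc a b, HasDerivWithinAt (fun τ => u τ w) (G (u s w, w)) (Icc a b) s)
    (h0 : DerivBdd {a} (r + 1) u) : DerivBdd (Icc a b) (r + 1) u := by
  obtain ⟨M, hM0, hM⟩ := hG.exists_lipschitz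
  obtain ⟨L, hL0, hL⟩ := h0.exists_lipschitz
  obtain ⟨B, hB⟩ := hG.unifBdd_fderiv
  have hB0 : 0 ≤ B := (norm_nonneg _).trans (hB 0 trivial 0)
  refine derivBdd_of_solution (.Icc hab) hG hu ⟨(L + M) * Real.exp ((M + 1) * (b - a)),
    fun w => Eventually.of_forall fun w' s hs => ?_⟩
    (bddSolutionEstimate_Icc (M := B * ‖(.inl ℝ V W : V →L[ℝ] V × W)‖)
      (mul_nonneg hB0 (norm_nonneg (.inl ℝ V W : V →L[ℝ] V × W))) fun s _ w => ?_) h0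
  · refine (norm_le_mul_exp_of_norm_deriv_le (x := fun τ => u τ w' - u τ w)
      (ε := M * ‖w' - w‖) (δ := L * ‖w' - w‖) hM0 (by positivity)
      (fun τ hτ => (hu w' τ hτ).sub (hu w τ hτ)) (hL a rfl w w') (fun τ hτ => ?_) s hs).trans
      (le_of_eq (by ring))
    refine (hM 0 trivial _ _).trans ?_
    rw [← mul_add]
    gcongr
    rw [Prod.mk_sub_mk, Prod.norm_def]
    exact max_le (by linarith [norm_nonneg (w' - w)]) (by linarith [norm_nonneg (u τ w' - u τ w)])
  · refine (ContinuousLinearMap.opNorm_comp_le _ _).trans ?_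
    gcongr
    exact hB 0 trivial _

theorem eq_of_solution_right {K : ℝ} (hK0 : 0 ≤ K) {f : V → V}
    (hK : ∀ x y, ‖f x - f y‖ ≤ K * ‖x - y‖) {x y : ℝ → V}
    (hx : ∀ t ∈ Icc a b, HasDerivWithinAt x (f (x t)) (Icc a b) t)
    (hy : ∀ t ∈ Icc a b, HasDerivWithinAt y (f (y t)) (Icc a b) t) (h : x a = y a) {t : ℝ}
    (ht : t ∈ Icc a b) : x t = y t := by
  have := norm_le_mul_exp_of_norm_deriv_le (x := fun t => x t - y t) (δ := 0) (ε := 0) hK0 le_rfl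
    (fun t ht => (hx t ht).sub (hy t ht)) (by simp [h])
    (fun t _ => by rw [add_zero]; exact hK _ _) t ht
  simpa [sub_eq_zero] using this

theorem HasDerivWithinAt.reflect {x : ℝ → V} {x' : V} {t : ℝ}
    (h : HasDerivWithinAt x x' (Icc a b) (-t)) :
    HasDerivWithinAt (fun s => x (-s)) (-x') (Icc (-b) (-a)) t := by
  have h1 : HasDerivWithinAt (fun s : ℝ => -s) (-1) (Icc (-b) (-a)) t :=
    (hasDerivAt_neg t).hasDerivWithinAt
  simpa [Function.comp_def] using h.scomp t h1
    (fun s hs => ⟨by linarith [hs.2], by linarith [hs.1]⟩)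

theorem eq_of_solution {K : ℝ} (hK0 : 0 ≤ K) {f : V → V}
    (hK : ∀ x y, ‖f x - f y‖ ≤ K * ‖x - y‖) {x y : ℝ → V}
    (hx : ∀ t ∈ Icc a b, HasDerivWithinAt x (f (x t)) (Icc a b) t)
    (hy : ∀ t ∈ Icc a b, HasDerivWithinAt y (f (y t)) (Icc a b) t) {c : ℝ} (hc : c ∈ Icc a b)
    (h : x c = y c) {t : ℝ} (ht : t ∈ Icc a b) : x t = y t := by
  rcases le_total c t with hct | hct
  · have hs : Icc c b ⊆ Icc a b := Icc_subset_Icc_left hc.1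
    exact eq_of_solution_right hK0 hK (fun s hs' => (hx s (hs hs')).mono hs)
      (fun s hs' => (hy s (hs hs')).mono hs) h ⟨hct, ht.2⟩
  · have hs : Icc a c ⊆ Icc a b := Icc_subset_Icc_right hc.2
    have hm : ∀ s ∈ Icc (-c) (-a), -s ∈ Icc a c := fun s hs' =>
      ⟨by linarith [hs'.2], by linarith [hs'.1]⟩
    have := eq_of_solution_right (a := -c) (b := -a) (f := fun v => -f v)
      (x := fun s => x (-s)) (y := fun s => y (-s)) hK0
      (fun x y => by rw [← neg_sub', norm_neg]; exact hK x y)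
      (fun s hs' => ((hx _ (hs (hm s hs'))).mono hs).reflect)
      (fun s hs' => ((hy _ (hs (hm s hs'))).mono hs).reflect) (by simpa using h)
      (t := -t) ⟨by linarith, by linarith [ht.1]⟩
    simpa using this

/-- A solution on an open interval, continuous up to the boundary, is one on the closed interval. -/
theorem hasDerivWithinAt_Icc_of_Ioo (hab : a < b) {f : V → V} (hf : Continuous f) {x : ℝ → V}
    (hc : ContinuousOn x (Icc a b)) (hx : ∀ t ∈ Ioo a b, HasDerivAt x (f (x t)) t) :
    ∀ t ∈ Icc a b, HasDerivWithinAt x (f (x t)) (Icc a b) t := by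
  have hd : DifferentiableOn ℝ x (Ioo a b) := fun t ht =>
    (hx t ht).differentiableAt.differentiableWithinAt
  -- The derivative has a limit at each endpoint, and a continuous function whose derivative
  -- converges there has that limit as one-sided derivative.
  have lim : ∀ c ∈ Icc a b, Tendsto (fun t => deriv x t) (𝓝[Ioo a b] c) (𝓝 (f (x c))) := by
    intro c hcm
    have : Tendsto (fun t => f (x t)) (𝓝[Ioo a b] c) (𝓝 (f (x c))) :=
      (hf.tendsto _).comp ((hc c hcm).mono_left (nhdsWithin_mono _ Ioo_subset_Icc_self))
    refine this.congr' ?_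
    filter_upwards [self_mem_nhdsWithin] with t ht
    exact (hx t ht).deriv.symm
  intro t ht
  rcases eq_or_lt_of_le ht.1 with rfl | h1
  · refine HasDerivWithinAt.mono ?_ Icc_subset_Ici_self
    refine hasDerivWithinAt_Ici_of_tendsto_deriv hd
      ((hc _ ht).mono Ioo_subset_Icc_self) (Ioo_mem_nhdsGT hab) ?_
    have := lim _ ht
    rwa [nhdsWithin_Ioo_eq_nhdsGT hab] at this
  rcases eq_or_lt_of_le ht.2 with rfl | h2
  · refine HasDerivWithinAt.mono ?_ Icc_subset_Iic_self
    refine hasDerivWithinAt_Iic_of_tendsto_deriv hd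
      ((hc _ ht).mono Ioo_subset_Icc_self) (Ioo_mem_nhdsLT hab) ?_
    have := lim _ ht
    rwa [nhdsWithin_Ioo_eq_nhdsLT hab] at this
  · exact (hx t ⟨h1, h2⟩).hasDerivWithinAt

end FiniteInterval

/-! ### The flow as a smooth function of time, initial point and parameter. -/

/-- A bounded substitute for the time variable, so that time can serve as a parameter ranging over
all of `ℝ` without losing the bounds on the vector field. -/
theorem exists_bddWithDerivs_eq_id (r : ℕ) {T : ℝ} (hT : 0 < T) :
    ∃ θ : ℝ → ℝ, BddWithDerivs r θ ∧ ∀ t, |t| ≤ T → θ t = t := by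
  let χ : ContDiffBump (0 : ℝ) := ⟨T, T + 1, hT, by linarith⟩
  have hc : ContDiff ℝ r fun t => χ t * t := χ.contDiff.mul contDiff_id
  have hs : HasCompactSupport fun t => χ t * t := χ.hasCompactSupport.mul_right
  refine ⟨fun t => χ t * t, ⟨hc, fun k hk => ?_⟩, fun t ht => ?_⟩
  · exact (hc.continuous_iteratedFDeriv (by exact_mod_cast hk)).bounded_above_of_compact_support
      (hs.iteratedFDeriv k)
  · have : χ t = 1 := χ.one_of_mem_closedBall (by simpa using ht)
    simp [this]

section Flow

variable {E Y : Type} [NormedAddCommGroup E] [NormedSpace ℝ E] [CompleteSpace E]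
  [NormedAddCommGroup Y] [NormedSpace ℝ Y]

/-- `x + Ξ (t, x, y)` is the flow of `x' = g (x, y)` for `|t| ≤ T`, and `Ξ` inherits the
smoothness and the bounds of `g`. -/
theorem exists_flow {r : ℕ} {g : E × Y → E} (hg : BddWithDerivs (r + 1) g) {T : ℝ} (hT : 0 < T) :
    ∃ Ξ : ℝ × (E × Y) → E, BddWithDerivs (r + 1) Ξ ∧ ∀ x y, Ξ (0, x, y) = 0 ∧
      ∀ t ∈ Icc (-T) T, HasDerivWithinAt (fun τ => x + Ξ (τ, x, y)) (g (x + Ξ (t, x, y), y))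
        (Icc (-T) T) t := by
  obtain ⟨θ, hθ, hθid⟩ := exists_bddWithDerivs_eq_id (r + 1) hT
  -- Time and initial point become parameters: the displacement `ξ` solves `ξ' = θ(t) g(x + ξ, y)`
  -- on `[0, 1]` with `ξ(0) = 0`, and its value at `1` is the displacement at time `t`. Smoothness
  -- in the parameters then covers all variables, and the displacement, unlike the flow, is bounded.
  let G : E × (ℝ × (E × Y)) → E := fun p => θ p.2.1 • g (p.2.2.1 + p.1, p.2.2.2)
  let L₁ : E × (ℝ × (E × Y)) →L[ℝ] ℝ :=
    (ContinuousLinearMap.fst ℝ ℝ (E × Y)).comp (.snd ℝ E (ℝ × (E × Y)))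
  let L₂ : E × (ℝ × (E × Y)) →L[ℝ] E × Y :=
    (ContinuousLinearMap.snd ℝ ℝ (E × Y)).comp (.snd ℝ E (ℝ × (E × Y))) +
      (ContinuousLinearMap.inl ℝ E Y).comp (.fst ℝ E (ℝ × (E × Y)))
  have hG1 : DerivBdd univ (r + 1) fun _ (p : E × (ℝ × (E × Y))) => θ (L₁ p) :=
    hθ.derivBdd.comp (.clm L₁)
  have hG2 : DerivBdd univ (r + 1) fun _ (p : E × (ℝ × (E × Y))) => g (L₂ p) :=
    hg.derivBdd.comp (.clm L₂)
  obtain ⟨Cθ, hCθ⟩ := hθ.unifBdd (J := univ)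
  obtain ⟨Cg, hCg⟩ := hg.unifBdd (J := univ)
  have hCθ0 : 0 ≤ Cθ := (norm_nonneg _).trans (hCθ 0 trivial 0)
  have hCg0 : 0 ≤ Cg := (norm_nonneg _).trans (hCg 0 trivial 0)
  have hG : DerivBdd univ (r + 1) fun _ => G := by
    refine (DerivBdd.bilin (ContinuousLinearMap.lsmul ℝ ℝ) hG1 ⟨Cθ, fun s hs w => hCθ s hs _⟩
      hG2 ⟨Cg, fun s hs w => hCg s hs _⟩).congr fun s _ => ?_
    funext p
    have e : L₂ p = (p.2.2.1 + p.1, p.2.2.2) := by apply Prod.ext <;> simp [L₂]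
    simp [G, L₁, e]
  have hGb : ∀ p, ‖G p‖ ≤ Cθ * Cg := fun p => by
    rw [norm_smul]
    have := hCθ 0 trivial p.2.1
    have := hCg 0 trivial (p.2.2.1 + p.1, p.2.2.2)
    gcongr
  obtain ⟨M, hM0, hM⟩ := hG.exists_lipschitz
  obtain ⟨K, hK0, hK⟩ := (hg.derivBdd (J := univ)).exists_lipschitz
  have hGlip : ∀ w x y, ‖G (x, w) - G (y, w)‖ ≤ M * ‖x - y‖ := fun w x y => by
    simpa [Prod.norm_def] using hM 0 trivial (y, w) (x, w)
  have hglip : ∀ z y x x', ‖g (z + x, y) - g (z + x', y)‖ ≤ K * ‖x - x'‖ := fun z y x x' => by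
    simpa [Prod.norm_def] using hK 0 trivial (z + x', y) (z + x, y)
  have hex : ∀ w, ∃ ξ : ℝ → E, ξ 0 = 0 ∧
      ∀ s ∈ Icc (0 : ℝ) 1, HasDerivWithinAt ξ (G (ξ s, w)) (Icc 0 1) s := fun w =>
    exists_solution_of_bounded_lipschitz (f := fun _ x => G (x, w)) ⟨le_rfl, zero_le_one⟩
      (fun _ _ => hGlip w) (fun _ => continuousOn_const) (fun _ _ x => hGb _) 0
  choose ξ hξ0 hξ using hex
  have hsm : DerivBdd (Icc 0 1) (r + 1) fun s w => ξ w s :=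
    derivBdd_of_solution_Icc zero_le_one hG (u := fun s w => ξ w s) hξ
      ((DerivBdd.const 0).congr fun s hs => by
        rw [mem_singleton_iff.1 hs]; exact funext hξ0)
  have h1m : (1 : ℝ) ∈ Icc (0 : ℝ) 1 := ⟨zero_le_one, le_rfl⟩
  refine ⟨fun w => ξ w 1, ?_, fun x y => ?_⟩
  · have hb : UnifBdd univ fun (_ : ℝ) w => ξ w 1 := by
      refine ⟨(0 + Cθ * Cg) * Real.exp ((0 + 1) * (1 - 0)), fun _ _ w => ?_⟩
      exact norm_le_mul_exp_of_norm_deriv_le le_rfl (mul_nonneg hCθ0 hCg0) (hξ w)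
        (by rw [hξ0, norm_zero]) (fun t _ => by simpa using hGb _) 1 h1m
    refine DerivBdd.bddWithDerivs (.of_contDiff (hsm.contDiff 1 h1m) fun j h1 hj => ?_) hb
    obtain ⟨C, hC⟩ := hsm.exists_bound h1 hj
    exact ⟨C, hC 1 h1m⟩
  · obtain ⟨γ, hγ0, hγ⟩ := exists_solution_of_bounded_lipschitz (f := fun _ ξ => g (x + ξ, y))
      (a := -T) (b := T) (t₀ := 0) ⟨by linarith, hT.le⟩ (fun _ _ => hglip x y)
      (fun _ => continuousOn_const) (fun _ _ z => hCg 0 trivial _) 0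
    have heq : ∀ t ∈ Icc (-T) T, ξ (t, x, y) 1 = γ t := by
      intro t ht
      have hmaps : MapsTo (fun s : ℝ => s * t) (Icc 0 1) (Icc (-T) T) := fun s hs => by
        have ht' := abs_le.2 ht
        refine abs_le.1 ?_
        rw [abs_mul, abs_of_nonneg hs.1]
        exact (mul_le_of_le_one_left (abs_nonneg _) hs.2).trans ht'
      have hsol : ∀ s ∈ Icc (0 : ℝ) 1,
          HasDerivWithinAt (fun s => γ (s * t)) (G (γ (s * t), (t, x, y))) (Icc 0 1) s := by
        intro s hs
        have h1 : HasDerivWithinAt (fun s : ℝ => s * t) t (Icc 0 1) s := by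
          simpa using ((hasDerivAt_id s).mul_const t).hasDerivWithinAt
        have h2 := (hγ (s * t) (hmaps hs)).scomp s h1 hmaps
        have e : G (γ (s * t), (t, x, y)) = t • g (x + γ (s * t), y) := by
          simp only [G]
          rw [hθid t (abs_le.2 ht)]
        rw [e]
        exact h2
      have := eq_of_solution_right hM0 (hGlip (t, x, y)) (hξ (t, x, y)) hsol
        (by rw [hξ0, zero_mul, hγ0]) h1m
      simpa using this
    have h0m : (0 : ℝ) ∈ Icc (-T) T := ⟨by linarith, hT.le⟩
    beta_reduce
    refine ⟨by rw [heq 0 h0m, hγ0], fun t ht => ?_⟩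
    rw [heq t ht]
    exact ((hγ t ht).const_add x).congr (fun τ hτ => by rw [heq τ hτ]) (by rw [heq t ht])

end Flow

/-- A bounded function which is bounded by `B + D / 2` whenever it is bounded by `D` is bounded by
`2 * B`. -/
theorem le_two_mul_of_absorb {S : Set ℝ} {f : ℝ → ℝ} {B : ℝ} (hb : ∃ D, ∀ s ∈ S, f s ≤ D)
    (h : ∀ D, (∀ s ∈ S, f s ≤ D) → ∀ s ∈ S, f s ≤ B + D / 2) : ∀ s ∈ S, f s ≤ 2 * B := by
  intro s hs
  obtain ⟨D, hD⟩ := hb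
  have hbdd : BddAbove (f '' S) := ⟨D, by rintro _ ⟨t, ht, rfl⟩; exact hD t ht⟩
  have h1 : ∀ t ∈ S, f t ≤ sSup (f '' S) := fun t ht => le_csSup hbdd (mem_image_of_mem f ht)
  have h2 : sSup (f '' S) ≤ B + sSup (f '' S) / 2 :=
    csSup_le ⟨_, mem_image_of_mem f hs⟩ (by rintro _ ⟨t, ht, rfl⟩; exact h _ h1 t ht)
  linarith [h1 s hs]

/-! ### Bounded solutions of linear equations with spectrum off the imaginary axis. -/

section ScalarEquation

variable {V : Type} [NormedAddCommGroup V] [NormedSpace ℂ V]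

/-- Integrating factor: the derivative of `exp(-z(τ - s)) x(τ)` is `exp(-z(τ - s)) h(τ)`, and the
right side integrates its norm bound. It serves both signs of `Re z`. -/
theorem norm_exp_smul_sub_le {z : ℂ} (hz : z.re ≠ 0) {a γ : ℝ} {x h : ℝ → V}
    (hx : ∀ s ∈ Ici a, HasDerivWithinAt x (z • x s + h s) (Ici a) s)
    (hh : ∀ s ∈ Ici a, ‖h s‖ ≤ γ) {s t : ℝ} (hs : a ≤ s) (hst : s ≤ t) :
    ‖Complex.exp (-z * (t - s : ℝ)) • x t - x s‖ ≤
      γ / (-z.re) * (Real.exp (-z.re * (t - s)) - 1) := by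
  have hexp : ∀ τ : ℝ, HasDerivAt (fun τ : ℝ => Complex.exp (-z * (τ - s : ℝ)))
      (Complex.exp (-z * (τ - s : ℝ)) * -z) τ := fun τ => by
    have h1 : HasDerivAt (fun τ : ℝ => -z * ((τ - s : ℝ) : ℂ)) (-z) τ := by
      simpa using (((hasDerivAt_id τ).sub_const s).ofReal_comp).const_mul (-z)
    exact h1.cexp
  have hd : ∀ τ ∈ Ici s, HasDerivWithinAt (fun τ => Complex.exp (-z * (τ - s : ℝ)) • x τ - x s)
      (Complex.exp (-z * (τ - s : ℝ)) • h τ) (Ici s) τ := fun τ hτ => by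
    have h1 := ((hexp τ).hasDerivWithinAt (s := Ici s)).smul
      ((hx τ (hs.trans hτ)).mono (Ici_subset_Ici.2 hs))
    refine (h1.sub_const (x s)).congr_deriv ?_
    rw [smul_add, smul_smul, mul_neg, neg_smul]
    abel
  have hB : ∀ τ, HasDerivAt (fun τ => γ / (-z.re) * (Real.exp (-z.re * (τ - s)) - 1))
      (Real.exp (-z.re * (τ - s)) * γ) τ := fun τ => by
    have h1 : HasDerivAt (fun τ : ℝ => -z.re * (τ - s)) (-z.re) τ := by
      simpa using ((hasDerivAt_id τ).sub_const s).const_mul (-z.re)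
    refine ((h1.exp.sub_const 1).const_mul (γ / (-z.re))).congr_deriv ?_
    field_simp
  refine image_norm_le_of_norm_deriv_right_le_deriv_boundary (a := s) (b := t)
    (fun τ hτ => ((hd τ hτ.1).continuousWithinAt).mono Icc_subset_Ici_self)
    (fun τ hτ => (hd τ hτ.1).mono (Ici_subset_Ici.2 hτ.1)) (by simp) hB (fun τ hτ => ?_)
    ⟨hst, le_rfl⟩
  rw [norm_smul, Complex.norm_exp]
  have e : (-z * (τ - s : ℝ)).re = -z.re * (τ - s) := by simp
  rw [e]
  gcongr
  exact hh τ (hs.trans hτ.1)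

/-- Bounded solutions of `x' = z x + h` with `Re z ≠ 0`. -/
theorem norm_le_of_bounded_solution_scalar {z : ℂ} {δ : ℝ} (hδ : 0 < δ) (hz : δ ≤ |z.re|)
    {a γ : ℝ} {x h : ℝ → V} (hx : ∀ s ∈ Ici a, HasDerivWithinAt x (z • x s + h s) (Ici a) s)
    (hb : ∃ C, ∀ s ∈ Ici a, ‖x s‖ ≤ C) (hh : ∀ s ∈ Ici a, ‖h s‖ ≤ γ) :
    ∀ s ∈ Ici a, ‖x s‖ ≤ ‖x a‖ + γ / δ := by
  intro s hs
  have hγ : 0 ≤ γ := (norm_nonneg _).trans (hh s hs)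
  have hre : z.re ≠ 0 := fun h0 => by rw [h0, abs_zero] at hz; linarith
  have hnorm : ∀ t u : ℝ, ‖Complex.exp (-z * (t - u : ℝ))‖ = Real.exp (-z.re * (t - u)) :=
    fun t u => by rw [Complex.norm_exp]; simp
  rcases lt_or_gt_of_ne hre with hneg | hpos
  · rw [abs_of_neg hneg] at hz
    have h1 := norm_exp_smul_sub_le hre hx hh le_rfl hs
    have h2 := norm_add_le_of_le h1 (le_refl ‖x a‖)
    rw [sub_add_cancel, norm_smul, hnorm] at h2
    set q := Real.exp (-z.re * (s - a))
    have hq : 1 ≤ q := Real.one_le_exp (mul_nonneg (by linarith) (sub_nonneg.2 hs))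
    have h3 : γ / (-z.re) ≤ γ / δ := div_le_div_of_nonneg_left hγ hδ hz
    have h4 : γ / (-z.re) * (q - 1) ≤ γ / δ * q := by
      apply mul_le_mul h3 (by linarith) (by linarith) (by positivity)
    have h5 : q * ‖x s‖ ≤ q * (‖x a‖ + γ / δ) := by nlinarith [norm_nonneg (x a)]
    exact le_of_mul_le_mul_left h5 (by linarith)
  · rw [abs_of_pos hpos] at hz
    obtain ⟨C, hC⟩ := hb
    -- Unstable case: `x s` is read off from the future. Letting `t → ∞` removes the first term
    -- precisely because `x` is bounded by `C`.
    have key : ∀ t ∈ Ici s, ‖x s‖ ≤ Real.exp (-z.re * (t - s)) * C + γ / δ := by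
      intro t ht
      have h1 := norm_exp_smul_sub_le hre hx hh hs ht
      rw [norm_sub_rev] at h1
      have h2 := norm_add_le_of_le h1
        (le_refl ‖Complex.exp (-z * (t - s : ℝ)) • x t‖)
      rw [sub_add_cancel, norm_smul, hnorm] at h2
      have h3 : γ / z.re ≤ γ / δ := div_le_div_of_nonneg_left hγ hδ hz
      have h4 : γ / (-z.re) * (Real.exp (-z.re * (t - s)) - 1) ≤ γ / δ := by
        have : γ / (-z.re) * (Real.exp (-z.re * (t - s)) - 1) =
          γ / z.re - γ / z.re * Real.exp (-z.re * (t - s)) := by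
          field_simp
          ring
        rw [this]
        have : 0 ≤ γ / z.re * Real.exp (-z.re * (t - s)) := by positivity
        linarith
      have h5 := mul_le_mul_of_nonneg_left (hC t (show a ≤ t from le_trans hs ht))
        (Real.exp_pos (-z.re * (t - s))).le
      linarith
    have hlim : Tendsto (fun t => Real.exp (-z.re * (t - s)) * C + γ / δ) atTop
        (𝓝 (0 * C + γ / δ)) := by
      refine Tendsto.add_const _ (Tendsto.mul_const _ (Real.tendsto_exp_atBot.comp ?_))
      exact (tendsto_atTop_add_const_right _ (-s) tendsto_id).const_mul_atTop_of_neg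
        (by linarith)
    have := ge_of_tendsto hlim (eventually_ge_atTop s |>.mono key)
    linarith [norm_nonneg (x a)]

open Polynomial in
/-- Bounded solutions of `x' = L x + h` when a polynomial in `L` with roots off the imaginary axis
annihilates `x`. -/
theorem exists_norm_le_of_bounded_solution_of_roots (m : ℕ) {C δ : ℝ} (hC : 0 ≤ C) (hδ : 0 < δ) :
    ∃ κ, 0 ≤ κ ∧ ∀ {V : Type} [NormedAddCommGroup V] [NormedSpace ℂ V] (L : V →L[ℂ] V),
      ‖L‖ ≤ C → ∀ Λ : List ℂ, Λ.length = m → (∀ z ∈ Λ, δ ≤ |z.re| ∧ ‖z‖ ≤ C) →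
      ∀ (a γ : ℝ) (x h : ℝ → V), (∀ s ∈ Ici a, HasDerivWithinAt x (L (x s) + h s) (Ici a) s) →
      (∃ B, ∀ s ∈ Ici a, ‖x s‖ ≤ B) → (∀ s ∈ Ici a, ‖h s‖ ≤ γ) →
      (∀ s ∈ Ici a, aeval (L : V →ₗ[ℂ] V) (Λ.map fun z => X - Polynomial.C z).prod (x s) = 0) →
      ∀ s ∈ Ici a, ‖x s‖ ≤ κ * (‖x a‖ + γ) := by
  induction m with
  | zero =>
    refine ⟨0, le_rfl, fun L _ Λ hΛ _ a γ x h _ _ _ h0 s hs => ?_⟩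
    rw [List.length_eq_zero_iff] at hΛ
    subst hΛ
    have := h0 s hs
    simp only [List.map_nil, List.prod_nil, map_one, Module.End.one_apply] at this
    simp [this]
  | succ m ih =>
    obtain ⟨κ, hκ, ih⟩ := ih
    -- For the first root `z`, the function `(L - z)x` solves an equation of the same kind and is
    -- annihilated by the remaining factors, so the induction bounds it. Then `x' = z x + ((L - z)x
    -- + h)` is a scalar equation; `2 * C` bounds `‖L - z‖`.
    refine ⟨1 + (κ * (2 * C) + 1) / δ, by positivity, ?_⟩
    intro V _ _ L hL Λ hΛ hroots a γ x h hx ⟨B, hB⟩ hh h0 s hs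
    obtain _ | ⟨z, Λ⟩ := Λ
    · simp at hΛ
    have hγ : 0 ≤ γ := (norm_nonneg _).trans (hh s hs)
    obtain ⟨hz, hzC⟩ := hroots z (by simp)
    let P : V →L[ℂ] V := L - z • .id ℂ V
    have hP : ‖P‖ ≤ 2 * C := by
      refine (norm_sub_le_of_le hL ((norm_smul_le _ _).trans
        (mul_le_mul hzC ContinuousLinearMap.norm_id_le (norm_nonneg _) hC))).trans
        (le_of_eq (by ring))
    have hy : ∀ s ∈ Ici a, HasDerivWithinAt (fun s => P (x s)) (L (P (x s)) + P (h s)) (Ici a) s :=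
      fun s hs => by
        have := (P.restrictScalars ℝ).hasFDerivAt.comp_hasDerivWithinAt s (hx s hs)
        refine this.congr_deriv ?_
        simp only [ContinuousLinearMap.coe_restrictScalars', map_add, P, sub_apply,
          smul_apply, ContinuousLinearMap.id_apply, map_sub, map_smul]
    have hest := ih L hL Λ (by simpa using hΛ) (fun w hw => hroots w (by simp [hw])) a
      (2 * C * γ) (fun s => P (x s)) (fun s => P (h s)) hy
      ⟨2 * C * B, fun s hs => P.le_of_opNorm_le_of_le hP (hB s hs)⟩
      (fun s hs => P.le_of_opNorm_le_of_le hP (hh s hs)) (fun s hs => by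
        have := h0 s hs
        rw [List.map_cons, List.prod_cons, mul_comm, map_mul, Module.End.mul_apply] at this
        rw [← this]
        congr 1
        simp [P, Algebra.algebraMap_eq_smul_one])
    have hest' : ∀ s ∈ Ici a, ‖P (x s) + h s‖ ≤ κ * (2 * C * (‖x a‖ + γ)) + γ := fun s hs => by
      refine norm_add_le_of_le ((hest s hs).trans ?_) (hh s hs)
      rw [mul_add (2 * C)]
      gcongr
      exact P.le_of_opNorm_le hP _
    have := norm_le_of_bounded_solution_scalar hδ hz (x := x) (h := fun s => P (x s) + h s)
      (fun s hs => by
        refine (hx s hs).congr_deriv ?_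
        simp only [P, sub_apply, smul_apply, ContinuousLinearMap.id_apply]
        abel) ⟨B, hB⟩ hest' s hs
    refine this.trans ?_
    have h1 : (κ * (2 * C * (‖x a‖ + γ)) + γ) / δ ≤ (κ * (2 * C) + 1) / δ * (‖x a‖ + γ) := by
      rw [div_mul_eq_mul_div]
      gcongr
      nlinarith [norm_nonneg (x a)]
    rw [add_mul, one_mul]
    linarith

end ScalarEquation
-- Passage from real matrices to complex ones, and the dichotomy estimate.
section Complexification

variable {n : ℕ}

/-- The inclusion of real vectors into complex vectors. -/
noncomputable def complexify (n : ℕ) : EuclideanSpace ℝ (Fin n) →L[ℝ] (Fin n → ℂ) :=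
  ContinuousLinearMap.pi fun i => Complex.ofRealCLM.comp (EuclideanSpace.proj i)

/-- The complexification of a real linear map. -/
noncomputable def complexifyMap (A : EuclideanSpace ℝ (Fin n) →L[ℝ] EuclideanSpace ℝ (Fin n)) :
    (Fin n → ℂ) →L[ℂ] (Fin n → ℂ) :=
  LinearMap.toContinuousLinearMap (Matrix.toLin' ((LinearMap.toMatrix
    (EuclideanSpace.basisFun (Fin n) ℝ).toBasis (EuclideanSpace.basisFun (Fin n) ℝ).toBasis
    (A : EuclideanSpace ℝ (Fin n) →ₗ[ℝ] EuclideanSpace ℝ (Fin n))).map (algebraMap ℝ ℂ)))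

theorem complexifyMap_complexify (A : EuclideanSpace ℝ (Fin n) →L[ℝ] EuclideanSpace ℝ (Fin n))
    (x : EuclideanSpace ℝ (Fin n)) : complexifyMap A (complexify n x) = complexify n (A x) := by
  have h := LinearMap.toMatrix_mulVec_repr (EuclideanSpace.basisFun (Fin n) ℝ).toBasis
    (EuclideanSpace.basisFun (Fin n) ℝ).toBasis
    (A : EuclideanSpace ℝ (Fin n) →ₗ[ℝ] EuclideanSpace ℝ (Fin n)) x
  funext i
  have hi := congrFun h i
  simp only [complexifyMap, LinearMap.coe_toContinuousLinearMap', Matrix.toLin'_apply]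
  simp only [Matrix.mulVec, dotProduct, Matrix.map_apply] at hi ⊢
  simp only [OrthonormalBasis.coe_toBasis_repr_apply, EuclideanSpace.basisFun_repr,
    ContinuousLinearMap.coe_coe] at hi
  simpa [complexify] using congrArg (fun r : ℝ => (r : ℂ)) hi

theorem charpoly_complexifyMap (A : EuclideanSpace ℝ (Fin n) →L[ℝ] EuclideanSpace ℝ (Fin n)) :
    (complexifyMap A : (Fin n → ℂ) →ₗ[ℂ] (Fin n → ℂ)).charpoly =
      (A : EuclideanSpace ℝ (Fin n) →ₗ[ℝ] EuclideanSpace ℝ (Fin n)).charpoly.map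
        (algebraMap ℝ ℂ) := by
  rw [complexifyMap, LinearMap.coe_toContinuousLinearMap, Matrix.charpoly_toLin', Matrix.charpoly_map,
    LinearMap.charpoly_toMatrix]

/-- Eigenvectors of the complexification make two facts accessible: eigenvalues are bounded by the
operator norm, and negating `A` negates them. -/
theorem mem_complexEigenvalues_iff
    {A : EuclideanSpace ℝ (Fin n) →L[ℝ] EuclideanSpace ℝ (Fin n)} {z : ℂ} :
    z ∈ complexEigenvalues A ↔ ∃ v, v ≠ 0 ∧ complexifyMap A v = z • v := by
  rw [complexEigenvalues, ← charpoly_complexifyMap,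
    Polynomial.mem_roots (LinearMap.charpoly_monic _).ne_zero,
    ← Module.End.hasEigenvalue_iff_isRoot_charpoly]
  constructor
  · intro h
    obtain ⟨v, hv⟩ := h.exists_hasEigenvector
    exact ⟨v, hv.2, hv.apply_eq_smul⟩
  · rintro ⟨v, hv, h⟩
    exact Module.End.hasEigenvalue_of_hasEigenvector (x := v)
      ⟨Module.End.mem_eigenspace_iff.2 h, hv⟩

theorem complexifyMap_neg (A : EuclideanSpace ℝ (Fin n) →L[ℝ] EuclideanSpace ℝ (Fin n)) :
    complexifyMap (-A) = -complexifyMap A := by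
  ext v i
  simp [complexifyMap, Matrix.toLin'_apply, Matrix.mulVec, dotProduct]

theorem neg_mem_complexEigenvalues
    {A : EuclideanSpace ℝ (Fin n) →L[ℝ] EuclideanSpace ℝ (Fin n)} {z : ℂ}
    (hz : z ∈ complexEigenvalues (-A)) : -z ∈ complexEigenvalues A := by
  obtain ⟨v, hv, h⟩ := mem_complexEigenvalues_iff.1 hz
  refine mem_complexEigenvalues_iff.2 ⟨v, hv, ?_⟩
  rw [complexifyMap_neg, neg_apply] at h
  rw [neg_smul, ← h, neg_neg]

/-- A complex vector splits into real and imaginary parts, on each of which the complexified map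
acts as `A`. One `q` depending only on `n` keeps the later estimates uniform in the matrix. -/
theorem exists_norm_complexifyMap_le (n : ℕ) : ∃ q, 0 ≤ q ∧ (∀ x, ‖complexify n x‖ ≤ q * ‖x‖) ∧
    (∀ x, ‖x‖ ≤ q * ‖complexify n x‖) ∧
    ∀ A : EuclideanSpace ℝ (Fin n) →L[ℝ] EuclideanSpace ℝ (Fin n),
      ‖complexifyMap A‖ ≤ q * ‖A‖ := by
  let e := EuclideanSpace.equiv (Fin n) ℝ
  let q₁ := ‖complexify n‖
  let q₂ := ‖(e.symm : (Fin n → ℝ) →L[ℝ] EuclideanSpace ℝ (Fin n))‖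
  have h2 : ∀ v : Fin n → ℝ, ‖e.symm v‖ ≤ q₂ * ‖v‖ := fun v =>
    (e.symm : (Fin n → ℝ) →L[ℝ] EuclideanSpace ℝ (Fin n)).le_opNorm v
  have h1 : ∀ x, ‖complexify n x‖ ≤ q₁ * ‖x‖ := (complexify n).le_opNorm
  have h0 : ∀ x, ‖e x‖ = ‖complexify n x‖ := fun x => by
    simp only [Pi.norm_def, complexify, ContinuousLinearMap.coe_pi']
    congr 1
    refine Finset.sup_congr rfl fun i _ => ?_
    apply NNReal.eq
    simp [e]
  have hq₁ : 0 ≤ q₁ := norm_nonneg _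
  have hq₂ : 0 ≤ q₂ := norm_nonneg _
  refine ⟨q₁ + q₂ + 2 * (q₁ * q₂), by positivity, fun x => (h1 x).trans ?_, fun x => ?_,
    fun A => ContinuousLinearMap.opNorm_le_bound _ (by positivity) fun v => ?_⟩
  · gcongr
    nlinarith [mul_nonneg hq₁ hq₂]
  · have := h2 (e x)
    rw [e.symm_apply_apply, h0] at this
    refine this.trans ?_
    gcongr
    nlinarith [mul_nonneg hq₁ hq₂]
  · let vr := e.symm fun i => (v i).re
    let vi := e.symm fun i => (v i).im
    have hv : v = complexify n vr + Complex.I • complexify n vi := by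
      funext i
      simp [complexify, vr, vi, e, mul_comm Complex.I, Complex.re_add_im]
    have hr : ‖vr‖ ≤ q₂ * ‖v‖ := (h2 _).trans (mul_le_mul_of_nonneg_left
      ((pi_norm_le_iff_of_nonneg (norm_nonneg _)).2 fun i =>
        (Complex.abs_re_le_norm _).trans (norm_le_pi_norm v i)) hq₂)
    have hi : ‖vi‖ ≤ q₂ * ‖v‖ := (h2 _).trans (mul_le_mul_of_nonneg_left
      ((pi_norm_le_iff_of_nonneg (norm_nonneg _)).2 fun i =>
        (Complex.abs_im_le_norm _).trans (norm_le_pi_norm v i)) hq₂)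
    have hb : ∀ w, ‖w‖ ≤ q₂ * ‖v‖ → ‖complexify n (A w)‖ ≤ q₁ * (‖A‖ * (q₂ * ‖v‖)) := fun w hw =>
      (h1 _).trans (mul_le_mul_of_nonneg_left (A.le_opNorm_of_le hw) hq₁)
    have e1 : complexifyMap A v = complexify n (A vr) + Complex.I • complexify n (A vi) := by
      conv_lhs => rw [hv]
      rw [map_add, map_smul, complexifyMap_complexify, complexifyMap_complexify]
    rw [e1]
    have hbi : ‖Complex.I • complexify n (A vi)‖ ≤ q₁ * (‖A‖ * (q₂ * ‖v‖)) := by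
      rw [norm_smul, Complex.norm_I, one_mul]
      exact hb _ hi
    refine (norm_add_le_of_le (hb _ hr) hbi).trans ?_
    have : 0 ≤ (q₁ + q₂) * ‖A‖ * ‖v‖ := by positivity
    nlinarith

/-- Exponential dichotomy: bounded solutions of `x' = A x + h` are controlled by `x(a)` and
`sup ‖h‖`, uniformly in the matrix `A` as long as its spectrum stays off the imaginary axis. -/
theorem exists_norm_le_of_bounded_solution (n : ℕ) {C δ : ℝ} (hC : 0 ≤ C) (hδ : 0 < δ) :
    ∃ κ, 0 ≤ κ ∧ ∀ A : EuclideanSpace ℝ (Fin n) →L[ℝ] EuclideanSpace ℝ (Fin n), ‖A‖ ≤ C →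
      (∀ z ∈ complexEigenvalues A, δ < |z.re|) →
      ∀ (a γ : ℝ) (x h : ℝ → EuclideanSpace ℝ (Fin n)),
      (∀ s ∈ Ici a, HasDerivWithinAt x (A (x s) + h s) (Ici a) s) →
      (∃ B, ∀ s ∈ Ici a, ‖x s‖ ≤ B) → (∀ s ∈ Ici a, ‖h s‖ ≤ γ) →
      ∀ s ∈ Ici a, ‖x s‖ ≤ κ * (‖x a‖ + γ) := by
  obtain ⟨q, hq0, hq1, hq2, hq3⟩ := exists_norm_complexifyMap_le n
  obtain ⟨κ, hκ, hest⟩ := exists_norm_le_of_bounded_solution_of_roots n (mul_nonneg hq0 hC) hδ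
  refine ⟨q * (κ * q), by positivity, fun A hA hspec a γ x h hx ⟨B, hB⟩ hh s hs => ?_⟩
  have hL : ‖complexifyMap A‖ ≤ q * C := (hq3 A).trans (mul_le_mul_of_nonneg_left hA hq0)
  have hsplit := IsAlgClosed.splits
    (complexifyMap A : (Fin n → ℂ) →ₗ[ℂ] (Fin n → ℂ)).charpoly
  have hmonic := LinearMap.charpoly_monic (complexifyMap A : (Fin n → ℂ) →ₗ[ℂ] (Fin n → ℂ))
  have hroots : complexEigenvalues A =
    (complexifyMap A : (Fin n → ℂ) →ₗ[ℂ] (Fin n → ℂ)).charpoly.roots := by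
    rw [charpoly_complexifyMap, complexEigenvalues]
  have hprod : (((complexEigenvalues A).toList.map fun z => Polynomial.X - Polynomial.C z).prod) =
      (complexifyMap A : (Fin n → ℂ) →ₗ[ℂ] (Fin n → ℂ)).charpoly := by
    rw [← Multiset.prod_coe, ← Multiset.map_coe, Multiset.coe_toList, hroots]
    exact (hsplit.eq_prod_roots_of_monic hmonic).symm
  have key := hest (complexifyMap A) hL (complexEigenvalues A).toList
    (by
      rw [Multiset.length_toList, hroots, ← hsplit.natDegree_eq_card_roots,
        LinearMap.charpoly_natDegree, Module.finrank_fin_fun])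
    (fun z hz => by
      rw [Multiset.mem_toList] at hz
      refine ⟨(hspec z hz).le, ?_⟩
      obtain ⟨v, hv, hvz⟩ := mem_complexEigenvalues_iff.1 hz
      have := (complexifyMap A).le_of_opNorm_le hL v
      rw [hvz, norm_smul] at this
      exact le_of_mul_le_mul_right this (norm_pos_iff.2 hv))
    a (q * γ) (fun s => complexify n (x s)) (fun s => complexify n (h s))
    (fun s hs => by
      refine ((complexify n).hasFDerivAt.comp_hasDerivWithinAt s (hx s hs)).congr_deriv ?_
      rw [map_add, complexifyMap_complexify])
    ⟨q * B, fun s hs => (hq1 _).trans (mul_le_mul_of_nonneg_left (hB s hs) hq0)⟩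
    (fun s hs => (hq1 _).trans (mul_le_mul_of_nonneg_left (hh s hs) hq0))
    -- Cayley–Hamilton: the product over all eigenvalues annihilates every vector, whether or not
    -- the matrix is diagonalizable.
    (fun s hs => by rw [hprod, LinearMap.aeval_self_charpoly]; rfl) s hs
  calc ‖x s‖ ≤ q * ‖complexify n (x s)‖ := hq2 _
    _ ≤ q * (κ * (q * ‖x a‖ + q * γ)) := by
        gcongr
        exact key.trans (by gcongr; exact hq1 _)
    _ = q * (κ * q) * (‖x a‖ + γ) := by ring

/-- The dichotomy estimate persists under small bounded perturbations of the coefficient. -/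
theorem exists_bddSolutionEstimate_Ici (n : ℕ) {C δ : ℝ} (hC : 0 ≤ C) (hδ : 0 < δ) :
    ∃ κ ε, 0 < ε ∧ ∀ {W : Type}
      (A₀ : W → EuclideanSpace ℝ (Fin n) →L[ℝ] EuclideanSpace ℝ (Fin n))
      (A : ℝ → W → EuclideanSpace ℝ (Fin n) →L[ℝ] EuclideanSpace ℝ (Fin n)) (a : ℝ),
      (∀ w, ‖A₀ w‖ ≤ C) → (∀ w, ∀ z ∈ complexEigenvalues (A₀ w), δ < |z.re|) →
      (∀ s ∈ Ici a, ∀ w, ‖A s w - A₀ w‖ ≤ ε) → BddSolutionEstimate (Ici a) a κ A := by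
  obtain ⟨κ, hκ, hest⟩ := exists_norm_le_of_bounded_solution n hC hδ
  -- The perturbation term `(A - A₀)e` is moved into the forcing; this size makes its contribution
  -- at most half of any bound for `‖e‖`, which is absorbed at the price of doubling `κ`.
  refine ⟨2 * κ, 1 / (2 * (κ + 1)), by positivity, fun A₀ A a hA₀ hspec hA => ⟨by positivity,
    fun w e g γ hb he hg s hs => ?_⟩⟩
  rw [mul_assoc]
  refine le_two_mul_of_absorb (f := fun s => ‖e s‖) hb (fun D hD s hs => ?_) s hs
  have hD0 : 0 ≤ D := (norm_nonneg _).trans (hD s hs)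
  have := hest (A₀ w) (hA₀ w) (hspec w) a (1 / (2 * (κ + 1)) * D + γ) e
    (fun s => (A s w - A₀ w) (e s) + g s) (fun s hs => by
      refine (he s hs).congr_deriv ?_
      rw [sub_apply]
      abel) hb (fun s hs => norm_add_le_of_le
        (ContinuousLinearMap.le_of_opNorm_le_of_le _ (hA s hs w) (hD s hs)) (hg s hs)) s hs
  refine this.trans ?_
  have h1 : κ * (1 / (2 * (κ + 1)) * D) ≤ D / 2 := by
    have : κ * (1 / (2 * (κ + 1))) ≤ 1 / 2 := by
      rw [mul_one_div, div_le_div_iff₀ (by positivity) (by norm_num)]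
      linarith
    nlinarith
  linarith

end Complexification

/-! ### Crossing times as implicit functions. -/

section Implicit

variable {Y : Type} [NormedAddCommGroup Y]

/-- Continuity of the first positive-slope zero `σ` of `H (y, ·)` after the time `τ`. -/
theorem continuousAt_firstZero {H : Y × ℝ → ℝ} (hH : Continuous H) {τ σ : Y → ℝ} {y : Y}
    (hτ : ContinuousAt τ y) (h0 : ∀ y, H (y, σ y) = 0)
    (hneg : ∀ y, ∀ t ∈ Ioo (τ y) (σ y), H (y, t) < 0) {H' : ℝ} (hH' : 0 < H')
    (hd : HasDerivAt (fun t => H (y, t)) H' (σ y)) (hlt : τ y < σ y) {κ : ℝ} (hκ : 0 < κ)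
    (hsep : ∀ᶠ x in 𝓝 y, τ y + κ ≤ σ x) : ContinuousAt σ y := by
  rw [ContinuousAt, tendsto_order]
  constructor
  · intro c hc
    -- Negativity on this compact interval persists for nearby parameters, so they have no zero
    -- there; `hsep` excludes zeros collapsing onto the starting time.
    have hK : ∀ t ∈ Icc (τ y + κ) c, H (y, t) < 0 := fun t ht =>
      hneg y t ⟨by linarith [ht.1], ht.2.trans_lt hc⟩
    have := isCompact_Icc.eventually_forall_of_forall_eventually (x₀ := y)
      (K := Icc (τ y + κ) c) (P := fun x t => H (x, t) < 0) fun t ht =>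
        hH.continuousAt.eventually_lt continuousAt_const (hK t ht)
    filter_upwards [this, hsep] with x hx hsx
    by_contra hcx
    have := hx (σ x) ⟨hsx, not_lt.1 hcx⟩
    rw [h0] at this
    exact lt_irrefl _ this
  · intro c hc
    -- Positive slope makes `H` positive just after `σ y`, hence at a fixed such `t` for nearby
    -- parameters, which must therefore have crossed earlier.
    have hpos : ∀ᶠ t in 𝓝[>] (σ y), 0 < H (y, t) := by
      have h1 := (hasDerivAt_iff_tendsto_slope.1 hd).mono_left
        (nhdsWithin_mono _ (fun t (ht : σ y < t) => ht.ne') : 𝓝[>] (σ y) ≤ _)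
      filter_upwards [h1.eventually_const_lt hH', self_mem_nhdsWithin] with t ht hts
      rw [slope_def_field, h0, sub_zero] at ht
      exact (div_pos_iff_of_pos_right (sub_pos.2 hts)).1 ht
    obtain ⟨t, ht, hts, htc⟩ := (hpos.and (Ioo_mem_nhdsGT hc)).exists
    have h1 : ∀ᶠ x in 𝓝 y, 0 < H (x, t) :=
      (continuousAt_const (y := (0 : ℝ))).eventually_lt
        (g := fun x => H (x, t)) (by fun_prop) ht
    filter_upwards [h1, hτ.eventually_lt_const (hlt.trans hts)] with x hx hxt
    by_contra hcx
    have := hneg x t ⟨hxt, htc.trans_le (not_lt.1 hcx)⟩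
    linarith

variable [NormedSpace ℝ Y]

/-- The derivative `-f⁻² Df` contains only the reciprocal itself and `Df`, so induction on the order
closes; `η` bounds the reciprocal. -/
theorem DerivBdd.inv {J : Set ℝ} {k : ℕ} {f : ℝ → Y → ℝ} (hf : DerivBdd J k f) {η : ℝ} (hη : 0 < η)
    (hle : ∀ s ∈ J, ∀ y, η ≤ f s y) : DerivBdd J k fun s y => (f s y)⁻¹ := by
  have hne : ∀ s ∈ J, ∀ y, f s y ≠ 0 := fun s hs y => (hη.trans_le (hle s hs y)).ne'
  have hc : ContinuousOn (fun p : ℝ × Y => (f p.1 p.2)⁻¹) (J ×ˢ univ) :=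
    hf.continuousOn.inv₀ fun p hp => hne _ hp.1 _
  have hb : UnifBdd J fun s y => (f s y)⁻¹ := ⟨η⁻¹, fun s hs y => by
    rw [norm_inv, Real.norm_of_nonneg (hη.le.trans (hle s hs y))]
    exact inv_anti₀ hη (hle s hs y)⟩
  induction k with
  | zero => exact hc
  | succ k ih =>
    have ihk := ih hf.of_succ
    have h1 := DerivBdd.bilin (ContinuousLinearMap.mul ℝ ℝ) ihk hb ihk hb
    have h1b := UnifBdd.bilin (ContinuousLinearMap.mul ℝ ℝ) hb hb
    have h2 := DerivBdd.bilin (ContinuousLinearMap.lsmul ℝ ℝ) h1 h1b hf.fderiv hf.unifBdd_fderiv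
    have h2b := UnifBdd.bilin (ContinuousLinearMap.lsmul ℝ ℝ (E := Y →L[ℝ] ℝ)) h1b
      hf.unifBdd_fderiv
    refine DerivBdd.succ_intro (v' := fun s y => -(((f s y)⁻¹ * (f s y)⁻¹) • _root_.fderiv ℝ (f s) y))
      hc (fun s hs y => ?_) ?_ h2.neg
    · have h3 := (hasDerivAt_inv (hne s hs y)).comp_hasFDerivAt y (hf.hasFDerivAt hs y)
      refine h3.congr_fderiv ?_
      rw [← neg_smul, pow_two, mul_inv]
    · obtain ⟨C, hC⟩ := h2b
      exact ⟨C, fun s hs y => by rw [norm_neg]; exact hC s hs y⟩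

/-- Regularity of a continuous solution of an implicit equation. -/
theorem contDiffAt_of_implicit [CompleteSpace Y] {k : ℕ} (hk : k ≠ 0) {H : Y × ℝ → ℝ}
    (hH : ContDiff ℝ k H) {σ : Y → ℝ} {y : Y} (hσ : ContinuousAt σ y) (h0 : ∀ y, H (y, σ y) = 0)
    (hne : fderiv ℝ H (y, σ y) (0, 1) ≠ 0) : ContDiffAt ℝ k σ y := by
  have hk' : (k : WithTop ℕ∞) ≠ 0 := by exact_mod_cast hk
  have hinv : (fderiv ℝ H (y, σ y) ∘L .inr ℝ Y ℝ).IsInvertible := by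
    refine ⟨ContinuousLinearEquiv.unitsEquivAut ℝ (Units.mk0 _ hne), ?_⟩
    ext
    simp
  have hc := hH.contDiffAt (x := (y, σ y))
  have h1 := hc.eventually_apply_eq_iff_implicitFunction hk' hinv
  have h2 : Tendsto (fun x => (x, σ x)) (𝓝 y) (𝓝 (y, σ y)) := continuousAt_id.prodMk hσ
  refine (hc.contDiffAt_implicitFunction hk' hinv).congr_of_eventuallyEq ?_
  filter_upwards [h2.eventually h1] with x hx
  exact (hx.1 (by rw [h0, h0])).symm

/-- Differentiating the equation gives `Dσ = -(∂ₜH)⁻¹ ∂_yH` along the graph. The right side has as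
many bounded derivatives as `σ`, within the limits of `DH`, so each pass gains one order. -/
theorem bddWithDerivs_of_implicit {k : ℕ} {H : Y × ℝ → ℝ} (hH : DerivBdd univ (k + 1) fun _ => H)
    {σ : Y → ℝ} (hσ : Differentiable ℝ σ) (h0 : ∀ y, H (y, σ y) = 0) {η : ℝ} (hη : 0 < η)
    (hle : ∀ y, η ≤ fderiv ℝ H (y, σ y) (0, 1)) (hb : ∃ C, ∀ y, ‖σ y‖ ≤ C) :
    BddWithDerivs (k + 1) σ := by
  obtain ⟨C, hC⟩ := hb
  let f : Y → ℝ := fun y => fderiv ℝ H (y, σ y) (0, 1)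
  let R : Y → Y →L[ℝ] ℝ := fun y => (fderiv ℝ H (y, σ y)).comp (.inl ℝ Y ℝ)
  have hd : ∀ y, HasFDerivAt σ (-((f y)⁻¹ • R y)) y := by
    intro y
    have h1 : HasFDerivAt (fun y => H (y, σ y))
        ((fderiv ℝ H (y, σ y)).comp ((ContinuousLinearMap.id ℝ Y).prod (fderiv ℝ σ y))) y :=
      (hH.hasFDerivAt (s := 0) trivial _).comp y ((hasFDerivAt_id y).prodMk (hσ y).hasFDerivAt)
    have h2 : HasFDerivAt (fun y => H (y, σ y)) (0 : Y →L[ℝ] ℝ) y := by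
      simp only [h0]
      exact hasFDerivAt_const _ _
    have h3 := h1.unique h2
    refine (hσ y).hasFDerivAt.congr_fderiv ?_
    ext v
    have h4 := DFunLike.congr_fun h3 v
    have e : (((ContinuousLinearMap.id ℝ Y).prod (fderiv ℝ σ y)) v : Y × ℝ) =
        (v, 0) + (fderiv ℝ σ y v) • ((0 : Y), (1 : ℝ)) := by simp
    rw [ContinuousLinearMap.comp_apply, e, map_add, map_smul] at h4
    have hf : f y ≠ 0 := (hη.trans_le (hle y)).ne'
    have h5 : R y v + fderiv ℝ σ y v * f y = 0 := h4
    change fderiv ℝ σ y v = -((f y)⁻¹ * R y v)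
    field_simp
    linarith
  have hcσ : ContinuousOn (fun p : ℝ × Y => σ p.2) (univ ×ˢ univ) :=
    (hσ.continuous.comp continuous_snd).continuousOn
  have hDb : UnifBdd univ fun (_ : ℝ) y => fderiv ℝ H (y, σ y) := by
    obtain ⟨B, hB⟩ := hH.unifBdd_fderiv
    exact ⟨B, fun s _ y => hB 0 trivial _⟩
  let L : (Y × ℝ →L[ℝ] ℝ) →L[ℝ] (Y →L[ℝ] ℝ) :=
    (ContinuousLinearMap.compL ℝ Y (Y × ℝ) ℝ).flip (.inl ℝ Y ℝ)
  have hRb : UnifBdd univ fun (_ : ℝ) => R := UnifBdd.clm_comp L hDb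
  have hfb : UnifBdd univ fun (_ : ℝ) y => (f y)⁻¹ := ⟨η⁻¹, fun s _ y => by
    rw [norm_inv, Real.norm_of_nonneg (hη.le.trans (hle y))]
    exact inv_anti₀ hη (hle y)⟩
  have hprodb : UnifBdd univ fun (_ : ℝ) y => -((f y)⁻¹ • R y) := by
    obtain ⟨B, hB⟩ := UnifBdd.bilin (ContinuousLinearMap.lsmul ℝ ℝ (E := Y →L[ℝ] ℝ)) hfb hRb
    exact ⟨B, fun s hs y => by rw [norm_neg]; exact hB s hs y⟩
  have main : ∀ j ≤ k + 1, DerivBdd univ j fun _ => σ := by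
    intro j
    induction j with
    | zero => exact fun _ => hcσ
    | succ j ih =>
      intro hj
      have hD : DerivBdd univ j fun (_ : ℝ) y => fderiv ℝ H (y, σ y) :=
        (hH.fderiv.of_le (by omega)).comp ((DerivBdd.clm (.id ℝ Y)).prodMk (ih (by omega)))
      have hf : DerivBdd univ j fun (_ : ℝ) => f :=
        hD.clm_comp (ContinuousLinearMap.apply ℝ ℝ ((0 : Y), (1 : ℝ)))
      have hR : DerivBdd univ j fun (_ : ℝ) => R := hD.clm_comp L
      have hfi := hf.inv hη fun _ _ y => hle y
      exact DerivBdd.succ_intro hcσ (fun _ _ y => hd y) hprodb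
        (DerivBdd.bilin (ContinuousLinearMap.lsmul ℝ ℝ) hfi hfb hR hRb).neg
  exact (main (k + 1) le_rfl).bddWithDerivs ⟨C, fun _ _ y => hC y⟩

end Implicit

theorem derivBdd_flow_comp {E Y : Type} [NormedAddCommGroup E] [NormedSpace ℝ E]
    [NormedAddCommGroup Y] [NormedSpace ℝ Y] {r : ℕ} {Ξ : ℝ × (E × Y) → E} (hΞ : BddWithDerivs r Ξ)
    {τ : Y → ℝ}
    {p : Y → E} (hτ : BddWithDerivs r τ) (hp : BddWithDerivs r p) :
    DerivBdd univ r fun (_ : ℝ) (z : Y × ℝ) => p z.1 + Ξ (z.2 - τ z.1, p z.1, z.1) := by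
  have h1 : DerivBdd univ r fun (_ : ℝ) (z : Y × ℝ) => z.1 :=
    .clm (ContinuousLinearMap.fst ℝ Y ℝ)
  have h2 : DerivBdd univ r fun (_ : ℝ) (z : Y × ℝ) => z.2 :=
    .clm (ContinuousLinearMap.snd ℝ Y ℝ)
  have hp1 := hp.derivBdd.comp h1
  exact hp1.add (hΞ.derivBdd.comp ((h2.sub (hτ.derivBdd.comp h1)).prodMk (hp1.prodMk h1)))

/-! ### One transversal crossing. -/

section Crossing

variable {E Y : Type} [NormedAddCommGroup E] [NormedSpace ℝ E] [CompleteSpace E]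
  [NormedAddCommGroup Y] [NormedSpace ℝ Y]

/-- If a solution family starts at time `τ` at the point `p` and crosses a hypersurface `q = 0`
transversally for the first time at time `σ`, then the crossing time and the crossing point are as
smooth, with bounds, as the data. -/
theorem bddWithDerivs_crossing [CompleteSpace Y] {r : ℕ} {g : E × Y → E}
    (hg : BddWithDerivs (r + 1) g) {q : E × Y → ℝ} (hq : DerivBdd univ (r + 1) fun _ => q)
    {τ σ : Y → ℝ} {p : Y → E} {u : ℝ → Y → E} (hτ : BddWithDerivs (r + 1) τ)
    (hp : BddWithDerivs (r + 1) p) (hlt : ∀ y, τ y < σ y) (hσ : ∃ C, ∀ y, ‖σ y‖ ≤ C)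
    (hu0 : ∀ y, u (τ y) y = p y) (hc : ∀ y, ContinuousOn (fun t => u t y) (Icc (τ y) (σ y)))
    (hu : ∀ y, ∀ t ∈ Ioo (τ y) (σ y), HasDerivAt (fun t => u t y) (g (u t y, y)) t)
    (hneg : ∀ y, ∀ t ∈ Ioo (τ y) (σ y), q (u t y, y) < 0) (h0 : ∀ y, q (u (σ y) y, y) = 0)
    {η : ℝ} (hη : 0 < η)
    (htr : ∀ y, η ≤ fderiv ℝ (fun x => q (x, y)) (u (σ y) y) (g (u (σ y) y, y)))
    {O : Set (E × Y)} (hO : IsOpen O) (hpO : ∀ y, (p y, y) ∈ O) (hσO : ∀ y, (u (σ y) y, y) ∉ O) :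
    BddWithDerivs (r + 1) σ ∧ BddWithDerivs (r + 1) fun y => u (σ y) y := by
  obtain ⟨C, hC⟩ := hσ
  obtain ⟨D, hD⟩ := hτ.unifBdd (J := univ)
  have hCD : ∀ y, σ y - τ y < C + D + 1 := fun y => by
    have h1 := (le_abs_self _).trans (hC y)
    have h2 := (neg_abs_le _).trans' (neg_le_neg (hD 0 trivial y))
    linarith
  -- The flow must be defined over every elapsed time `σ y - τ y`. The extra `1` keeps these times
  -- interior, so that two-sided time derivatives exist at `σ y` itself.
  have hT0 : 0 < C + D + 1 := (sub_pos.2 (hlt 0)).trans (hCD 0)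
  obtain ⟨Ξ, hΞ, hflow⟩ := exists_flow hg hT0
  obtain ⟨K, hK0, hK⟩ := (hg.derivBdd (J := univ)).exists_lipschitz
  have hglip : ∀ y x x', ‖g (x, y) - g (x', y)‖ ≤ K * ‖x - x'‖ := fun y x x' => by
    simpa [Prod.norm_def] using hK 0 trivial (x', y) (x, y)
  let Φ : Y × ℝ → E := fun z => p z.1 + Ξ (z.2 - τ z.1, p z.1, z.1)
  have hΦ : DerivBdd univ (r + 1) fun _ => Φ := derivBdd_flow_comp hΞ hτ hp
  have hΦd : ∀ y, ∀ t ∈ Icc (τ y) (σ y), HasDerivAt (fun t => Φ (y, t)) (g (Φ (y, t), y)) t := by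
    intro y t ht
    have hm : t - τ y ∈ Ioo (-(C + D + 1)) (C + D + 1) :=
      ⟨by linarith [ht.1], by linarith [ht.2, hCD y]⟩
    have h1 := ((hflow (p y) y).2 (t - τ y) (Ioo_subset_Icc_self hm)).hasDerivAt
      (Icc_mem_nhds hm.1 hm.2)
    have h2 := h1.scomp t ((hasDerivAt_id t).sub_const (τ y))
    rw [one_smul] at h2
    exact h2
  have hΦu : ∀ y, ∀ t ∈ Icc (τ y) (σ y), u t y = Φ (y, t) := by
    intro y t ht
    refine eq_of_solution_right (f := fun x => g (x, y)) hK0 (hglip y)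
      (hasDerivWithinAt_Icc_of_Ioo (f := fun x => g (x, y)) (hlt y)
        (hg.1.continuous.comp (Continuous.prodMk_left y)) (hc y) (hu y))
      (fun s hs => (hΦd y s hs).hasDerivWithinAt) ?_ ht
    simp [Φ, (hflow (p y) y).1, hu0 y]
  let H : Y × ℝ → ℝ := fun z => q (Φ z, z.1)
  have hH : DerivBdd univ (r + 1) fun _ => H :=
    hq.comp (hΦ.prodMk (.clm (ContinuousLinearMap.fst ℝ Y ℝ)))
  have hσm : ∀ y, σ y ∈ Icc (τ y) (σ y) := fun y => ⟨(hlt y).le, le_rfl⟩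
  have hH0 : ∀ y, H (y, σ y) = 0 := fun y => by
    have := h0 y
    rwa [hΦu y _ (hσm y)] at this
  have hHneg : ∀ y, ∀ t ∈ Ioo (τ y) (σ y), H (y, t) < 0 := fun y t ht => by
    have := hneg y t ht
    rwa [hΦu y t (Ioo_subset_Icc_self ht)] at this
  have hHd : ∀ y, HasDerivAt (fun t => H (y, t)) (fderiv ℝ H (y, σ y) (0, 1)) (σ y) := fun y =>
    (hH.hasFDerivAt (s := 0) trivial (y, σ y)).comp_hasDerivAt (σ y)
      ((hasDerivAt_const (σ y) y).prodMk (hasDerivAt_id (σ y)))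
  have hHη : ∀ y, η ≤ fderiv ℝ H (y, σ y) (0, 1) := by
    intro y
    have h1 : DifferentiableAt ℝ (fun x => q (x, y)) (Φ (y, σ y)) :=
      ((hq.hasFDerivAt (s := 0) trivial _).comp (Φ (y, σ y))
        (hasFDerivAt_prodMk_left _ _)).differentiableAt
    have h2 := h1.hasFDerivAt.comp_hasDerivAt (σ y) (hΦd y _ (hσm y))
    rw [(hHd y).unique h2, ← hΦu y _ (hσm y)]
    exact htr y
  have hcΦ : Continuous Φ := (hΦ.contDiff 0 trivial).continuous
  have hcσ : ∀ y, ContinuousAt σ y := by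
    intro y
    -- The starting points lie in the open set `O` and the crossing points outside it. Near `(y, τ
    -- y)` the trajectory is still in `O`, which separates `σ` at nearby parameters from `τ y`.
    have h1 : ∀ᶠ z in 𝓝 (y, τ y), (Φ z, z.1) ∈ O := by
      refine (hcΦ.prodMk continuous_fst).continuousAt.eventually_mem (hO.mem_nhds ?_)
      simpa [Φ, (hflow (p y) y).1] using hpO y
    rw [nhds_prod_eq] at h1
    obtain ⟨P, hP, Q, hQ, hPQ⟩ := eventually_prod_iff.1 h1
    obtain ⟨κ, hκ, hQκ⟩ := Metric.eventually_nhds_iff.1 hQ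
    refine continuousAt_firstZero (hH.contDiff 0 trivial).continuous
      hτ.1.continuous.continuousAt hH0 hHneg (hη.trans_le (hHη y)) (hHd y) (hlt y) hκ ?_
    have hτy := hτ.1.continuous.continuousAt (x := y)
    filter_upwards [hP, hτy.eventually_const_lt (sub_lt_self (τ y) hκ)] with x hx hx2
    by_contra hcon
    refine hσO x ?_
    rw [hΦu x _ (hσm x)]
    refine hPQ hx (hQκ ?_)
    rw [Real.dist_eq, abs_lt]
    exact ⟨by linarith [hlt x], by linarith⟩
  have hdσ : Differentiable ℝ σ := fun y =>
    (contDiffAt_of_implicit (Nat.succ_ne_zero r) (hH.contDiff 0 trivial) (hcσ y) hH0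
      (hη.trans_le (hHη y)).ne').differentiableAt (by simp)
  have hσs : BddWithDerivs (r + 1) σ :=
    bddWithDerivs_of_implicit hH hdσ hH0 hη hHη ⟨C, hC⟩
  refine ⟨hσs, ?_⟩
  have e : (fun y => u (σ y) y) = fun y => Φ (y, σ y) := funext fun y => hΦu y _ (hσm y)
  rw [e]
  refine DerivBdd.bddWithDerivs
    (hΦ.comp ((DerivBdd.clm (ContinuousLinearMap.id ℝ Y)).prodMk hσs.derivBdd)) ?_
  obtain ⟨Cp, hCp⟩ := hp.unifBdd (J := univ)
  obtain ⟨CΞ, hCΞ⟩ := hΞ.unifBdd (J := univ)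
  exact ⟨Cp + CΞ, fun _ _ y => norm_add_le_of_le (hCp 0 trivial _) (hCΞ 0 trivial _)⟩

end Crossing

theorem DerivBdd.time {W : Type} [NormedAddCommGroup W] [NormedSpace ℝ W] {J : Set ℝ} {k : ℕ} :
    DerivBdd J k fun s (_ : W) => s := by
  have hc : ContinuousOn (fun p : ℝ × W => p.1) (J ×ˢ univ) := continuousOn_fst
  cases k with
  | zero => exact hc
  | succ k =>
    exact .succ_intro hc (v' := fun _ _ => 0) (fun s _ w => hasFDerivAt_const s w) ⟨0, by simp⟩
      (.const 0)

theorem norm_inl_le_one {E Y : Type} [NormedAddCommGroup E] [NormedSpace ℝ E]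
    [NormedAddCommGroup Y] [NormedSpace ℝ Y] : ‖ContinuousLinearMap.inl ℝ E Y‖ ≤ 1 :=
  ContinuousLinearMap.opNorm_le_bound _ zero_le_one fun x => by simp [Prod.norm_def]

/-! ### The tail on bounded time intervals. -/

section FiniteTime

variable {E Y : Type} [NormedAddCommGroup E] [NormedSpace ℝ E] [CompleteSpace E]
  [NormedAddCommGroup Y] [NormedSpace ℝ Y]

/-- Smoothness with bounds, on bounded time intervals, of a family of solutions which passes at time
`τ y` through the point `p y`. -/
theorem derivBdd_solution_of_initial {r : ℕ} {g : E × Y → E} (hg : BddWithDerivs (r + 1) g)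
    {τ : Y → ℝ} {p : Y → E} (hτ : BddWithDerivs (r + 1) τ) (hp : BddWithDerivs (r + 1) p)
    (hτ0 : ∀ y, 0 ≤ τ y) {v : ℝ → Y → E} (hv0 : ∀ y, v (τ y) y = p y)
    (hv : ∀ y, ∀ s ∈ Ici (0 : ℝ), HasDerivWithinAt (fun t => v t y) (g (v s y, y)) (Ici 0) s)
    (S : ℝ) : DerivBdd (Icc 0 S) (r + 1) v ∧ UnifBdd (Icc 0 S) v := by
  obtain ⟨D, hD⟩ := hτ.unifBdd (J := univ)
  have hτD : ∀ y, τ y ≤ D := fun y => (le_abs_self _).trans (hD 0 trivial y)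
  have hD0 : 0 ≤ D := (hτ0 0).trans (hτD 0)
  -- Enlarged so that `[0, S']` contains every initial time `τ y`; uniqueness is then applied from
  -- `τ y` in both directions.
  set S' := max S D
  have hT0 : 0 < S' + D + 1 := by
    have : D ≤ S' := le_max_right _ _
    linarith
  obtain ⟨Ξ, hΞ, hflow⟩ := exists_flow hg hT0
  obtain ⟨K, hK0, hK⟩ := (hg.derivBdd (J := univ)).exists_lipschitz
  have hglip : ∀ y x x', ‖g (x, y) - g (x', y)‖ ≤ K * ‖x - x'‖ := fun y x x' => by
    simpa [Prod.norm_def] using hK 0 trivial (x', y) (x, y)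
  have key : ∀ y, ∀ s ∈ Icc 0 S', v s y = p y + Ξ (s - τ y, p y, y) := by
    intro y s hs
    refine eq_of_solution (f := fun x => g (x, y)) (a := 0) (b := S')
      (x := fun t => v t y) (y := fun t => p y + Ξ (t - τ y, p y, y)) hK0 (hglip y)
      (fun t ht => (hv y t ht.1).mono Icc_subset_Ici_self) (fun t ht => ?_) (c := τ y)
      ⟨hτ0 y, (hτD y).trans (le_max_right _ _)⟩ ?_ hs
    · have hm : t - τ y ∈ Icc (-(S' + D + 1)) (S' + D + 1) := by
        have := hτ0 y
        have := hτD y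
        exact ⟨by linarith [ht.1, le_max_right S D], by linarith [ht.2]⟩
      have h1 : HasDerivWithinAt (fun t => t - τ y) 1 (Icc 0 S') t :=
        ((hasDerivAt_id t).sub_const (τ y)).hasDerivWithinAt
      have h2 := ((hflow (p y) y).2 _ hm).scomp t h1 (fun s hs => by
        have := hτ0 y
        have := hτD y
        exact ⟨by linarith [hs.1, le_max_right S D], by linarith [hs.2]⟩)
      rw [one_smul] at h2
      exact h2
    · simp [(hflow (p y) y).1, hv0]
  have hsub : Icc 0 S ⊆ Icc 0 S' := Icc_subset_Icc_right (le_max_left _ _)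
  have hid : DerivBdd (Icc 0 S) (r + 1) fun s (y : Y) => (y, s) :=
    (DerivBdd.clm (ContinuousLinearMap.id ℝ Y)).prodMk .time
  refine ⟨((derivBdd_flow_comp hΞ hτ hp).comp hid).congr fun s hs =>
    funext fun y => key y s (hsub hs), ?_⟩
  obtain ⟨Cp, hCp⟩ := hp.unifBdd (J := univ)
  obtain ⟨CΞ, hCΞ⟩ := hΞ.unifBdd (J := univ)
  refine ⟨Cp + CΞ, fun s hs y => ?_⟩
  rw [key y s (hsub hs)]
  exact norm_add_le_of_le (hCp 0 trivial _) (hCΞ 0 trivial _)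

end FiniteTime

/-! ### The tail near the hyperbolic equilibria. -/

section Tail

variable {n : ℕ} {Y : Type} [NormedAddCommGroup Y] [NormedSpace ℝ Y]

local notation "E" => EuclideanSpace ℝ (Fin n)

/-- Solutions converging uniformly to a family of uniformly hyperbolic equilibria depend smoothly
on the parameters, with bounds uniform in time. -/
theorem contDiffAt_and_bound_of_tendsto_hyperbolic {r : ℕ} {g : E × Y → E}
    (hg : BddWithDerivs (r + 2) g) {τ : Y → ℝ} {p : Y → E} (hτ : BddWithDerivs (r + 2) τ)
    (hp : BddWithDerivs (r + 2) p) (hτ0 : ∀ y, 0 ≤ τ y) {v : ℝ → Y → E}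
    (hv0 : ∀ y, v (τ y) y = p y)
    (hv : ∀ y, ∀ s ∈ Ici (0 : ℝ), HasDerivWithinAt (fun t => v t y) (g (v s y, y)) (Ici 0) s)
    {w : Y → E} (hw : Continuous w) (hwb : ∃ C, ∀ y, ‖w y‖ ≤ C)
    (hlim : ∀ ε > 0, ∃ T, ∀ s ≥ T, ∀ y, ‖v s y - w y‖ < ε) {δ : ℝ} (hδ : 0 < δ)
    (hspec : ∀ y, ∀ z ∈ complexEigenvalues (fderiv ℝ (fun x => g (x, y)) (w y)), δ < |z.re|) :
    (∀ y s, τ y ≤ s → ContDiffAt ℝ (r + 2 : ℕ) (v s) y) ∧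
      ∀ k ≤ r + 2, ∃ C, ∀ y s, τ y ≤ s → ‖iteratedFDeriv ℝ k (v s) y‖ ≤ C := by
  have hfin := derivBdd_solution_of_initial hg hτ hp hτ0 hv0 hv
  have hgd : DerivBdd univ (r + 2) fun _ => g := hg.derivBdd
  obtain ⟨M, hM0, hM⟩ := hgd.exists_lipschitz
  obtain ⟨c, hc0, hc⟩ := hgd.fderiv.exists_lipschitz
  obtain ⟨B, hB⟩ := hgd.unifBdd_fderiv
  have hB0 : 0 ≤ B := (norm_nonneg _).trans (hB 0 trivial 0)
  let A : E → Y → E →L[ℝ] E := fun x y => (fderiv ℝ g (x, y)).comp (.inl ℝ E Y)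
  have hAd : ∀ x y, HasFDerivAt (fun x => g (x, y)) (A x y) x := fun x y =>
    (hgd.hasFDerivAt (s := 0) trivial (x, y)).comp x (hasFDerivAt_prodMk_left _ _)
  have hAB : ∀ x y, ‖A x y‖ ≤ B := fun x y =>
    (ContinuousLinearMap.opNorm_comp_le _ _).trans
      ((mul_le_mul (hB 0 trivial _) norm_inl_le_one (norm_nonneg _) hB0).trans_eq (mul_one _))
  have hAc : ∀ x x' y, ‖A x' y - A x y‖ ≤ c * ‖x' - x‖ := fun x x' y => by
    have h1 := hc 0 trivial (x, y) (x', y)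
    have e : ‖((x', y) : E × Y) - (x, y)‖ = ‖x' - x‖ := by simp [Prod.norm_def]
    rw [e] at h1
    rw [← ContinuousLinearMap.sub_comp]
    exact (ContinuousLinearMap.opNorm_comp_le _ _).trans
      ((mul_le_mul h1 norm_inl_le_one (norm_nonneg _) (by positivity)).trans_eq (mul_one _))
  obtain ⟨κ, ε, hε, hest⟩ := exists_bddSolutionEstimate_Ici n hB0 hδ
  -- Two smallness conditions: `c * ρ ≤ ε` keeps the linearization along `v` within the admissible
  -- perturbation of that at `w`, and `κ * c * 3ρ ≤ 1/2` absorbs the nonlinear remainder in the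
  -- difference equation.
  set ρ := min (ε / (c + 1)) (1 / (6 * ((|κ| + 1) * (c + 1))))
  have hρ : 0 < ρ := by positivity
  have hcρ : c * ρ ≤ ε := by
    have h1 : ρ ≤ ε / (c + 1) := min_le_left _ _
    rw [le_div_iff₀ (by positivity)] at h1
    nlinarith
  have hκρ : κ * (c * (3 * ρ)) ≤ 1 / 2 := by
    have h1 : ρ ≤ 1 / (6 * ((|κ| + 1) * (c + 1))) := min_le_right _ _
    rw [le_div_iff₀ (by positivity)] at h1
    have h2 : κ * (c * ρ) ≤ (|κ| + 1) * ((c + 1) * ρ) := by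
      apply mul_le_mul <;> first | positivity | nlinarith [le_abs_self κ, abs_nonneg κ]
    nlinarith
  obtain ⟨T, hT⟩ := hlim ρ hρ
  set T₀ := max T 0
  have hT₀ : 0 ≤ T₀ := le_max_right _ _
  have hclose : ∀ s ∈ Ici T₀, ∀ y, ‖v s y - w y‖ < ρ := fun s hs y =>
    hT s ((le_max_left _ _).trans hs) y
  have hE : BddSolutionEstimate (Ici T₀) T₀ κ fun s y => A (v s y) y :=
    hest (fun y => A (w y) y) _ T₀ (fun y => hAB _ _)
      (fun y z hz => hspec y z (by rwa [(hAd (w y) y).fderiv]))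
      (fun s hs y => (hAc _ _ _).trans ((mul_le_mul_of_nonneg_left (hclose s hs y).le hc0).trans
        hcρ))
  have hvT : ∀ y, ∀ s ∈ Ici T₀,
      HasDerivWithinAt (fun t => v t y) (g (v s y, y)) (Ici T₀) s := fun y s hs =>
    (hv y s (hT₀.trans hs)).mono (Ici_subset_Ici.2 hT₀)
  have hinit : DerivBdd {T₀} (r + 2) v :=
    (hfin T₀).1.mono (singleton_subset_iff.2 ⟨hT₀, le_rfl⟩)
  obtain ⟨L, hL0, hL⟩ := hinit.exists_lipschitz
  have hlip : ∃ C, ∀ y, ∀ᶠ y' in 𝓝 y, ∀ s ∈ Ici T₀, ‖v s y' - v s y‖ ≤ C * ‖y' - y‖ := by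
    -- The neighbourhood of `y` below depends on `y`, through the continuity of `w`, but this
    -- constant does not. That suffices, since only a bound on the derivative at each point is
    -- extracted.
    refine ⟨2 * (κ * (L + M)), fun y => ?_⟩
    have hwy : ∀ᶠ y' in 𝓝 y, ‖w y' - w y‖ < ρ := by
      have := Metric.tendsto_nhds.1 (hw.tendsto y) ρ hρ
      simpa [dist_eq_norm] using this
    filter_upwards [hwy] with y' hy' s hs
    have hd3 : ∀ s ∈ Ici T₀, ‖v s y' - v s y‖ ≤ 3 * ρ := fun s hs => by
      have e : v s y' - v s y = (v s y' - w y') + (w y' - w y) - (v s y - w y) := by abel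
      rw [e]
      refine (norm_sub_le_of_le (norm_add_le_of_le (hclose s hs y').le hy'.le)
        (hclose s hs y).le).trans (le_of_eq (by ring))
    rw [mul_assoc]
    refine le_two_mul_of_absorb (f := fun s => ‖v s y' - v s y‖) ⟨_, hd3⟩ (fun D hD s hs => ?_) s hs
    have hD0 : 0 ≤ D := (norm_nonneg _).trans (hD s hs)
    -- The difference solves the linearized equation with two forcing terms: the change of
    -- parameter, at most `M * ‖y' - y‖`, and the Taylor remainder, at most `c * 3ρ * D` for any
    -- bound `D` of the difference. The latter is absorbed.
    have h1 := hE.est y (fun s => v s y' - v s y)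
      (fun s => g (v s y', y') - g (v s y, y) - A (v s y) y (v s y' - v s y))
      (M * ‖y' - y‖ + c * (3 * ρ) * D) ⟨_, hD⟩ (fun s hs => by
        refine ((hvT y' s hs).sub (hvT y s hs)).congr_deriv ?_
        abel) (fun s hs => by
        have e : g (v s y', y') - g (v s y, y) - A (v s y) y (v s y' - v s y) =
          (g (v s y', y') - g (v s y', y)) +
          (g (v s y', y) - g (v s y, y) - A (v s y) y (v s y' - v s y)) := by abel
        rw [e]
        refine norm_add_le_of_le ?_ ?_
        · simpa [Prod.norm_def] using hM 0 trivial (v s y', y) (v s y', y')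
        · refine ((convex_closedBall (v s y) (3 * ρ)).norm_image_sub_le_of_norm_hasFDerivWithin_le'
            (fun x _ => (hAd x y).hasFDerivWithinAt) (fun x hx => ?_)
            (Metric.mem_closedBall_self (by positivity))
            (by simpa [dist_eq_norm] using hd3 s hs)).trans
            (mul_le_mul_of_nonneg_left (hD s hs) (by positivity))
          refine (hAc _ _ _).trans (mul_le_mul_of_nonneg_left ?_ hc0)
          simpa [dist_eq_norm] using hx) s hs
    refine h1.trans ?_
    have h2 := hL T₀ rfl y y'
    have h3 : κ * (‖v T₀ y' - v T₀ y‖ + (M * ‖y' - y‖ + c * (3 * ρ) * D)) ≤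
        κ * (L * ‖y' - y‖ + (M * ‖y' - y‖ + c * (3 * ρ) * D)) :=
      mul_le_mul_of_nonneg_left (by linarith) hE.nonneg
    have h4 : κ * (c * (3 * ρ)) * D ≤ 1 / 2 * D := mul_le_mul_of_nonneg_right hκρ hD0
    linarith
  have hinf : DerivBdd (Ici T₀) (r + 2) v :=
    derivBdd_of_solution (.Ici T₀) hgd hvT hlip hE hinit
  have hinfb : UnifBdd (Ici T₀) v := by
    obtain ⟨C, hC⟩ := hwb
    refine ⟨ρ + C, fun s hs y => ?_⟩
    have := norm_add_le_of_le (hclose s hs y).le (hC y)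
    rwa [sub_add_cancel] at this
  constructor
  · intro y s hs
    rcases le_total s T₀ with h | h
    · exact ((hfin T₀).1.contDiff s ⟨(hτ0 y).trans hs, h⟩).contDiffAt
    · exact (hinf.contDiff s h).contDiffAt
  · intro k hk
    obtain ⟨C₁, hC₁⟩ := (hfin T₀).1.exists_bound_of_unifBdd (hfin T₀).2 hk
    obtain ⟨C₂, hC₂⟩ := hinf.exists_bound_of_unifBdd hinfb hk
    refine ⟨max C₁ C₂, fun y s hs => ?_⟩
    rcases le_total s T₀ with h | h
    · exact (hC₁ s ⟨(hτ0 y).trans hs, h⟩ y).trans (le_max_left _ _)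
    · exact (hC₂ s h y).trans (le_max_right _ _)

end Tail

theorem BddWithDerivs.neg {W V : Type} [NormedAddCommGroup W] [NormedSpace ℝ W]
    [NormedAddCommGroup V] [NormedSpace ℝ V] {k : ℕ} {g : W → V} (hg : BddWithDerivs k g) :
    BddWithDerivs k fun w => -g w := by
  refine hg.derivBdd.neg.bddWithDerivs ?_
  obtain ⟨C, hC⟩ := hg.unifBdd (J := univ)
  exact ⟨C, fun s hs w => (norm_neg _).trans_le (hC s hs w)⟩

/-! ### Finitely many crossings followed by convergence. -/

section Chain

variable {n : ℕ} {Y : Type} [NormedAddCommGroup Y] [NormedSpace ℝ Y] [CompleteSpace Y]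

/-- A family of solutions which passes successively and transversally through finitely many
hypersurfaces `q i = 0` and then converges to a hyperbolic equilibrium. -/
theorem contDiffAt_and_bound_of_crossings {r L : ℕ}
    {g : ℕ → EuclideanSpace ℝ (Fin n) × Y → EuclideanSpace ℝ (Fin n)}
    (hg : ∀ i ≤ L, BddWithDerivs (r + 2) (g i))
    {q : ℕ → EuclideanSpace ℝ (Fin n) × Y → ℝ}
    (hq : ∀ i < L, DerivBdd univ (r + 2) fun _ => q i)
    {τ : ℕ → Y → ℝ} {u : ℝ → Y → EuclideanSpace ℝ (Fin n)}
    (hu0 : BddWithDerivs (r + 2) (u 0)) (hτ0 : ∀ y, τ 0 y = 0)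
    (hlt : ∀ i < L, ∀ y, τ i y < τ (i + 1) y) (hτL : ∃ T, ∀ y, τ L y ≤ T)
    (hc : ∀ y, ContinuousOn (fun t => u t y) (Ici 0))
    (hu : ∀ i < L, ∀ y, ∀ t ∈ Ioo (τ i y) (τ (i + 1) y),
      HasDerivAt (fun t => u t y) (g i (u t y, y)) t)
    (hneg : ∀ i < L, ∀ y, ∀ t ∈ Ioo (τ i y) (τ (i + 1) y), q i (u t y, y) < 0)
    (h0 : ∀ i < L, ∀ y, q i (u (τ (i + 1) y) y, y) = 0)
    {η : ℝ} (hη : 0 < η)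
    (htr : ∀ i < L, ∀ y, η ≤ fderiv ℝ (fun x => q i (x, y)) (u (τ (i + 1) y) y)
      (g i (u (τ (i + 1) y) y, y)))
    {O : Set (EuclideanSpace ℝ (Fin n) × Y)} (hO : IsOpen O) (hO0 : ∀ y, (u 0 y, y) ∈ O)
    (hO1 : 0 < L → ∀ y, (u (τ 1 y) y, y) ∉ O)
    (hq0 : ∀ i < L, 0 < i → ∀ y, q i (u (τ i y) y, y) < 0)
    (huL : ∀ y s, τ L y < s → HasDerivAt (fun t => u t y) (g L (u s y, y)) s)
    {v : ℝ → Y → EuclideanSpace ℝ (Fin n)} (hv0 : ∀ y, v (τ L y) y = u (τ L y) y)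
    (hv : ∀ y, ∀ s ∈ Ici (0 : ℝ), HasDerivWithinAt (fun t => v t y) (g L (v s y, y)) (Ici 0) s)
    {w : Y → EuclideanSpace ℝ (Fin n)} (hw : Continuous w) (hwb : ∃ C, ∀ y, ‖w y‖ ≤ C)
    (hlim : ∀ ε > 0, ∃ T, ∀ s ≥ T, ∀ y, ‖u s y - w y‖ < ε)
    {δ : ℝ} (hδ : 0 < δ)
    (hspec : ∀ y, ∀ z ∈ complexEigenvalues (fderiv ℝ (fun x => g L (x, y)) (w y)), δ < |z.re|) :
    (∀ y s, τ L y ≤ s → ContDiffAt ℝ (r + 2 : ℕ) (v s) y) ∧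
      ∀ k ≤ r + 2, ∃ C, ∀ y s, τ L y ≤ s → ‖iteratedFDeriv ℝ k (v s) y‖ ≤ C := by
  have hnonneg : ∀ i ≤ L, ∀ y, 0 ≤ τ i y := by
    intro i
    induction i with
    | zero => exact fun _ y => (hτ0 y).ge
    | succ i ih => exact fun hi y => (ih (by omega) y).trans (hlt i hi y).le
  obtain ⟨T, hT⟩ := hτL
  have hle : ∀ j i, i + j = L → ∀ y, τ i y ≤ T := by
    intro j
    induction j with
    | zero => rintro i rfl; exact hT
    | succ j ih => exact fun i hi y => (hlt i (by omega) y).le.trans (ih (i + 1) (by omega) y)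
  have key : ∀ i ≤ L, BddWithDerivs (r + 2) (τ i) ∧ BddWithDerivs (r + 2) fun y => u (τ i y) y := by
    intro i
    induction i with
    | zero =>
      intro _
      rw [show τ 0 = fun _ => 0 from funext hτ0]
      exact ⟨(DerivBdd.const 0).bddWithDerivs ⟨0, by simp⟩, hu0⟩
    | succ i ih =>
      intro hi
      obtain ⟨h1, h2⟩ := ih (by omega)
      have hqc : Continuous (q i) := (hq i hi).contDiff (s := 0) trivial |>.continuous
      -- After the first step the solution starts on the previous hypersurface, strictly below the
      -- next, so the sublevel set separates start from crossing. Initially this role falls to the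
      -- given `O`.
      refine bddWithDerivs_crossing (O := if i = 0 then O else {z | q i z < 0}) (hg i (by omega))
        (hq i hi) h1 h2 (hlt i hi) ⟨T, fun y => ?_⟩ (fun _ => rfl) (fun y => ?_) (hu i hi)
        (hneg i hi)
        (h0 i hi) hη (htr i hi) ?_ (fun y => ?_) fun y => ?_
      · rw [Real.norm_of_nonneg (hnonneg _ hi y)]
        exact hle (L - (i + 1)) _ (by omega) y
      · exact (hc y).mono fun t ht => (hnonneg i (by omega) y).trans ht.1
      · split_ifs
        exacts [hO, isOpen_lt hqc continuous_const]
      · split_ifs with hi0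
        · subst hi0
          simpa only [hτ0] using hO0 y
        · exact hq0 i hi (Nat.pos_of_ne_zero hi0) y
      · split_ifs with hi0
        · subst hi0
          exact hO1 hi y
        · exact (h0 i hi y).not_lt
  obtain ⟨hτb, hpb⟩ := key L le_rfl
  have hgL := hg L le_rfl
  obtain ⟨K, hK0, hK⟩ := (hgL.derivBdd (J := univ)).exists_lipschitz
  have hvu : ∀ y s, τ L y ≤ s → v s y = u s y := by
    intro y s hs
    rcases hs.eq_or_lt with rfl | hs'
    · exact hv0 y
    have hsub : Icc (τ L y) s ⊆ Ici 0 := fun t ht => (hnonneg L le_rfl y).trans ht.1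
    refine eq_of_solution_right (f := fun x => g L (x, y)) hK0 (fun x x' => ?_)
      (fun t ht => (hv y t (hsub ht)).mono hsub)
      (hasDerivWithinAt_Icc_of_Ioo (f := fun x => g L (x, y)) hs'
        (hgL.1.continuous.comp (Continuous.prodMk_left y)) ((hc y).mono hsub)
        fun t ht => huL y t ht.1) (hv0 y) ⟨hs, le_rfl⟩
    simpa [Prod.norm_def] using hK 0 trivial (x', y) (x, y)
  refine contDiffAt_and_bound_of_tendsto_hyperbolic hgL hτb hpb (hnonneg L le_rfl) hv0 hv hw hwb
    (fun ε hε => ?_) hδ hspec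
  obtain ⟨T', hT'⟩ := hlim ε hε
  refine ⟨max T T', fun s hs y => ?_⟩
  rw [hvu y s ((hT y).trans ((le_max_left _ _).trans hs))]
  exact hT' s ((le_max_right _ _).trans hs) y

end Chain

theorem HasDerivAt.reflect {V : Type} [NormedAddCommGroup V] [NormedSpace ℝ V] {x : ℝ → V} {x' : V}
    {s : ℝ} (h : HasDerivAt x x' (-s)) : HasDerivAt (fun s => x (-s)) (-x') s := by
  have := h.scomp s (hasDerivAt_neg s)
  rwa [neg_one_smul] at this

/-! ### Application to the discontinuous system, in both time directions. -/

namespace DiscSystem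

variable {n m : ℕ} (S : DiscSystem n m)

theorem level_of_le {ℓ : ℤ} (h : -(S.M : ℤ) ≤ ℓ) : S.level ℓ = S.c ℓ := if_neg h.not_gt

theorem derivBdd_h : DerivBdd univ S.r fun _ => S.h := .of_contDiff S.h_contDiff S.h_bdd

theorem exists_lipschitz_h : ∃ C, 0 ≤ C ∧ ∀ x x' y, |S.h (x', y) - S.h (x, y)| ≤ C * ‖x' - x‖ := by
  have h := S.derivBdd_h.of_le (k' := 1) (one_le_two.trans S.two_le_r)
  obtain ⟨C, hC0, hC⟩ := h.exists_lipschitz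
  exact ⟨C, hC0, fun x x' y => by simpa [Prod.norm_def] using hC 0 trivial (x, y) (x', y)⟩

variable {S} {up um : ℝ → EuclideanSpace ℝ (Fin m) → EuclideanSpace ℝ (Fin n)}
  {t : ℤ → EuclideanSpace ℝ (Fin m) → ℝ}
  {wp wm : EuclideanSpace ℝ (Fin m) → EuclideanSpace ℝ (Fin n)}

/-- Once the solution is within `μ / (C + 1)` of `wp`, with `C` a Lipschitz constant of `h`, the gap
in A2 gives `h > c_{N-1}`; the last crossing, where equality holds, must come earlier. -/
theorem exists_forall_time_le (hup : S.IsForwardSolution up t) (hA2 : S.A2 up um wp wm) :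
    ∃ T, ∀ y, t S.N y ≤ T := by
  obtain ⟨-, -, -, -, ⟨μ, hμ, hgap⟩, hlim, -⟩ := hA2
  rcases Nat.eq_zero_or_pos S.N with hN | hN
  · exact ⟨0, fun y => by rw [hN]; exact (hup.t_zero y).le⟩
  obtain ⟨C, hC0, hC⟩ := S.exists_lipschitz_h
  obtain ⟨T, hT⟩ := eventually_atTop.1 (Metric.tendstoUniformly_iff.1 hlim (μ / (C + 1))
    (by positivity))
  refine ⟨T, fun y => ?_⟩
  by_contra! hlt
  have h1 := hT _ hlt.le y
  rw [dist_eq_norm, lt_div_iff₀ (by positivity)] at h1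
  have h2 := (abs_le.1 (hC (up (t S.N y) y) (wp y) y)).2
  have h3 := hup.crossing S.N (by omega) le_rfl y
  have h4 := (hgap y).1
  rw [S.level_of_le (by omega), ← EReal.coe_add, EReal.coe_lt_coe_iff] at h4
  nlinarith [norm_nonneg (wp y - up (t S.N y) y)]

theorem exists_forall_le_time (hum : S.IsBackwardSolution um t) (hA2 : S.A2 up um wp wm) :
    ∃ T, ∀ y, -t (-(S.M : ℤ)) y ≤ T := by
  obtain ⟨-, -, -, -, ⟨μ, hμ, hgap⟩, -, hlim⟩ := hA2
  rcases Nat.eq_zero_or_pos S.M with hM | hM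
  · exact ⟨0, fun y => by simp [hM, hum.t_zero y]⟩
  obtain ⟨C, hC0, hC⟩ := S.exists_lipschitz_h
  obtain ⟨T, hT⟩ := eventually_atBot.1 (Metric.tendstoUniformly_iff.1 hlim (μ / (C + 1))
    (by positivity))
  refine ⟨-T, fun y => ?_⟩
  by_contra! hlt
  have h1 := hT _ (neg_lt_neg_iff.1 hlt).le y
  rw [dist_eq_norm, lt_div_iff₀ (by positivity)] at h1
  have h2 := (abs_le.1 (hC (um (t (-(S.M : ℤ)) y) y) (wm y) y)).1
  have h3 := hum.crossing (-(S.M : ℤ)) le_rfl (by omega) y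
  have h4 := (hgap y).2
  nlinarith [norm_nonneg (wm y - um (t (-(S.M : ℤ)) y) y)]

theorem IsForwardSolution.contDiffAt_and_bound_tail (hup : S.IsForwardSolution up t)
    (hA1 : S.A1 up um) (hA2 : S.A2 up um wp wm) (hA3 : S.A3 wp wm)
    {v : ℝ → EuclideanSpace ℝ (Fin m) → EuclideanSpace ℝ (Fin n)} (hv : S.IsForwardTail up t v) :
    (∀ y s, t S.N y ≤ s → ContDiffAt ℝ S.r (v s) y) ∧
      ∀ k ≤ S.r, ∃ C, ∀ y s, t S.N y ≤ s → ‖iteratedFDeriv ℝ k (v s) y‖ ≤ C := by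
  obtain ⟨hu0, -, B, hBo, -, hB, hBΩ⟩ := hA1
  obtain ⟨T, hT⟩ := exists_forall_time_le hup hA2
  obtain ⟨hwp, -, ⟨C, hC⟩, -, -, hlim, -⟩ := hA2
  obtain ⟨k, δ, hδ, hspec⟩ := hA3
  obtain ⟨η, hη, htr⟩ := hup.transversal
  -- Two derivatives are needed: the remainder estimate near the equilibria uses a Lipschitz bound
  -- for the derivative of the vector field.
  obtain ⟨r, hr⟩ : ∃ r, S.r = r + 2 := ⟨S.r - 2, by have := S.two_le_r; omega⟩
  have hg : ∀ i ≤ S.N, BddWithDerivs (r + 2) (S.f i) := fun i hi =>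
    hr ▸ S.f_bdd i (by omega) (by omega)
  have hh := S.derivBdd_h
  rw [hr] at hu0 hh ⊢
  have hfd : ∀ (c : ℝ) y x, fderiv ℝ (fun x => S.h (x, y) - c) x =
      fderiv ℝ (fun x => S.h (x, y)) x :=
    fun c y x => fderiv_sub_const c
  refine contDiffAt_and_bound_of_crossings (L := S.N) (g := fun i => S.f i) (τ := fun i => t i)
    (u := up) (q := fun i z => S.h z - S.c i) (O := B ×ˢ univ) (w := wp) (η := η) (δ := δ) hg
    (fun i _ => hh.sub (.const _)) hu0 hup.t_zero (fun i hi y => ?_) ⟨T, hT⟩ hup.cont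
    (fun i hi y s hs => ?_) (fun i hi y s hs => ?_) (fun i hi y => ?_) hη (fun i hi y => ?_)
    (hBo.prod isOpen_univ) (fun y => ⟨(hB y).1, trivial⟩) (fun hN y hmem => ?_)
    (fun i hi hi0 y => ?_) (fun y s hs => hup.deriv_last y s hs) (fun y => (hv y).1)
    (fun y s hs => (hv y).2 s hs) hwp.continuous ⟨C, fun y => (hC y).1⟩ (fun ε hε => ?_) hδ
    (fun y => (hspec y).1.2.2)
  · exact_mod_cast hup.t_lt i (by omega) (by omega) y
  · have := hup.deriv (i + 1) (by omega) (by omega) y s (by simpa using hs.1) (by simpa using hs.2)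
    rwa [add_sub_cancel_right] at this
  · have := (hup.between i (by omega) (by omega) y s hs.1 (by simpa using hs.2)).2
    rw [S.level_of_le (by omega), EReal.coe_lt_coe_iff] at this
    exact sub_neg.2 this
  · have := hup.crossing (i + 1) (by omega) (by omega) y
    rw [add_sub_cancel_right] at this
    simpa [sub_eq_zero] using this
  · have := (htr (i + 1) (by omega) (by omega) y).1
    rw [add_sub_cancel_right, hx] at this
    rw [hfd]
    push_cast
    linarith
  -- The first forward crossing has `h = c_0`, whereas `h < c_0` on `B`.
  · have h1 := (hBΩ ⟨subset_closure hmem.1, trivial⟩ : _ ∈ S.region 0).2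
    have h2 := hup.crossing 1 le_rfl (by omega) y
    rw [S.level_of_le (by omega), EReal.coe_lt_coe_iff] at h1
    simp only [sub_self, Nat.cast_one] at h1 h2
    exact h1.ne h2
  · have h1 := hup.crossing i (by omega) (by omega) y
    have h2 := S.c_lt (i - 1) (by omega) (by omega)
    rw [sub_add_cancel] at h2
    exact sub_neg.2 (h1.trans_lt h2)
  · obtain ⟨T', hT'⟩ := eventually_atTop.1 (Metric.tendstoUniformly_iff.1 hlim ε hε)
    exact ⟨T', fun s hs y => by simpa [dist_eq_norm, norm_sub_rev] using hT' s hs y⟩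

/-- `Ω_0` contains its lower boundary `h = c_{-1}`, so the strict inequality of the forward case is
not available. Instead, a crossing point in the open set `B` would be a local minimum of `h(·, y)`,
forcing `h_x = 0` against transversality. -/
theorem IsBackwardSolution.first_crossing_notMem (hum : S.IsBackwardSolution um t)
    {B : Set (EuclideanSpace ℝ (Fin n))} (hBo : IsOpen B) (hBΩ : closure B ×ˢ univ ⊆ S.region 0)
    (hM : 0 < S.M) (y : EuclideanSpace ℝ (Fin m)) : um (t (-1) y) y ∉ B := by
  intro hmem
  obtain ⟨η, hη, htr⟩ := hum.transversal
  have hmin : IsLocalMin (fun x => S.h (x, y)) (um (t (-1) y) y) := by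
    filter_upwards [hBo.mem_nhds hmem] with x hx
    have h1 := (hBΩ ⟨subset_closure hx, trivial⟩ : (x, y) ∈ S.region 0).1
    rw [S.level_of_le (by omega), EReal.coe_le_coe_iff] at h1
    exact (hum.crossing (-1) (by omega) le_rfl y).trans_le (by simpa using h1)
  have h2 := (htr (-1) (by omega) le_rfl y).1
  rw [DiscSystem.hx, hmin.fderiv_eq_zero] at h2
  simp only [_root_.zero_apply] at h2
  linarith

theorem IsBackwardSolution.contDiffAt_and_bound_tail (hum : S.IsBackwardSolution um t)
    (hA1 : S.A1 up um) (hA2 : S.A2 up um wp wm) (hA3 : S.A3 wp wm)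
    {v : ℝ → EuclideanSpace ℝ (Fin m) → EuclideanSpace ℝ (Fin n)} (hv : S.IsBackwardTail um t v) :
    (∀ y s, s ≤ t (-(S.M : ℤ)) y → ContDiffAt ℝ S.r (v s) y) ∧
      ∀ k ≤ S.r, ∃ C, ∀ y s, s ≤ t (-(S.M : ℤ)) y → ‖iteratedFDeriv ℝ k (v s) y‖ ≤ C := by
  obtain ⟨-, hu0, B, hBo, -, hB, hBΩ⟩ := hA1
  obtain ⟨T, hT⟩ := exists_forall_le_time hum hA2
  obtain ⟨-, hwm, ⟨C, hC⟩, -, -, -, hlim⟩ := hA2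
  obtain ⟨k, δ, hδ, hspec⟩ := hA3
  obtain ⟨η, hη, htr⟩ := hum.transversal
  obtain ⟨r, hr⟩ : ∃ r, S.r = r + 2 := ⟨S.r - 2, by have := S.two_le_r; omega⟩
  have hg : ∀ i ≤ S.M, BddWithDerivs (r + 2) fun z => -S.f (-(i : ℤ)) z := fun i hi =>
    hr ▸ (S.f_bdd (-i) (by omega) (by omega)).neg
  have hh := S.derivBdd_h
  rw [hr] at hu0 hh ⊢
  have hfd : ∀ (c : ℝ) y x,
      fderiv ℝ (fun x => c - S.h (x, y)) x = -fderiv ℝ (fun x => S.h (x, y)) x :=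
    fun c y x => fderiv_const_sub c
  have hcast : ∀ i : ℕ, -((i + 1 : ℕ) : ℤ) + 1 = -(i : ℤ) := fun i => by push_cast; ring
  suffices H : (∀ y s, -t (-(S.M : ℤ)) y ≤ s → ContDiffAt ℝ (r + 2 : ℕ) (v (-s)) y) ∧
      ∀ k ≤ r + 2, ∃ C, ∀ y s, -t (-(S.M : ℤ)) y ≤ s → ‖iteratedFDeriv ℝ k (v (-s)) y‖ ≤ C by
    refine ⟨fun y s hs => by simpa using H.1 y (-s) (neg_le_neg hs), fun k hk => ?_⟩
    obtain ⟨C, hC⟩ := H.2 k hk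
    exact ⟨C, fun y s hs => by simpa using hC y (-s) (neg_le_neg hs)⟩
  -- Time reversal negates the vector fields, and `h` now decreases through `c_{-1}, c_{-2}, …`; the
  -- hypersurface reached at the end of piece `i` has level `-(i + 1)`.
  refine contDiffAt_and_bound_of_crossings (L := S.M) (g := fun i z => -S.f (-(i : ℤ)) z)
    (τ := fun i y => -t (-(i : ℤ)) y) (u := fun s => um (-s)) (v := fun s => v (-s))
    (q := fun i z => S.c (-((i + 1 : ℕ) : ℤ)) - S.h z) (O := B ×ˢ univ) (w := wm) (η := η)
    (δ := δ) hg (fun i _ => (DerivBdd.const _).sub hh) (by simpa using hu0)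
    (fun y => by simp [hum.t_zero y]) (fun i hi y => ?_) ⟨T, hT⟩ (fun y => ?_)
    (fun i hi y s hs => ?_) (fun i hi y s hs => ?_) (fun i hi y => ?_) hη (fun i hi y => ?_)
    (hBo.prod isOpen_univ) (fun y => ⟨by simpa using (hB y).2, trivial⟩) (fun hM y hmem => ?_)
    (fun i hi hi0 y => ?_) (fun y s hs => ?_) (fun y => ?_)
    (fun y s hs => ?_) hwm.continuous ⟨C, fun y => (hC y).2⟩ (fun ε hε => ?_) hδ
    (fun y z hz => ?_)
  · have := hum.t_lt (-((i + 1 : ℕ) : ℤ)) (by omega) (by omega) y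
    rw [hcast] at this
    exact neg_lt_neg this
  · exact (hum.cont y).comp continuous_neg.continuousOn fun s hs => neg_nonpos.2 (mem_Ici.1 hs)
  · have := hum.deriv (-((i + 1 : ℕ) : ℤ)) (by omega) (by omega) y (-s) (lt_neg_of_lt_neg hs.2)
      (by rw [hcast]; exact neg_lt_of_neg_lt hs.1)
    rw [hcast] at this
    exact HasDerivAt.reflect this
  · have := (hum.between (-((i + 1 : ℕ) : ℤ)) (by omega) (by omega) y (-s) (lt_neg_of_lt_neg hs.2)
      (by rw [hcast]; exact neg_lt_of_neg_lt hs.1)).1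
    exact sub_neg.2 this
  · simpa [sub_eq_zero] using (hum.crossing (-((i + 1 : ℕ) : ℤ)) (by omega) (by omega) y).symm
  -- In reversed time the crossing is approached from its right-hand side, hence the second
  -- transversality inequality. The signs from reversing `h` and the field cancel.
  · have := (htr (-((i + 1 : ℕ) : ℤ)) (by omega) (by omega) y).2
    rw [hcast, hx] at this
    rw [hfd, neg_neg, _root_.neg_apply, map_neg, neg_neg]
    linarith
  · exact hum.first_crossing_notMem hBo hBΩ hM y (by simpa using hmem.1)
  · have h1 := hum.crossing (-(i : ℤ)) (by omega) (by omega) y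
    have h2 := S.c_lt (-((i + 1 : ℕ) : ℤ)) (by omega) (by omega)
    rw [hcast] at h2
    rw [neg_neg, h1]
    exact sub_neg.2 h2
  · exact HasDerivAt.reflect (hum.deriv_last y (-s) (neg_lt_of_neg_lt hs))
  · simpa using (hv y).1
  · have := ((hv y).2 (-s) (neg_nonpos.2 hs)).scomp (t' := Iic 0) (s := Ici 0) s
      (hasDerivAt_neg s).hasDerivWithinAt fun s hs => neg_nonpos.2 (mem_Ici.1 hs)
    rwa [neg_one_smul] at this
  · obtain ⟨T', hT'⟩ := eventually_atBot.1 (Metric.tendstoUniformly_iff.1 hlim ε hε)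
    exact ⟨-T', fun s hs y => by
      simpa [dist_eq_norm, norm_sub_rev] using hT' (-s) (neg_le_of_neg_le hs) y⟩
  · rw [show fderiv ℝ (fun x => -S.f (-(S.M : ℤ)) (x, y)) (wm y)
      = -fderiv ℝ (fun x => S.f (-(S.M : ℤ)) (x, y)) (wm y) from fderiv_fun_neg] at hz
    simpa using (hspec y).2.2.2 _ (neg_mem_complexEigenvalues hz)

end DiscSystem

theorem lemma4p2 {n m : ℕ} (S : DiscSystem n m)
    (up um : ℝ → EuclideanSpace ℝ (Fin m) → EuclideanSpace ℝ (Fin n))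
    (t : ℤ → EuclideanSpace ℝ (Fin m) → ℝ)
    (wp wm : EuclideanSpace ℝ (Fin m) → EuclideanSpace ℝ (Fin n))
    (hup : S.IsForwardSolution up t) (hum : S.IsBackwardSolution um t)
    (hA1 : S.A1 up um) (hA2 : S.A2 up um wp wm) (hA3 : S.A3 wp wm)
    (uN uM : ℝ → EuclideanSpace ℝ (Fin m) → EuclideanSpace ℝ (Fin n))
    (huN : S.IsForwardTail up t uN) (huM : S.IsBackwardTail um t uM) :
    ((∀ y s, t S.N y ≤ s → ContDiffAt ℝ S.r (uN s) y) ∧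
      ∀ k : ℕ, k ≤ S.r → ∃ C : ℝ, ∀ y s, t S.N y ≤ s →
        ‖iteratedFDeriv ℝ k (uN s) y‖ ≤ C) ∧
    ((∀ y s, s ≤ t (-(S.M : ℤ)) y → ContDiffAt ℝ S.r (uM s) y) ∧
      ∀ k : ℕ, k ≤ S.r → ∃ C : ℝ, ∀ y s, s ≤ t (-(S.M : ℤ)) y →
        ‖iteratedFDeriv ℝ k (uM s) y‖ ≤ C) :=
  ⟨hup.contDiffAt_and_bound_tail hA1 hA2 hA3 huN, hum.contDiffAt_and_bound_tail hA1 hA2 hA3 huM⟩
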